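/- Conventions. Vectors and matrices carry the norm $\|M\|=\max_{i,j}|M_{ij}|$ and $\|M\|_p=\mathbb E(\|M\|^p)^{1/p}$. For functions of $\varepsilon>0$ write $G\sim H$ with ratio $c$ if $\lim_{\varepsilon\to0}G(\varepsilon)/H(\varepsilon)=c\in(0,\infty)$. A speed is a function $\rho(\varepsilon)>0$ with $\rho(\varepsilon)\to0$ as $\varepsilon\to0$. Setups. An indirect observability setup in $\mathbb R^r$ with speed $\rho$ consists of a strictly stationary process $(X_t)_{t\ge0}$ and processes $(Y^\varepsilon_t)_{t\ge0}$, $\varepsilon>0$, on a common probability space, such that $\|X_t\|_4\le\nu$, $\|Y^\varepsilon_t\|_4\le\nu$ and $\|Y^\varepsilon_t-X_t\|_4\le\rho(\varepsilon)$ for all $t\ge0$, $\varepsilon>0$, and such that the lagged covariances $K(u)=\mathbb E(X_tX_{t+u}^*)-\mu\mu^*$, $\mu=\mathbb E X_t$, are Lipschitz on every $[0,B]$, with constant $\Lambda(B)$. The process $X$ has integrable decorrelation rate $f$ if $f:(0,\infty)\to(0,\infty)$ is continuous and decreasing, $I(f)=\int_1^\infty f(T)\,dT<\infty$, and for any two time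 intervals $U,V\subset[0,\infty)$ with gap $T=\inf_{s\in U,\,t\in V}(t-s)>0$ one has $|\mathbb E(GH)-\mathbb E(G)\mathbb E(H)|\le f(T)$ whenever $G$ is of the form $X_s(i)$ or $X_s(i)X_{s'}(j)$ with $s,s'\in U$, and $H$ is of the same form with times in $V$. Schemes and estimators. An adaptive sub-sampling scheme is a pair $N(\varepsilon)\in\mathbb N$, $\Delta(\varepsilon)>0$ with $\Delta\to0$ and $N\Delta\to\infty$ as $\varepsilon\to0$. With $\kappa$ the closest integer to $u/\Delta$, put $$\bar Y^\varepsilon=\frac1N\sum_{n=1}^NY^\varepsilon_{n\Delta},\qquad \tau_u\bar Y^\varepsilon=\frac1N\sum_{n=1}^NY^\varepsilon_{(n+\kappa)\Delta},\qquad \hat K^\varepsilon_Y(u)=\frac1N\sum_{n=1}^NY^\varepsilon_{n\Delta}(Y^\varepsilon_{(n+\kappa)\Delta})^*-\bar Y^\varepsilon(\tau_u\bar Y^\varepsilon)^*.$$ A scheme is optimized for $\rho$ if $N\sim\rho^{-3}$ with some ratio $a$ and $\Delta\sim\rho$ with some ratio $b$ (hence also $\Delta\sim N^{-1/3}$). Theorem.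 (0) For every speed $\rho$ and all $a,b>0$ there are optimized schemes with ratios $a,b$, and every optimized scheme is an adaptive sub-sampling scheme. (1) For every $r,A,\nu,J,\Lambda,a,b$ there is a constant $C$, depending on nothing else, such that for every setup in $\mathbb R^r$ with bounds $\nu,\Lambda$ and any speed $\rho$, whose process $X$ has an integrable decorrelation rate $f$ with $I(f)\le J$, and for every optimized scheme with ratios $a,b$, one has for all sufficiently small $\varepsilon>0$ $$\|\hat K^\varepsilon_Y(u)-K(u)\|_2\le C\rho(\varepsilon)\ \text{ for all }0\le u\le A,\qquad \|\bar Y^\varepsilon-\mu\|_2\le C\rho(\varepsilon).$$ (2) This speed is the best achievable, in the worst case over the setups, and the optimized schemes minimize the growth of the observational time span $S=N\Delta$: for all $r\ge1$ and $\nu,\lambda,J>0$ there are constants $c(u)>0$, $u\ge0$, such that for every speed $\rho$ there is a setup in $\mathbb R^r$ with speed $\rho$, with $L^4$ bound $\nu$, with $K$ Lipschitz on $[0,\infty)$ with constant $\lambda$, and with an integrable decorrelation rate $f$ such that $I(f)\le J$, for which the following holds for every $u\ge0$ and every adaptive sub-sampling scheme $(N,\Delta)$: first, $\|\hat K^\varepsilon_Y(u)-K(u)\|_2\ge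 c(u)\rho(\varepsilon)$ for all sufficiently small $\varepsilon>0$; second, if $\|\hat K^\varepsilon_Y(u)-K(u)\|_2=O(\rho(\varepsilon))$ as $\varepsilon\to0$, then every optimized scheme $(N',\Delta')$ satisfies $N'\Delta'=O(N\Delta)$ as $\varepsilon\to0$. -/

import Mathlib

/-! The estimation error has three sources. Replacing `X` by `Y` costs `O(ρ)` in `L²`, because the
estimator is quadratic and the fourth moments are bounded. Rounding the lag to a multiple of `Δ`
costs `O(Δ)`, because `K` is Lipschitz. The random fluctuation costs `O((N Δ) ^ (-1/2))`, because
decorrelation at an integrable rate makes the covariances of the sampled products summable, with a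
sum of order `1 / Δ`. The three terms are of order `ρ` when `Δ ∼ ρ` and `N ∼ ρ⁻³`.

Neither `ρ` nor the span `N Δ ∼ ρ⁻²` can be improved for an Ornstein–Uhlenbeck process observed up
to a random factor `1 ± ρ`. The factor multiplies the estimated covariance by `(1 ± ρ) ^ 2`, hence
the error `ρ`. All four-point moments are explicit by Wick's formula, so the variance of the
empirical covariance is at least a multiple of `1 / (N Δ)`, and an error `O(ρ)` forces
`ρ⁻² = O(N Δ)`. -/

open MeasureTheory Filter Topology
open scoped NNReal ENNReal

namespace IndirectObs

noncomputable section

open scoped Matrix.Norms.Elementwise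

/-- Similarity at `ε → 0⁺` with limiting ratio `c`: `G(ε) / H(ε) → c`, finite and strictly positive. -/
def SimilarWith (c : ℝ) (G H : ℝ → ℝ) : Prop :=
  0 < c ∧ Tendsto (fun ε => G ε / H ε) (𝓝[>] 0) (𝓝 c)

/-- A speed function: positive for `ε > 0`, tending to zero as `ε → 0⁺`. -/
def IsSpeed (ρ : ℝ → ℝ) : Prop :=
  (∀ ε, 0 < ε → 0 < ρ ε) ∧ Tendsto ρ (𝓝[>] 0) (𝓝 0)

/-- Adaptive sub-sampling scheme: `Δ(ε) > 0`, `Δ(ε) → 0` and `N(ε) Δ(ε) → ∞`. -/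
structure IsAdaptiveScheme (N : ℝ → ℕ) (Δ : ℝ → ℝ≥0) : Prop where
  step_pos : ∀ ε, 0 < ε → 0 < Δ ε
  step_tendsto : Tendsto Δ (𝓝[>] 0) (𝓝 0)
  span_tendsto : Tendsto (fun ε => (N ε : ℝ) * (Δ ε : ℝ)) (𝓝[>] 0) atTop

/-- Optimized scheme for the speed `ρ`: `N(ε) ∼ ρ(ε)⁻³` and `Δ(ε) ∼ ρ(ε)`, with limiting
ratios `a` and `b` (so that `Δ(ε) ∼ N(ε)^(-1/3)` as well). -/
structure IsOptimizedScheme (ρ : ℝ → ℝ) (a b : ℝ) (N : ℝ → ℕ) (Δ : ℝ → ℝ≥0) : Prop where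
  step_pos : ∀ ε, 0 < ε → 0 < Δ ε
  number_similar : SimilarWith a (fun ε => (N ε : ℝ)) (fun ε => 1 / ρ ε ^ 3)
  step_similar : SimilarWith b (fun ε => (Δ ε : ℝ)) ρ

/-- The closest integer to `u / Δ`. -/
def lagIndex (Δ u : ℝ≥0) : ℕ := ⌊u / Δ + 1 / 2⌋₊

section Estimators

variable {Ω : Type*} {r : ℕ}

/-- The empirical mean of `Z_Δ, Z_{2Δ}, …, Z_{NΔ}`. -/
def empMean (Z : ℝ≥0 → Ω → Fin r → ℝ) (N : ℕ) (Δ : ℝ≥0) (ω : Ω) : Fin r → ℝ :=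
  (N : ℝ)⁻¹ • ∑ n ∈ Finset.Icc 1 N, Z ((n : ℝ≥0) * Δ) ω

/-- The empirical mean shifted in time by the lag `κ Δ` that approximates `u`. -/
def shiftedEmpMean (Z : ℝ≥0 → Ω → Fin r → ℝ) (N : ℕ) (Δ u : ℝ≥0) (ω : Ω) : Fin r → ℝ :=
  (N : ℝ)⁻¹ • ∑ n ∈ Finset.Icc 1 N, Z (((n + lagIndex Δ u : ℕ) : ℝ≥0) * Δ) ω

/-- The sub-sampled empirical covariance matrix at lag `u`. -/
def empCov (Z : ℝ≥0 → Ω → Fin r → ℝ) (N : ℕ) (Δ u : ℝ≥0) (ω : Ω) :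
    Matrix (Fin r) (Fin r) ℝ :=
  (N : ℝ)⁻¹ • ∑ n ∈ Finset.Icc 1 N,
      Matrix.vecMulVec (Z ((n : ℝ≥0) * Δ) ω) (Z (((n + lagIndex Δ u : ℕ) : ℝ≥0) * Δ) ω)
    - Matrix.vecMulVec (empMean Z N Δ ω) (shiftedEmpMean Z N Δ u ω)

end Estimators

section Processes

variable {Ω : Type*} [MeasurableSpace Ω] {r : ℕ}

/-- The mean vector of a stationary process. -/
def mean (P : Measure Ω) (X : ℝ≥0 → Ω → Fin r → ℝ) : Fin r → ℝ :=
  fun i => ∫ ω, X 0 ω i ∂P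

/-- The lagged covariance matrix `K(u) = E(X_t X_{t+u}^*) - μ μ^*` of a stationary process
(read at `t = 0`). -/
def lagCov (P : Measure Ω) (X : ℝ≥0 → Ω → Fin r → ℝ) (u : ℝ≥0) : Matrix (Fin r) (Fin r) ℝ :=
  Matrix.of fun i j => (∫ ω, X 0 ω i * X u ω j ∂P) - mean P X i * mean P X j

/-- Strict stationarity: the finite-dimensional laws are invariant under time shifts. -/
def IsStrictlyStationary (P : Measure Ω) (X : ℝ≥0 → Ω → Fin r → ℝ) : Prop :=
  ∀ (n : ℕ) (t : Fin n → ℝ≥0) (h : ℝ≥0),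
    P.map (fun ω k => X (t k + h) ω) = P.map (fun ω k => X (t k) ω)

/-- The random variables `X_s(i)` and `X_s(i) X_t(j)` with `s, t ∈ U`. -/
def lowMoments (X : ℝ≥0 → Ω → Fin r → ℝ) (U : Set ℝ≥0) : Set (Ω → ℝ) :=
  {G | (∃ s ∈ U, ∃ i, G = fun ω => X s ω i) ∨
       (∃ s ∈ U, ∃ t ∈ U, ∃ i j, G = fun ω => X s ω i * X t ω j)}

/-- `X` has integrable decorrelation rate `f`: for time intervals `U`, `V` separated by a time
gap `T = inf (v - u) > 0`, all `G ∈ F_U`, `H ∈ F_V` satisfy `|E(GH) - E(G)E(H)| ≤ f(T)`. -/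
structure HasIntegrableDecorrelationRate (P : Measure Ω) (X : ℝ≥0 → Ω → Fin r → ℝ)
    (f : ℝ → ℝ) : Prop where
  pos : ∀ T, 0 < T → 0 < f T
  antitone : AntitoneOn f (Set.Ioi 0)
  continuous : ContinuousOn f (Set.Ioi 0)
  integrable : IntegrableOn f (Set.Ioi 1)
  decorrelation : ∀ U V : Set ℝ≥0, U.OrdConnected → V.OrdConnected → ∀ T : ℝ, 0 < T →
    IsGLB {d : ℝ | ∃ s ∈ U, ∃ t ∈ V, d = (t : ℝ) - (s : ℝ)} T →
    ∀ G ∈ lowMoments X U, ∀ H ∈ lowMoments X V,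
      |(∫ ω, G ω * H ω ∂P) - (∫ ω, G ω ∂P) * ∫ ω, H ω ∂P| ≤ f T

/-- Indirect observability setup `X_t = lim Y^ε_t` with uniform `L⁴`-speed `ρ`, where `ν` bounds
all the `L⁴` norms and `Λ B` is a Lipschitz constant of the lagged covariances on `[0, B]`.
Vectors and matrices carry the norm `max |entry|`. -/
structure IsSetup (P : Measure Ω) (X : ℝ≥0 → Ω → Fin r → ℝ) (Y : ℝ → ℝ≥0 → Ω → Fin r → ℝ)
    (ρ : ℝ → ℝ) (ν : ℝ≥0) (Λ : ℝ≥0 → ℝ≥0) : Prop where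
  measurable_X : ∀ t, Measurable (X t)
  measurable_Y : ∀ ε, 0 < ε → ∀ t, Measurable (Y ε t)
  stationary : IsStrictlyStationary P X
  bound_X : ∀ t, eLpNorm (X t) 4 P ≤ ν
  bound_Y : ∀ ε, 0 < ε → ∀ t, eLpNorm (Y ε t) 4 P ≤ ν
  isSpeed : IsSpeed ρ
  speed : ∀ ε, 0 < ε → ∀ t, eLpNorm (fun ω => Y ε t ω - X t ω) 4 P ≤ ENNReal.ofReal (ρ ε)
  lipschitz : ∀ B, LipschitzOnWith (Λ B) (lagCov P X) (Set.Iic B)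

/-- The `L²` error of the observable covariance estimator at lag `u`. -/
def covError (P : Measure Ω) (X : ℝ≥0 → Ω → Fin r → ℝ) (Y : ℝ → ℝ≥0 → Ω → Fin r → ℝ)
    (N : ℝ → ℕ) (Δ : ℝ → ℝ≥0) (u : ℝ≥0) (ε : ℝ) : ℝ≥0∞ :=
  eLpNorm (fun ω => empCov (Y ε) (N ε) (Δ ε) u ω - lagCov P X u) 2 P

/-- The `L²` error of the observable empirical mean. -/
def meanError (P : Measure Ω) (X : ℝ≥0 → Ω → Fin r → ℝ) (Y : ℝ → ℝ≥0 → Ω → Fin r → ℝ)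
    (N : ℝ → ℕ) (Δ : ℝ → ℝ≥0) (ε : ℝ) : ℝ≥0∞ :=
  eLpNorm (fun ω => empMean (Y ε) (N ε) (Δ ε) ω - mean P X) 2 P

end Processes

/-- The observational time span `N(ε) Δ(ε)`. -/
def span (N : ℝ → ℕ) (Δ : ℝ → ℝ≥0) (ε : ℝ) : ℝ := (N ε : ℝ) * (Δ ε : ℝ)

end

end IndirectObs

namespace IndirectObs

section Isonormal

open ProbabilityTheory

variable {Ω : Type*} [MeasurableSpace Ω] {P : Measure Ω}

theorem continuous_charFun_map_Lp [IsProbabilityMeasure P] (t : ℝ) :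
    Continuous fun g : Lp ℝ 2 P => charFun (P.map g) t := by
  refine continuous_iff_seqContinuous.2 fun g g₀ hg => ?_
  have hlaw := (tendstoInMeasure_of_tendsto_Lp hg).tendstoInDistribution
    fun n => (Lp.aestronglyMeasurable (g n)).aemeasurable
  exact ProbabilityMeasure.tendsto_iff_tendsto_charFun.1 hlaw.tendsto t

theorem isClosed_setOf_map_eq_gaussianReal [IsProbabilityMeasure P] :
    IsClosed {g : Lp ℝ 2 P | P.map g = gaussianReal 0 (‖g‖₊ ^ 2)} := by
  have heq : {g : Lp ℝ 2 P | P.map g = gaussianReal 0 (‖g‖₊ ^ 2)} =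
      ⋂ t : ℝ, {g : Lp ℝ 2 P | charFun (P.map g) t = Complex.exp (-(‖g‖ ^ 2 * t ^ 2 / 2 : ℝ))} := by
    ext g
    have : IsProbabilityMeasure (P.map g) :=
      Measure.isProbabilityMeasure_map (Lp.aestronglyMeasurable g).aemeasurable
    have hiff : P.map g = gaussianReal 0 (‖g‖₊ ^ 2) ↔
        charFun (P.map g) = charFun (gaussianReal 0 (‖g‖₊ ^ 2)) :=
      ⟨congrArg charFun, Measure.ext_of_charFun⟩
    simp [hiff, funext_iff, charFun_gaussianReal]
  rw [heq]
  exact isClosed_iInter fun t => isClosed_eq (continuous_charFun_map_Lp t) (by fun_prop)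

theorem map_eq_gaussianReal_of_hasGaussianLaw {g : Lp ℝ 2 P} (hg : HasGaussianLaw g P)
    (hmean : ∫ ω, g ω ∂P = 0) : P.map g = gaussianReal 0 (‖g‖₊ ^ 2) := by
  have hvar : Var[g; P] = ‖g‖ ^ 2 := by
    rw [variance_of_integral_eq_zero hg.aemeasurable hmean, ← real_inner_self_eq_norm_sq,
      L2.inner_def]
    simp [pow_two]
  rw [hg.map_eq_gaussianReal, hmean, hvar]
  congr 1
  ext
  simp

theorem coeFn_sum_smul {ι : Type*} (s : Finset ι) (c : ι → ℝ) (g : ι → Lp ℝ 2 P) :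
    (∑ i ∈ s, c i • g i : Lp ℝ 2 P) =ᵐ[P] fun ω => ∑ i ∈ s, c i * g i ω := by
  have hsmul : ∀ᵐ ω ∂P, ∀ i ∈ s, (c i • g i : Lp ℝ 2 P) ω = c i * g i ω :=
    (ae_ball_iff s.countable_toSet).2 fun i _ => Lp.coeFn_smul (c i) (g i)
  filter_upwards [Lp.coeFn_finsetSum s fun i => c i • g i, hsmul] with ω hsum hω
  rw [hsum, Finset.sum_apply]
  exact Finset.sum_congr rfl hω

theorem hasGaussianLaw_of_mem_span {ι : Type*} {e : ι → Lp ℝ 2 P}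
    (he : IsGaussianProcess (fun i => e i) P) {g : Lp ℝ 2 P}
    (hg : g ∈ Submodule.span ℝ (Set.range e)) : HasGaussianLaw g P := by
  obtain ⟨c, rfl⟩ := Finsupp.mem_span_range_iff_exists_finsupp.1 hg
  exact (he.smul c).hasGaussianLaw_fun_sum.congr (coeFn_sum_smul c.support c e).symm

theorem isGaussianProcess_of_iIndepFun {ι : Type*} {X : ι → Ω → ℝ}
    (hX : ∀ i, HasGaussianLaw (X i) P) (hind : iIndepFun X P) : IsGaussianProcess X P where
  hasGaussianLaw I := iIndepFun.hasGaussianLaw (fun i : I => hX i)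
    (hind.precomp Subtype.val_injective)

theorem integral_eq_zero_of_mem_span [IsProbabilityMeasure P] {s : Set (Lp ℝ 2 P)}
    (hs : ∀ f ∈ s, ∫ ω, f ω ∂P = 0) {g : Lp ℝ 2 P} (hg : g ∈ Submodule.span ℝ s) :
    ∫ ω, g ω ∂P = 0 := by
  have hint (f : Lp ℝ 2 P) : Integrable f P := (Lp.memLp f).integrable one_le_two
  induction hg using Submodule.span_induction with
  | mem f hf => exact hs f hf
  | zero => rw [integral_congr_ae (Lp.coeFn_zero ℝ 2 P)]; simp
  | add f g _ _ hf hg =>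
    rw [integral_congr_ae (Lp.coeFn_add f g), integral_add' (hint f) (hint g), hf, hg, add_zero]
  | smul c f _ hf =>
    rw [integral_congr_ae (Lp.coeFn_smul c f)]
    simp [integral_const_mul, hf]

theorem exists_orthonormal_isGaussianProcess (ι : Type*) :
    ∃ (P : Measure (ι → ℝ)) (_ : IsProbabilityMeasure P) (e : ι → Lp ℝ 2 P),
      Orthonormal ℝ e ∧ IsGaussianProcess (fun i => e i) P ∧ ∀ i, ∫ ω, e i ω ∂P = 0 := by
  classical
  let P : Measure (ι → ℝ) := Measure.infinitePi fun _ => gaussianReal 0 1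
  have hlaw (i : ι) : HasLaw (fun ω : ι → ℝ => ω i) (gaussianReal 0 1) P :=
    ⟨(measurable_pi_apply i).aemeasurable, Measure.infinitePi_map_eval _ i⟩
  have hgauss (i : ι) : HasGaussianLaw (fun ω : ι → ℝ => ω i) P := (hlaw i).hasGaussianLaw
  have hmean (i : ι) : ∫ ω, ω i ∂P = 0 := by
    simpa using (hlaw i).integral_eq
  have hsq (i : ι) : ∫ ω, ω i * ω i ∂P = 1 := by
    have hvar := (hlaw i).variance_eq
    rw [variance_of_integral_eq_zero (hlaw i).aemeasurable (hmean i)] at hvar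
    simpa [pow_two] using hvar
  have hind : iIndepFun (fun (i : ι) (ω : ι → ℝ) => ω i) P :=
    iIndepFun_infinitePi (X := fun _ x => x) (by fun_prop)
  let e : ι → Lp ℝ 2 P := fun i => (hgauss i).memLp_two.toLp
  have he (i : ι) : e i =ᵐ[P] fun ω => ω i := (hgauss i).memLp_two.coeFn_toLp
  refine ⟨P, inferInstance, e, orthonormal_iff_ite.2 fun i j => ?_,
    (isGaussianProcess_of_iIndepFun hgauss hind).congr fun i => (he i).symm,
    fun i => (integral_congr_ae (he i)).trans (hmean i)⟩
  have hinner : inner ℝ (e i) (e j) = ∫ ω, ω i * ω j ∂P := by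
    rw [L2.inner_def]
    refine integral_congr_ae ?_
    filter_upwards [he i, he j] with ω hi hj
    simp [hi, hj, mul_comm]
  rw [hinner]
  split_ifs with hij
  · rw [hij, hsq]
  · rw [(hind.indepFun hij).integral_fun_mul_eq_mul_integral
      (hgauss i).aemeasurable.aestronglyMeasurable (hgauss j).aemeasurable.aestronglyMeasurable,
      hmean, zero_mul]

universe u in
theorem exists_isonormal (H : Type u) [NormedAddCommGroup H] [InnerProductSpace ℝ H]
    [CompleteSpace H] :
    ∃ (Ω : Type u) (_ : MeasurableSpace Ω) (P : Measure Ω) (_ : IsProbabilityMeasure P)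
      (W : H →ₗᵢ[ℝ] Lp ℝ 2 P), ∀ h, P.map (W h) = gaussianReal 0 (‖h‖₊ ^ 2) := by
  classical
  obtain ⟨w, b, -⟩ := exists_hilbertBasis ℝ H
  obtain ⟨P, hP, e, he, hgauss, hmean⟩ := exists_orthonormal_isGaussianProcess w
  let W : H →ₗᵢ[ℝ] Lp ℝ 2 P :=
    he.orthogonalFamily.linearIsometry.comp b.repr.toLinearIsometry
  have hWb : (W ∘ b) = e := by
    ext1 i
    simp only [W, Function.comp_apply, LinearIsometry.coe_comp, b.repr_self,
      LinearIsometryEquiv.coe_toLinearIsometry, OrthogonalFamily.linearIsometry_apply_single,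
      LinearIsometry.toSpanSingleton_apply, one_smul]
  have hspan (h : H) (hh : h ∈ Submodule.span ℝ (Set.range b)) :
      P.map (W h) = gaussianReal 0 (‖W h‖₊ ^ 2) := by
    have hWh : W h ∈ Submodule.span ℝ (Set.range e) := by
      rw [← hWb, Set.range_comp]
      exact Submodule.apply_mem_span_image_of_mem_span W.toLinearMap hh
    exact map_eq_gaussianReal_of_hasGaussianLaw (hasGaussianLaw_of_mem_span hgauss hWh)
      (integral_eq_zero_of_mem_span (Set.forall_mem_range.2 hmean) hWh)
  have hclosure := (isClosed_setOf_map_eq_gaussianReal.preimage W.continuous).closure_subset_iff.2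
    hspan
  refine ⟨w → ℝ, inferInstance, P, hP, W, fun h => ?_⟩
  have hh : h ∈ (Submodule.span ℝ (Set.range b)).topologicalClosure := by
    rw [b.dense_span]; trivial
  simpa using hclosure hh

theorem isGaussianProcess_of_linearMap {H : Type*} [AddCommGroup H] [Module ℝ H]
    (W : H →ₗ[ℝ] Lp ℝ 2 P) (hW : ∀ h, HasGaussianLaw (W h) P) :
    IsGaussianProcess (fun h => W h) P where
  hasGaussianLaw I := by
    classical
    have hmeas : AEMeasurable (fun ω => I.restrict fun h => W h ω) P :=
      aemeasurable_pi_iff.2 fun h => (hW h).aemeasurable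
    refine ⟨isGaussian_of_map_eq_gaussianReal fun L => ?_⟩
    have hL : (fun ω => L (I.restrict fun h => W h ω)) =ᵐ[P]
        W (∑ h : I, L (Pi.single h 1) • (h : H)) := by
      rw [map_sum]
      simp only [map_smul]
      filter_upwards [coeFn_sum_smul Finset.univ (fun h : I => L (Pi.single h 1))
        fun h => W h] with ω hω
      rw [hω]
      conv_lhs => rw [← Finset.univ_sum_single (I.restrict fun h => W h ω), map_sum]
      refine Finset.sum_congr rfl fun h _ => ?_
      rw [← mul_one (I.restrict _ h), ← smul_eq_mul, Pi.single_smul, map_smul, smul_eq_mul,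
        mul_comm, Finset.restrict]
    exact ⟨_, _, by
      rw [AEMeasurable.map_map_of_aemeasurable (by fun_prop) hmeas]
      exact (Measure.map_congr hL).trans (hW _).map_eq_gaussianReal⟩

end Isonormal

section GaussianMoments

open ProbabilityTheory

open Polynomial in
theorem deriv_eval_mul_exp_sq (p : ℝ[X]) (v : ℝ) :
    deriv (fun t => p.eval t * Real.exp (v * t ^ 2 / 2)) =
      fun t => (derivative p + C v * X * p).eval t * Real.exp (v * t ^ 2 / 2) := by
  ext t
  have hexp : HasDerivAt (fun t : ℝ => Real.exp (v * t ^ 2 / 2))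
      (Real.exp (v * t ^ 2 / 2) * (v * t)) t :=
    (((hasDerivAt_pow 2 t).const_mul v).div_const 2).exp.congr_deriv (by push_cast; ring)
  rw [((p.hasDerivAt t).fun_mul hexp).deriv]
  simp only [eval_add, eval_mul, eval_C, eval_X]
  ring

theorem integral_pow_four_gaussianReal (v : ℝ≥0) :
    ∫ x, x ^ 4 ∂gaussianReal 0 v = 3 * (v : ℝ) ^ 2 := by
  have hmgf : mgf id (gaussianReal 0 v) =
      fun t => (1 : Polynomial ℝ).eval t * Real.exp (v * t ^ 2 / 2) := by
    simp [mgf_id_gaussianReal]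
  have hmoment := iteratedDeriv_mgf_zero (X := id) (μ := gaussianReal 0 v) (by simp) 4
  rw [hmgf] at hmoment
  simp only [iteratedDeriv_succ, iteratedDeriv_zero, deriv_eval_mul_exp_sq, Pi.pow_apply,
    id_eq] at hmoment
  rw [← hmoment]
  simp
  ring

variable {Ω Ω' : Type*} [MeasurableSpace Ω] [MeasurableSpace Ω'] {P : Measure Ω} {P' : Measure Ω'}

theorem integral_pow_four_of_hasGaussianLaw {X : Ω → ℝ} (hX : HasGaussianLaw X P)
    (hmean : P[X] = 0) : ∫ ω, X ω ^ 4 ∂P = 3 * Var[X; P] ^ 2 := by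
  have h := integral_pow_four_gaussianReal Var[X; P].toNNReal
  rw [← hmean, ← hX.map_eq_gaussianReal, integral_map hX.aemeasurable (by fun_prop),
    Real.coe_toNNReal _ (variance_nonneg X P)] at h
  exact h

theorem variance_sum_mul {ι : Type*} [Fintype ι] {X : ι → Ω → ℝ} [IsFiniteMeasure P]
    (hX : ∀ i, MemLp (X i) 2 P) (c : ι → ℝ) :
    Var[fun ω => ∑ i, c i * X i ω; P] = ∑ i, ∑ j, c i * c j * cov[X i, X j; P] := by
  have hcX (i : ι) : MemLp (fun ω => c i * X i ω) 2 P := (hX i).const_mul (c i)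
  rw [← covariance_self (memLp_finsetSum _ fun i _ => hcX i).aemeasurable,
    covariance_fun_sum_fun_sum hcX hcX]
  simp only [covariance_const_mul_left, covariance_const_mul_right, mul_assoc, mul_left_comm]

theorem map_eq_map_of_hasGaussianLaw {ι : Type*} [Finite ι] {X : ι → Ω → ℝ} {Y : ι → Ω' → ℝ}
    (hX : HasGaussianLaw (fun ω i => X i ω) P) (hY : HasGaussianLaw (fun ω i => Y i ω) P')
    (hmean : ∀ i, P[X i] = P'[Y i]) (hcov : ∀ i j, cov[X i, X j; P] = cov[Y i, Y j; P']) :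
    P.map (fun ω i => X i ω) = P'.map (fun ω i => Y i ω) := by
  classical
  cases nonempty_fintype ι
  have := hX.isProbabilityMeasure
  have := hY.isProbabilityMeasure
  have := hX.isGaussian_map
  have := hY.isGaussian_map
  refine Measure.ext_of_charFunDual (funext fun L => ?_)
  have hL (x : ι → ℝ) : L x = ∑ i, L (Pi.single i 1) * x i := by
    conv_lhs => rw [pi_eq_sum_univ' x, map_sum]
    simp [mul_comm]
  rw [hX.charFunDual_map_eq_fun, hY.charFunDual_map_eq_fun]
  have hXL : (fun ω => L fun i => X i ω) = fun ω => ∑ i, L (Pi.single i 1) * X i ω :=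
    funext fun ω => hL _
  have hYL : (fun ω => L fun i => Y i ω) = fun ω => ∑ i, L (Pi.single i 1) * Y i ω :=
    funext fun ω => hL _
  rw [hXL, hYL, variance_sum_mul fun i => (hX.eval i).memLp_two,
    variance_sum_mul fun i => (hY.eval i).memLp_two,
    integral_finsetSum _ fun i _ => (hX.eval i).integrable.const_mul _,
    integral_finsetSum _ fun i _ => (hY.eval i).integrable.const_mul _]
  simp only [integral_const_mul, hmean, hcov]

theorem hasGaussianLaw_pi_of_isGaussianProcess {T ι : Type*} [Finite ι] {X : T → Ω → ℝ}
    (hX : IsGaussianProcess X P) (t : ι → T) : HasGaussianLaw (fun ω i => X (t i) ω) P := by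
  classical
  cases nonempty_fintype ι
  let L : (Finset.univ.image t → ℝ) →L[ℝ] ι → ℝ :=
    ContinuousLinearMap.pi fun i => ContinuousLinearMap.proj ⟨t i, by simp⟩
  exact (hX.hasGaussianLaw (Finset.univ.image t)).map_fun L

variable {T : Type*} {X : T → Ω → ℝ}

theorem integral_mul_mul_eq_zero_of_isGaussianProcess (hX : IsGaussianProcess X P)
    (hmean : ∀ t, P[X t] = 0) (s t u : T) : ∫ ω, X s ω * X t ω * X u ω ∂P = 0 := by
  have hlaw := hasGaussianLaw_pi_of_isGaussianProcess hX ![s, t, u]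
  have hlaw' : HasGaussianLaw (fun ω i => -X (![s, t, u] i) ω) P := hlaw.fun_neg
  have hneg : P.map (fun ω i => X (![s, t, u] i) ω) = P.map (fun ω i => -X (![s, t, u] i) ω) :=
    map_eq_map_of_hasGaussianLaw hlaw hlaw'
      (fun i => by simp [integral_neg, hmean])
      fun i j => by simp [covariance_fun_neg_left, covariance_fun_neg_right]
  have hint : ∫ p, p 0 * p 1 * p 2 ∂(P.map fun ω i => X (![s, t, u] i) ω) =
      ∫ p, p 0 * p 1 * p 2 ∂(P.map fun ω i => -X (![s, t, u] i) ω) := by rw [hneg]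
  rw [integral_map hlaw.aemeasurable (by fun_prop),
    integral_map hlaw'.aemeasurable (by fun_prop)] at hint
  simp only [Matrix.cons_val, neg_mul, mul_neg, neg_neg, integral_neg] at hint
  linarith

theorem integral_sum_mul_pow_four_of_isGaussianProcess {ι : Type*} [Fintype ι] {X : ι → Ω → ℝ}
    (hX : IsGaussianProcess X P) (hmean : ∀ i, P[X i] = 0) (c : ι → ℝ) :
    ∫ ω, (∑ i, c i * X i ω) ^ 4 ∂P = 3 * (∑ i, ∑ j, c i * c j * cov[X i, X j; P]) ^ 2 := by
  have := hX.isProbabilityMeasure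
  have hmem (i : ι) := (hX.hasGaussianLaw_eval i).memLp_two
  rw [← variance_sum_mul hmem]
  refine integral_pow_four_of_hasGaussianLaw (hX.smul c).hasGaussianLaw_fun_sum ?_
  rw [integral_finsetSum _ fun i _ => ((hmem i).integrable one_le_two).const_mul (c i)]
  simp [integral_const_mul, hmean]

theorem integral_mul_mul_mul_of_isGaussianProcess (hX : IsGaussianProcess X P)
    (hmean : ∀ t, P[X t] = 0) (s t u v : T) :
    ∫ ω, X s ω * X t ω * (X u ω * X v ω) ∂P =
      cov[X s, X t; P] * cov[X u, X v; P] + cov[X s, X u; P] * cov[X t, X v; P] +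
        cov[X s, X v; P] * cov[X t, X u; P] := by
  have := hX.isProbabilityMeasure
  -- Polarization: `x₁ x₂ x₃ x₄` is a signed sum of the fourth powers `(x₁ ± x₂ ± x₃ ± x₄) ^ 4`,
  -- divided by `4! · 2 ^ 3`.
  let σ : Fin 2 → ℝ := ![1, -1]
  let c : Fin 2 × Fin 2 × Fin 2 → Fin 4 → ℝ := fun p => ![1, σ p.1, σ p.2.1, σ p.2.2]
  let Z : Fin 4 → Ω → ℝ := fun i => X (![s, t, u, v] i)
  have hZ : IsGaussianProcess Z P := hX.comp_right ![s, t, u, v]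
  have hint (p) : Integrable (fun ω => (∑ i, c p i * Z i ω) ^ 4) P := by
    have hlaw : HasGaussianLaw (fun ω => ∑ i, c p i * Z i ω) P :=
      (hZ.smul (c p)).hasGaussianLaw_fun_sum
    refine ((hlaw.memLp (p := 4) (by simp)).integrable_norm_pow (by simp)).congr
      (ae_of_all _ fun ω => ?_)
    exact (even_two_mul 2).pow_abs _
  calc ∫ ω, X s ω * X t ω * (X u ω * X v ω) ∂P
      = ∫ ω, ∑ p, (∏ i, c p i) / 192 * (∑ i, c p i * Z i ω) ^ 4 ∂P := by
        refine integral_congr_ae (ae_of_all _ fun ω => ?_)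
        simp only [Fintype.sum_prod_type, Fin.sum_univ_two, Fin.sum_univ_four,
          Fin.prod_univ_four, c, σ, Z, Matrix.cons_val]
        ring
    _ = ∑ p, (∏ i, c p i) / 192 * (3 * (∑ i, ∑ j, c p i * c p j * cov[Z i, Z j; P]) ^ 2) := by
        rw [integral_finsetSum _ fun p _ => (hint p).const_mul _]
        simp only [integral_const_mul,
          integral_sum_mul_pow_four_of_isGaussianProcess hZ fun _ => hmean _]
    _ = _ := by
        simp only [Fintype.sum_prod_type, Fin.sum_univ_two, Fin.sum_univ_four,
          Fin.prod_univ_four, c, σ, Z, Matrix.cons_val]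
        simp only [covariance_comm (X t) (X s), covariance_comm (X u) (X s),
          covariance_comm (X v) (X s), covariance_comm (X u) (X t), covariance_comm (X v) (X t),
          covariance_comm (X v) (X u)]
        ring

end GaussianMoments

section OrnsteinUhlenbeck

open ProbabilityTheory

variable {Ω : Type*} [MeasurableSpace Ω] {P : Measure Ω}

/-- The standard Ornstein–Uhlenbeck process: a centered Gaussian process on `[0, ∞)` with
covariance `exp (-|t - s|)`. Nothing is required of its paths. -/
structure IsOrnsteinUhlenbeck (P : Measure Ω) (x : ℝ≥0 → Ω → ℝ) : Prop where
  measurable : ∀ t, Measurable (x t)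
  isGaussianProcess : IsGaussianProcess x P
  integral : ∀ t, ∫ ω, x t ω ∂P = 0
  covariance : ∀ s t, cov[x s, x t; P] = Real.exp (-|(t : ℝ) - s|)

theorem exists_inner_eq_exp_neg_abs_sub :
    ∃ h : ℝ≥0 → Lp ℝ 2 (volume : Measure ℝ),
      ∀ s t, inner ℝ (h s) (h t) = Real.exp (-|(t : ℝ) - s|) := by
  -- The Ornstein–Uhlenbeck process is `exp (-t)` times Brownian motion at the time `exp (2 * t)`.
  let h : ℝ≥0 → Lp ℝ 2 (volume : Measure ℝ) := fun t => Real.exp (-t) •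
    indicatorConstLp 2 (measurableSet_Icc (a := (0 : ℝ)) (b := Real.exp (2 * t)))
      isCompact_Icc.measure_ne_top (1 : ℝ)
  have hle {s t : ℝ≥0} (hst : s ≤ t) : inner ℝ (h s) (h t) = Real.exp (-|(t : ℝ) - s|) := by
    have hexp : Real.exp (2 * s) ≤ Real.exp (2 * t) := by gcongr
    simp only [h]
    rw [real_inner_smul_left, real_inner_smul_right,
      L2.real_inner_indicatorConstLp_one_indicatorConstLp_one (hμs := isCompact_Icc.measure_ne_top)
        (hμt := isCompact_Icc.measure_ne_top), Set.Icc_inter_Icc, max_self, Real.volume_real_Icc,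
      sub_zero, inf_eq_left.2 hexp, max_eq_left (Real.exp_pos _).le,
      abs_of_nonneg (sub_nonneg.2 (NNReal.coe_le_coe.2 hst)), ← Real.exp_add, ← Real.exp_add]
    ring_nf
  refine ⟨h, fun s t => ?_⟩
  rcases le_total s t with hst | hst
  · exact hle hst
  · rw [real_inner_comm, hle hst, abs_sub_comm]

theorem exists_isOrnsteinUhlenbeck :
    ∃ (Ω : Type) (_ : MeasurableSpace Ω) (P : Measure Ω) (_ : IsProbabilityMeasure P)
      (x : ℝ≥0 → Ω → ℝ), IsOrnsteinUhlenbeck P x := by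
  obtain ⟨Ω, mΩ, P, hP, W, hW⟩ := exists_isonormal (Lp ℝ 2 (volume : Measure ℝ))
  obtain ⟨h, hinner⟩ := exists_inner_eq_exp_neg_abs_sub
  have hlaw (g) : HasLaw (W g) (gaussianReal 0 (‖g‖₊ ^ 2)) P :=
    ⟨(Lp.aestronglyMeasurable (W g)).aemeasurable, hW g⟩
  have hgauss : IsGaussianProcess (fun g => W g) P :=
    isGaussianProcess_of_linearMap W.toLinearMap fun g => (hlaw g).hasGaussianLaw
  have hmean (g) : ∫ ω, W g ω ∂P = 0 := by simpa using (hlaw g).integral_eq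
  refine ⟨Ω, mΩ, P, hP, fun t => W (h t),
    fun t => (Lp.stronglyMeasurable (W (h t))).measurable, hgauss.comp_right h,
    fun t => hmean (h t), fun s t => ?_⟩
  rw [covariance_eq_sub (Lp.memLp _) (Lp.memLp _), hmean, zero_mul, sub_zero, ← hinner s t,
    ← W.inner_map_map, L2.inner_def]
  simp [mul_comm]

namespace IsOrnsteinUhlenbeck

variable {x : ℝ≥0 → Ω → ℝ}

theorem memLp (hx : IsOrnsteinUhlenbeck P x) (t : ℝ≥0) : MemLp (x t) 4 P :=
  (hx.isGaussianProcess.hasGaussianLaw_eval t).memLp (by simp)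

theorem integral_mul (hx : IsOrnsteinUhlenbeck P x) (s t : ℝ≥0) :
    ∫ ω, x s ω * x t ω ∂P = Real.exp (-|(t : ℝ) - s|) := by
  have := hx.isGaussianProcess.isProbabilityMeasure
  have hmem (t : ℝ≥0) := (hx.isGaussianProcess.hasGaussianLaw_eval t).memLp_two
  have hcov := covariance_eq_sub (hmem s) (hmem t)
  rw [hx.covariance, hx.integral, zero_mul, sub_zero] at hcov
  exact hcov.symm

theorem integral_mul_mul (hx : IsOrnsteinUhlenbeck P x) (s t u : ℝ≥0) :
    ∫ ω, x s ω * x t ω * x u ω ∂P = 0 :=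
  integral_mul_mul_eq_zero_of_isGaussianProcess hx.isGaussianProcess hx.integral s t u

theorem integral_mul_mul_mul (hx : IsOrnsteinUhlenbeck P x) (s t u v : ℝ≥0) :
    ∫ ω, x s ω * x t ω * (x u ω * x v ω) ∂P =
      Real.exp (-|(t : ℝ) - s|) * Real.exp (-|(v : ℝ) - u|)
        + Real.exp (-|(u : ℝ) - s|) * Real.exp (-|(v : ℝ) - t|)
        + Real.exp (-|(v : ℝ) - s|) * Real.exp (-|(u : ℝ) - t|) := by
  rw [integral_mul_mul_mul_of_isGaussianProcess hx.isGaussianProcess hx.integral]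
  simp only [hx.covariance]

theorem map_add_right (hx : IsOrnsteinUhlenbeck P x) {ι : Type*} [Finite ι] (t : ι → ℝ≥0)
    (h : ℝ≥0) : P.map (fun ω i => x (t i + h) ω) = P.map (fun ω i => x (t i) ω) :=
  map_eq_map_of_hasGaussianLaw
    (hasGaussianLaw_pi_of_isGaussianProcess hx.isGaussianProcess fun i => t i + h)
    (hasGaussianLaw_pi_of_isGaussianProcess hx.isGaussianProcess t)
    (fun i => by rw [hx.integral, hx.integral]) fun i j => by simp [hx.covariance]

theorem comp_measurePreserving (hx : IsOrnsteinUhlenbeck P x) {Ω' : Type*} [MeasurableSpace Ω']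
    {Q : Measure Ω'} {g : Ω' → Ω} (hg : MeasurePreserving g Q P) :
    IsOrnsteinUhlenbeck Q fun t => x t ∘ g where
  measurable t := (hx.measurable t).comp hg.measurable
  isGaussianProcess := ⟨fun I => by
    have hI : Measurable fun ω => I.restrict (x · ω) :=
      measurable_pi_lambda _ fun t => hx.measurable t
    have hgauss := (hx.isGaussianProcess.hasGaussianLaw I).isGaussian_map
    rw [← hg.map_eq, Measure.map_map hI hg.measurable] at hgauss
    exact ⟨hgauss⟩⟩
  integral t := by
    rw [← hx.integral t, ← hg.map_eq,
      integral_map hg.aemeasurable (hx.measurable t).aestronglyMeasurable]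
    rfl
  covariance s t := by
    rw [← hx.covariance s t, ← hg.map_eq, covariance_map_fun (hx.measurable s).aestronglyMeasurable
      (hx.measurable t).aestronglyMeasurable hg.aemeasurable]
    rfl

end IsOrnsteinUhlenbeck

end OrnsteinUhlenbeck

instance holderTriple_four_four_two : ENNReal.HolderTriple 4 4 2 where
  inv_add_inv_eq_inv := by
    rw [← two_mul, show (4 : ℝ≥0∞) = 2 * 2 by norm_num, ENNReal.mul_inv (by simp) (by simp),
      ← mul_assoc, ENNReal.mul_inv_cancel (by simp) (by simp), one_mul]

section Sums

variable {φ : ℕ → ℝ} {B : ℝ}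

theorem sum_comp_le_of_injOn (hφ : ∀ j, 0 ≤ φ j) (hB : ∀ n, ∑ j ∈ Finset.range n, φ j ≤ B)
    (s : Finset ℕ) (g : ℕ → ℕ) (hg : Set.InjOn g s) : ∑ m ∈ s, φ (g m) ≤ B := by
  rw [← Finset.sum_image hg]
  refine (Finset.sum_le_sum_of_subset_of_nonneg ?_ fun i _ _ => hφ i).trans
    (hB ((s.image g).sup id + 1))
  intro i hi
  exact Finset.mem_range.2 (Nat.lt_succ_of_le (Finset.le_sup (f := id) hi))

theorem sum_dist_le (hφ : ∀ j, 0 ≤ φ j) (hB : ∀ n, ∑ j ∈ Finset.range n, φ j ≤ B)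
    (s : Finset ℕ) (n : ℕ) : ∑ m ∈ s, φ (Nat.dist n m) ≤ 2 * B := by
  rw [← Finset.sum_filter_add_sum_filter_not s (fun m => m ≤ n), two_mul]
  refine add_le_add (sum_comp_le_of_injOn hφ hB _ _ ?_) (sum_comp_le_of_injOn hφ hB _ _ ?_) <;>
  · intro a ha b hb hab
    simp only [Finset.coe_filter, Set.mem_ofPred_eq] at ha hb
    simp only [Nat.dist] at hab
    omega

theorem sum_ite_lt_le {M : ℝ} (hφ : ∀ j, 0 ≤ φ j) (hM : 0 ≤ M)
    (hB : ∀ n, ∑ j ∈ Finset.range n, φ j ≤ B) (κ n : ℕ) :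
    ∑ j ∈ Finset.range n, (if j < κ then M else φ (j - κ)) ≤ κ * M + B := by
  have hnonneg (j : ℕ) : 0 ≤ (if j < κ then M else φ (j - κ)) := by
    split_ifs
    exacts [hM, hφ _]
  calc ∑ j ∈ Finset.range n, (if j < κ then M else φ (j - κ))
      ≤ ∑ j ∈ Finset.range (κ + n), (if j < κ then M else φ (j - κ)) :=
        Finset.sum_le_sum_of_subset_of_nonneg (Finset.range_mono (by omega))
          fun i _ _ => hnonneg i
    _ = κ * M + ∑ j ∈ Finset.range n, φ j := by
        rw [Finset.sum_range_add, Finset.sum_congr rfl fun j hj => if_pos (Finset.mem_range.1 hj)]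
        simp
    _ ≤ κ * M + B := by grw [hB n]

theorem sum_piFinset_eq_sum_insertNth {α M : Type*} [AddCommMonoid M] {n : ℕ} (s : Finset α)
    (F : (Fin (n + 1) → α) → M) (i : Fin (n + 1)) :
    ∑ t ∈ Fintype.piFinset (fun _ => s), F t =
      ∑ t ∈ Fintype.piFinset (fun _ : Fin n => s), ∑ a ∈ s, F (i.insertNth a t) := by
  rw [← Finset.sum_product' _ _ fun t a => F (i.insertNth a t)]
  refine Finset.sum_bij' (fun t _ => (i.removeNth t, t i)) (fun p _ => i.insertNth p.2 p.1)
    ?_ ?_ ?_ ?_ ?_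
  · simp only [Fintype.mem_piFinset, Finset.mem_product]
    exact fun t ht => ⟨fun k => ht _, ht i⟩
  · simp only [Fintype.mem_piFinset, Finset.mem_product, Fin.forall_iff_succAbove i,
      Fin.insertNth_apply_same, Fin.insertNth_apply_succAbove]
    exact fun p hp => hp.symm
  all_goals simp

end Sums

section Moments

open ProbabilityTheory

variable {Ω : Type*} [MeasurableSpace Ω] {P : Measure Ω} {φ : ℕ → ℝ} {B : ℝ}

theorem variance_average_le [IsProbabilityMeasure P] (hφ : ∀ j, 0 ≤ φ j)
    (hB : ∀ n, ∑ j ∈ Finset.range n, φ j ≤ B)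
    (s : Finset ℕ) (w : ℕ → Ω → ℝ) (hw : ∀ n, MemLp (w n) 2 P)
    (hcov : ∀ n m, |cov[w n, w m; P]| ≤ φ (Nat.dist n m)) :
    Var[fun ω => (s.card : ℝ)⁻¹ * ∑ n ∈ s, w n ω; P] ≤ 2 * B / s.card := by
  rcases s.eq_empty_or_nonempty with rfl | hs
  · simp only [Finset.sum_empty, mul_zero, Finset.card_empty, Nat.cast_zero, div_zero]
    exact (variance_zero P).le
  have : (0 : ℝ) < s.card := by exact_mod_cast hs.card_pos
  rw [variance_const_mul, variance_fun_sum' fun i _ => hw i]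
  calc ((s.card : ℝ)⁻¹) ^ 2 * ∑ i ∈ s, ∑ j ∈ s, cov[w i, w j; P]
      ≤ ((s.card : ℝ)⁻¹) ^ 2 * ∑ i ∈ s, 2 * B := by
        gcongr with i
        exact (Finset.sum_le_sum fun j _ => (le_abs_self _).trans (hcov i j)).trans
          (sum_dist_le hφ hB s i)
    _ = 2 * B / s.card := by
        rw [Finset.sum_const, nsmul_eq_mul]
        field_simp

/-- The sum of `φ |t i - t j|` over the ordered pairs of distinct indices. It bounds joint moments
of weakly correlated variables at the times `t`; being symmetric in the times, it allows to sort
them first. -/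
def pairSum {ι : Type*} [Fintype ι] [DecidableEq ι] (φ : ℕ → ℝ) (t : ι → ℕ) : ℝ :=
  ∑ i, ∑ j, if i = j then 0 else φ (Nat.dist (t i) (t j))

theorem pairSum_comp_perm {ι : Type*} [Fintype ι] [DecidableEq ι] (φ : ℕ → ℝ) (t : ι → ℕ)
    (σ : Equiv.Perm ι) : pairSum φ (t ∘ σ) = pairSum φ t := by
  simp only [pairSum, Function.comp_apply]
  rw [← Equiv.sum_comp σ fun i => ∑ j, if i = j then 0 else φ (Nat.dist (t i) (t j))]
  refine Finset.sum_congr rfl fun i _ => ?_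
  rw [← Equiv.sum_comp σ fun j => if σ i = j then 0 else φ (Nat.dist (t (σ i)) (t j))]
  simp only [EmbeddingLike.apply_eq_iff_eq]

theorem sum_piFinset_pairSum_le (hφ : ∀ j, 0 ≤ φ j) (hB : ∀ n, ∑ j ∈ Finset.range n, φ j ≤ B)
    (s : Finset ℕ) (n : ℕ) :
    ∑ t ∈ Fintype.piFinset (fun _ : Fin (n + 1) => s), pairSum φ t ≤
      (n + 1) * n * (s.card ^ n * (2 * B)) := by
  have hpair (i k) : ∑ t ∈ Fintype.piFinset (fun _ : Fin (n + 1) => s),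
      φ (Nat.dist (t i) (t (i.succAbove k))) ≤ s.card ^ n * (2 * B) := by
    calc ∑ t ∈ Fintype.piFinset (fun _ : Fin (n + 1) => s),
          φ (Nat.dist (t i) (t (i.succAbove k)))
        = ∑ t ∈ Fintype.piFinset (fun _ : Fin n => s), ∑ a ∈ s, φ (Nat.dist (t k) a) := by
          simp only [sum_piFinset_eq_sum_insertNth s _ i, Fin.insertNth_apply_same,
            Fin.insertNth_apply_succAbove, Nat.dist_comm]
      _ ≤ ∑ t ∈ Fintype.piFinset (fun _ : Fin n => s), 2 * B :=
          Finset.sum_le_sum fun t _ => sum_dist_le hφ hB s _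
      _ = s.card ^ n * (2 * B) := by simp
  calc ∑ t ∈ Fintype.piFinset (fun _ : Fin (n + 1) => s), pairSum φ t
      = ∑ i, ∑ k, ∑ t ∈ Fintype.piFinset (fun _ : Fin (n + 1) => s),
          φ (Nat.dist (t i) (t (i.succAbove k))) := by
        simp only [pairSum]
        rw [Finset.sum_comm]
        refine Finset.sum_congr rfl fun i _ => ?_
        rw [Finset.sum_comm, Fin.sum_univ_succAbove _ i]
        simp [(Fin.succAbove_ne i _).symm]
    _ ≤ ∑ _i : Fin (n + 1), ∑ _k : Fin n, s.card ^ n * (2 * B) :=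
        Finset.sum_le_sum fun i _ => Finset.sum_le_sum fun k _ => hpair i k
    _ = (n + 1) * n * (s.card ^ n * (2 * B)) := by simp [mul_assoc]

theorem abs_integral_prod_four_le_of_monotone (hφ : ∀ j, 0 ≤ φ j) {M : ℝ} {z : ℕ → Ω → ℝ}
    (hM : ∀ a b, |∫ ω, z a ω * z b ω ∂P| ≤ M)
    (h2 : ∀ a b, a ≤ b → |∫ ω, z a ω * z b ω ∂P| ≤ φ (b - a))
    (h4 : ∀ a b c d, a ≤ b → b ≤ c → c ≤ d →
      |(∫ ω, z a ω * z b ω * (z c ω * z d ω) ∂P)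
        - (∫ ω, z a ω * z b ω ∂P) * ∫ ω, z c ω * z d ω ∂P| ≤ φ (c - b))
    {t : Fin 4 → ℕ} (ht : Monotone t) :
    |∫ ω, ∏ i, z (t i) ω ∂P| ≤ (1 + M) * pairSum φ t := by
  have hM0 : 0 ≤ M := (abs_nonneg _).trans (hM 0 0)
  have h01 : t 0 ≤ t 1 := ht (by decide)
  have h12 : t 1 ≤ t 2 := ht (by decide)
  have h23 : t 2 ≤ t 3 := ht (by decide)
  have hpair : φ (t 2 - t 1) + φ (t 1 - t 0) ≤ pairSum φ t := by
    simp only [pairSum, Fin.sum_univ_four, Fin.isValue, reduceIte, Fin.reduceEq,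
      Nat.dist_eq_sub_of_le h12, Nat.dist_eq_sub_of_le h01]
    have := fun i j => hφ (Nat.dist (t i) (t j))
    linarith [this 0 2, this 0 3, this 1 0, this 1 3, this 2 0, this 2 1, this 2 3, this 3 0,
      this 3 1, this 3 2]
  have hprod : |(∫ ω, z (t 0) ω * z (t 1) ω ∂P) * ∫ ω, z (t 2) ω * z (t 3) ω ∂P|
      ≤ φ (t 1 - t 0) * M := by
    rw [abs_mul]
    exact mul_le_mul (h2 _ _ h01) (hM _ _) (abs_nonneg _) (hφ _)
  calc |∫ ω, ∏ i, z (t i) ω ∂P|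
      = |∫ ω, z (t 0) ω * z (t 1) ω * (z (t 2) ω * z (t 3) ω) ∂P| := by
        simp only [Fin.prod_univ_four, mul_assoc]
    _ ≤ φ (t 2 - t 1) + φ (t 1 - t 0) * M := by
        linarith [abs_sub_abs_le_abs_sub
          (∫ ω, z (t 0) ω * z (t 1) ω * (z (t 2) ω * z (t 3) ω) ∂P)
          ((∫ ω, z (t 0) ω * z (t 1) ω ∂P) * ∫ ω, z (t 2) ω * z (t 3) ω ∂P),
          h4 _ _ _ _ h01 h12 h23]
    _ ≤ (1 + M) * (φ (t 2 - t 1) + φ (t 1 - t 0)) := by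
        nlinarith [mul_nonneg hM0 (hφ (t 2 - t 1)), hφ (t 1 - t 0)]
    _ ≤ (1 + M) * pairSum φ t := by gcongr

theorem abs_integral_prod_four_le (hφ : ∀ j, 0 ≤ φ j) {M : ℝ} {z : ℕ → Ω → ℝ}
    (hM : ∀ a b, |∫ ω, z a ω * z b ω ∂P| ≤ M)
    (h2 : ∀ a b, a ≤ b → |∫ ω, z a ω * z b ω ∂P| ≤ φ (b - a))
    (h4 : ∀ a b c d, a ≤ b → b ≤ c → c ≤ d →
      |(∫ ω, z a ω * z b ω * (z c ω * z d ω) ∂P)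
        - (∫ ω, z a ω * z b ω ∂P) * ∫ ω, z c ω * z d ω ∂P| ≤ φ (c - b))
    (t : Fin 4 → ℕ) : |∫ ω, ∏ i, z (t i) ω ∂P| ≤ (1 + M) * pairSum φ t := by
  have hsort (ω : Ω) : ∏ i, z ((t ∘ Tuple.sort t) i) ω = ∏ i, z (t i) ω :=
    Equiv.prod_comp (Tuple.sort t) fun i => z (t i) ω
  simpa only [hsort, pairSum_comp_perm] using
    abs_integral_prod_four_le_of_monotone hφ hM h2 h4 (Tuple.monotone_sort t)

theorem integral_sum_pow_eq_sum_integral_prod {ι : Type*} {k : ℕ} (hk : k ≠ 0) (s : Finset ι)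
    (z : ι → Ω → ℝ) (hz : ∀ n, MemLp (z n) k P) :
    ∫ ω, (∑ n ∈ s, z n ω) ^ k ∂P =
      ∑ t ∈ Fintype.piFinset (fun _ : Fin k => s), ∫ ω, ∏ i, z (t i) ω ∂P := by
  simp only [Finset.sum_pow']
  refine integral_finsetSum _ fun t _ => memLp_one_iff_integrable.1 ?_
  have hprod := MemLp.prod' (s := Finset.univ) fun i _ => hz (t i)
  convert hprod using 1
  have : (k : ℝ≥0∞) ≠ 0 := by exact_mod_cast hk
  simp [ENNReal.mul_inv_cancel this]

theorem integral_average_pow_four_le (hφ : ∀ j, 0 ≤ φ j)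
    (hB : ∀ n, ∑ j ∈ Finset.range n, φ j ≤ B) {M : ℝ}
    (s : Finset ℕ) (z : ℕ → Ω → ℝ) (hz : ∀ n, MemLp (z n) 4 P)
    (hM : ∀ a b, |∫ ω, z a ω * z b ω ∂P| ≤ M)
    (h2 : ∀ a b, a ≤ b → |∫ ω, z a ω * z b ω ∂P| ≤ φ (b - a))
    (h4 : ∀ a b c d, a ≤ b → b ≤ c → c ≤ d →
      |(∫ ω, z a ω * z b ω * (z c ω * z d ω) ∂P)
        - (∫ ω, z a ω * z b ω ∂P) * ∫ ω, z c ω * z d ω ∂P| ≤ φ (c - b)) :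
    ∫ ω, ((s.card : ℝ)⁻¹ * ∑ n ∈ s, z n ω) ^ 4 ∂P ≤ 24 * (1 + M) * B / s.card := by
  have hM0 : 0 ≤ M := (abs_nonneg _).trans (hM 0 0)
  rcases s.eq_empty_or_nonempty with rfl | hs
  · simp
  have : (0 : ℝ) < s.card := by exact_mod_cast hs.card_pos
  calc ∫ ω, ((s.card : ℝ)⁻¹ * ∑ n ∈ s, z n ω) ^ 4 ∂P
      = ((s.card : ℝ)⁻¹) ^ 4 *
          ∑ t ∈ Fintype.piFinset (fun _ : Fin 4 => s), ∫ ω, ∏ i, z (t i) ω ∂P := by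
        simp only [mul_pow]
        rw [integral_const_mul, integral_sum_pow_eq_sum_integral_prod (by norm_num) s z hz]
    _ ≤ ((s.card : ℝ)⁻¹) ^ 4 *
          ∑ t ∈ Fintype.piFinset (fun _ : Fin 4 => s), (1 + M) * pairSum φ t := by
        gcongr with t
        exact (le_abs_self _).trans (abs_integral_prod_four_le hφ hM h2 h4 t)
    _ ≤ ((s.card : ℝ)⁻¹) ^ 4 * ((1 + M) * (((3 : ℕ) + 1) * (3 : ℕ) * (s.card ^ 3 * (2 * B)))) := by
        rw [← Finset.mul_sum]
        gcongr
        exact sum_piFinset_pairSum_le hφ hB s 3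
    _ = 24 * (1 + M) * B / s.card := by
        field_simp
        ring

end Moments

section Rates

/-- A bound of the correlations at the time distance `k Δ` of a process with decorrelation rate
`f`: a crude constant `M` is used at distances below `2`, since `f` is only integrable on `(1, ∞)`
and may blow up at `0`. -/
noncomputable def rateBound (f : ℝ → ℝ) (M Δ : ℝ) (k : ℕ) : ℝ :=
  if k * Δ < 2 then M else f (k * Δ)

variable {f : ℝ → ℝ} {M Δ : ℝ}

theorem rateBound_nonneg (hf : ∀ T, 0 < T → 0 ≤ f T) (hM : 0 ≤ M) (k : ℕ) :
    0 ≤ rateBound f M Δ k := by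
  unfold rateBound
  split_ifs with h
  · exact hM
  · exact hf _ (by linarith)

theorem sum_comp_mul_le_integral_Ioi (hf : ∀ T, 0 < T → 0 ≤ f T)
    (hanti : AntitoneOn f (Set.Ioi 0)) (hint : IntegrableOn f (Set.Ioi 1)) (hΔ : 0 < Δ) {x : ℝ}
    (hx : 1 ≤ x * Δ) (n : ℕ) :
    ∑ i ∈ Finset.range n, f ((x + (i + 1 : ℕ)) * Δ) ≤ (∫ T in Set.Ioi 1, f T) / Δ := by
  have hmap : AntitoneOn (fun y => f (y * Δ)) (Set.Icc x (x + n)) := by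
    intro a ha b _ hab
    have hxa := mul_le_mul_of_nonneg_right ha.1 hΔ.le
    have hab := mul_le_mul_of_nonneg_right hab hΔ.le
    exact hanti (Set.mem_Ioi.2 (by linarith)) (Set.mem_Ioi.2 (by linarith)) hab
  refine hmap.sum_le_integral.trans ?_
  rw [intervalIntegral.integral_comp_mul_right _ hΔ.ne', smul_eq_mul, div_eq_inv_mul]
  gcongr
  rw [intervalIntegral.integral_of_le (by gcongr; simp)]
  refine setIntegral_mono_set hint ?_ ?_
  · exact (ae_restrict_iff' measurableSet_Ioi).2 (ae_of_all _ fun T hT =>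
      hf T (one_pos.trans hT))
  · exact LE.le.eventuallyLE fun T hT => Set.mem_Ioi.2 (hx.trans_lt hT.1)

theorem sum_rateBound_le (hf : ∀ T, 0 < T → 0 ≤ f T) (hanti : AntitoneOn f (Set.Ioi 0))
    (hint : IntegrableOn f (Set.Ioi 1)) (hM : 0 ≤ M) (hΔ : 0 < Δ) (hΔ1 : Δ ≤ 1) (n : ℕ) :
    ∑ j ∈ Finset.range n, rateBound f M Δ j ≤ (3 * M + ∫ T in Set.Ioi 1, f T) / Δ := by
  set k := ⌈2 / Δ⌉₊
  have hk_le : (k : ℝ) * Δ ≤ 3 := by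
    have := mul_le_mul_of_nonneg_right (Nat.ceil_lt_add_one (a := 2 / Δ) (by positivity)).le hΔ.le
    rw [add_mul, div_mul_cancel₀ _ hΔ.ne'] at this
    linarith
  have hle_k : 2 ≤ (k : ℝ) * Δ := (div_le_iff₀ hΔ).1 (Nat.le_ceil _)
  have hnear : ∑ j ∈ Finset.range k, rateBound f M Δ j ≤ 3 * M / Δ := by
    calc ∑ j ∈ Finset.range k, rateBound f M Δ j = ∑ _j ∈ Finset.range k, M := by
          refine Finset.sum_congr rfl fun j hj => if_pos ((lt_div_iff₀ hΔ).1 ?_)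
          exact Nat.lt_ceil.1 (Finset.mem_range.1 hj)
      _ = k * M := by simp
      _ ≤ 3 * M / Δ := by
          rw [le_div_iff₀ hΔ]
          nlinarith
  have hfar : ∑ j ∈ Finset.range n, rateBound f M Δ (k + j) ≤ (∫ T in Set.Ioi 1, f T) / Δ := by
    refine le_trans (Finset.sum_le_sum fun i _ => le_of_eq ?_)
      (sum_comp_mul_le_integral_Ioi (x := k - 1) hf hanti hint hΔ (by linarith) n)
    have : 0 ≤ (i : ℝ) * Δ := by positivity
    rw [rateBound, if_neg (by push_cast; linarith)]
    push_cast
    ring_nf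
  calc ∑ j ∈ Finset.range n, rateBound f M Δ j
      ≤ ∑ j ∈ Finset.range (k + n), rateBound f M Δ j :=
        Finset.sum_le_sum_of_subset_of_nonneg (Finset.range_mono (by omega))
          fun i _ _ => rateBound_nonneg hf hM i
    _ ≤ (3 * M + ∫ T in Set.Ioi 1, f T) / Δ := by
        rw [Finset.sum_range_add, add_div]
        exact add_le_add hnear hfar

end Rates

section Norms

variable {Ω : Type*} [MeasurableSpace Ω] {P : Measure Ω}

theorem eLpNorm_le_ofReal_iff {k : ℕ} (hk : Even k) (hk0 : k ≠ 0) {g : Ω → ℝ}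
    (hg : MemLp g k P) {c : ℝ} (hc : 0 ≤ c) :
    eLpNorm g k P ≤ ENNReal.ofReal c ↔ ∫ ω, g ω ^ k ∂P ≤ c ^ k := by
  have hint : 0 ≤ ∫ ω, g ω ^ k ∂P := integral_nonneg fun _ => hk.pow_nonneg _
  rw [hg.eLpNorm_eq_integral_rpow_norm (by exact_mod_cast hk0) (by simp),
    ENNReal.ofReal_le_ofReal_iff hc]
  simp only [ENNReal.toReal_natCast, Real.rpow_natCast, Real.norm_eq_abs, hk.pow_abs]
  rw [Real.rpow_inv_le_iff_of_pos hint hc (by positivity), Real.rpow_natCast]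

theorem eLpNorm_fun_mul_le {f g : Ω → ℝ} (hf : AEStronglyMeasurable f P)
    (hg : AEStronglyMeasurable g P) (p q : ℝ≥0∞) {r : ℝ≥0∞} [ENNReal.HolderTriple p q r] :
    eLpNorm (fun ω => f ω * g ω) r P ≤ eLpNorm f p P * eLpNorm g q P := by
  have h := eLpNorm_smul_le_mul_eLpNorm (p := p) (q := q) (r := r) hg hf
  exact h

theorem eLpNorm_add_le_ofReal {p : ℝ≥0∞} (hp : 1 ≤ p) {f g : Ω → ℝ}
    (hf : AEStronglyMeasurable f P) (hg : AEStronglyMeasurable g P) {a b : ℝ} (ha : 0 ≤ a)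
    (hb : 0 ≤ b) (hfa : eLpNorm f p P ≤ ENNReal.ofReal a)
    (hgb : eLpNorm g p P ≤ ENNReal.ofReal b) :
    eLpNorm (fun ω => f ω + g ω) p P ≤ ENNReal.ofReal (a + b) := by
  rw [ENNReal.ofReal_add ha hb]
  exact (eLpNorm_add_le hf hg hp).trans (add_le_add hfa hgb)

theorem eLpNorm_sub_le_ofReal {p : ℝ≥0∞} (hp : 1 ≤ p) {f g : Ω → ℝ}
    (hf : AEStronglyMeasurable f P) (hg : AEStronglyMeasurable g P) {a b : ℝ} (ha : 0 ≤ a)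
    (hb : 0 ≤ b) (hfa : eLpNorm f p P ≤ ENNReal.ofReal a)
    (hgb : eLpNorm g p P ≤ ENNReal.ofReal b) :
    eLpNorm (fun ω => f ω - g ω) p P ≤ ENNReal.ofReal (a + b) := by
  rw [ENNReal.ofReal_add ha hb]
  exact (eLpNorm_sub_le hf hg hp).trans (add_le_add hfa hgb)

theorem eLpNorm_mul_const_le_ofReal {p : ℝ≥0∞} {f : Ω → ℝ} {c : ℝ} {a b : ℝ} (ha : 0 ≤ a)
    (hfa : eLpNorm f p P ≤ ENNReal.ofReal a) (hcb : |c| ≤ b) :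
    eLpNorm (fun ω => f ω * c) p P ≤ ENNReal.ofReal (a * b) := by
  rw [ENNReal.ofReal_mul ha]
  have hsmul : (fun ω => f ω * c) = c • f := by
    ext ω
    simp [mul_comm]
  rw [hsmul, eLpNorm_const_smul, mul_comm, ← ofReal_norm]
  exact mul_le_mul' hfa (ENNReal.ofReal_le_ofReal hcb)

theorem eLpNorm_const_le_ofReal [IsProbabilityMeasure P] (p : ℝ≥0∞) {c b : ℝ} (hcb : |c| ≤ b) :
    eLpNorm (fun _ : Ω => c) p P ≤ ENNReal.ofReal b := by
  rcases eq_or_ne p 0 with rfl | hp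
  · simp
  rw [eLpNorm_const _ hp (NeZero.ne P), measure_univ, ENNReal.one_rpow, mul_one, ← ofReal_norm]
  exact ENNReal.ofReal_le_ofReal hcb

theorem eLpNorm_average_le {ι : Type*} {p : ℝ≥0∞} (hp : 1 ≤ p) {s : Finset ι} (hs : s.Nonempty)
    {g : ι → Ω → ℝ} (hg : ∀ n, AEStronglyMeasurable (g n) P) {c : ℝ≥0∞}
    (h : ∀ n, eLpNorm (g n) p P ≤ c) :
    eLpNorm (fun ω => (s.card : ℝ)⁻¹ * ∑ n ∈ s, g n ω) p P ≤ c := by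
  have hsmul : (fun ω => (s.card : ℝ)⁻¹ * ∑ n ∈ s, g n ω) = (s.card : ℝ)⁻¹ • ∑ n ∈ s, g n := by
    ext ω
    simp
  have hcard : (s.card : ℝ≥0∞) ≠ 0 := by simpa using hs.ne_empty
  rw [hsmul, eLpNorm_const_smul]
  calc ‖(s.card : ℝ)⁻¹‖ₑ * eLpNorm (∑ n ∈ s, g n) p P
      ≤ (s.card : ℝ≥0∞)⁻¹ * ∑ _n ∈ s, c := by
        gcongr
        · rw [enorm_inv (by simpa using hs.ne_empty)]
          simp
        · exact (eLpNorm_sum_le (fun n _ => hg n) hp).trans (Finset.sum_le_sum fun n _ => h n)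
    _ = c := by
        rw [Finset.sum_const, nsmul_eq_mul, ← mul_assoc, ENNReal.inv_mul_cancel hcard (by simp),
          one_mul]

theorem eLpNorm_average_Icc_le {p : ℝ≥0∞} (hp : 1 ≤ p) {N : ℕ} (hN : N ≠ 0)
    {g : ℕ → Ω → ℝ} (hg : ∀ n, AEStronglyMeasurable (g n) P) {c : ℝ≥0∞}
    (h : ∀ n, eLpNorm (g n) p P ≤ c) :
    eLpNorm (fun ω => (N : ℝ)⁻¹ * ∑ n ∈ Finset.Icc 1 N, g n ω) p P ≤ c := by
  simpa using
    eLpNorm_average_le hp (Finset.nonempty_Icc.2 (Nat.one_le_iff_ne_zero.2 hN)) hg h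

theorem eLpNorm_pi_le {ι : Type*} [Fintype ι] {E : Type*} [NormedAddCommGroup E] {p : ℝ≥0∞}
    (hp : 1 ≤ p) {F : Ω → ι → E} (hF : ∀ i, AEStronglyMeasurable (fun ω => F ω i) P) {c : ℝ≥0∞}
    (h : ∀ i, eLpNorm (fun ω => F ω i) p P ≤ c) : eLpNorm F p P ≤ Fintype.card ι * c := by
  calc eLpNorm F p P ≤ eLpNorm (∑ i, fun ω => ‖F ω i‖) p P := by
        refine eLpNorm_mono_real fun ω => ?_
        rw [Finset.sum_apply]
        refine (pi_norm_le_iff_of_nonneg (Finset.sum_nonneg fun i _ => norm_nonneg _)).2 fun i => ?_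
        exact Finset.single_le_sum (f := fun i => ‖F ω i‖) (fun i _ => norm_nonneg _)
          (Finset.mem_univ i)
    _ ≤ ∑ i, eLpNorm (fun ω => ‖F ω i‖) p P := eLpNorm_sum_le (fun i _ => (hF i).norm) hp
    _ ≤ ∑ _i : ι, c := Finset.sum_le_sum fun i _ => by rw [eLpNorm_norm]; exact h i
    _ = Fintype.card ι * c := by simp

theorem eLpNorm_pi_le_ofReal {r : ℕ} {p : ℝ≥0∞} (hp : 1 ≤ p) {F : Ω → Fin r → ℝ}
    (hF : ∀ i, AEStronglyMeasurable (fun ω => F ω i) P) {c : ℝ}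
    (h : ∀ i, eLpNorm (fun ω => F ω i) p P ≤ ENNReal.ofReal c) :
    eLpNorm F p P ≤ ENNReal.ofReal (r * c) := by
  rw [ENNReal.ofReal_mul r.cast_nonneg, ENNReal.ofReal_natCast]
  simpa only [Fintype.card_fin] using eLpNorm_pi_le hp hF h

open scoped Matrix.Norms.Elementwise in
theorem eLpNorm_matrix_le_ofReal {r : ℕ} {p : ℝ≥0∞} (hp : 1 ≤ p)
    {F : Ω → Matrix (Fin r) (Fin r) ℝ}
    (hF : ∀ i j, AEStronglyMeasurable (fun ω => F ω i j) P) {c : ℝ}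
    (h : ∀ i j, eLpNorm (fun ω => F ω i j) p P ≤ ENNReal.ofReal c) :
    eLpNorm F p P ≤ ENNReal.ofReal (r * (r * c)) := by
  rw [ENNReal.ofReal_mul r.cast_nonneg, ENNReal.ofReal_natCast]
  have hrow (i : Fin r) : AEStronglyMeasurable (fun ω => F ω i) P :=
    (aemeasurable_pi_lambda _ fun j => (hF i j).aemeasurable).aestronglyMeasurable
  have hrows := eLpNorm_pi_le (E := Fin r → ℝ) hp hrow fun i =>
    eLpNorm_pi_le_ofReal hp (hF i) (h i)
  rw [Fintype.card_fin] at hrows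
  exact hrows

theorem abs_integral_le_of_eLpNorm_one_le {g : Ω → ℝ} {c : ℝ} (hc : 0 ≤ c)
    (hg : eLpNorm g 1 P ≤ ENNReal.ofReal c) : |∫ ω, g ω ∂P| ≤ c := by
  rw [eLpNorm_one_eq_lintegral_enorm] at hg
  have h := (enorm_integral_le_lintegral_enorm g).trans hg
  rwa [← ofReal_norm, ENNReal.ofReal_le_ofReal_iff hc] at h

theorem abs_integral_le [IsProbabilityMeasure P] {p : ℝ≥0∞} (hp : 1 ≤ p) {g : Ω → ℝ}
    (hg : AEStronglyMeasurable g P) {c : ℝ} (hc : 0 ≤ c)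
    (hgc : eLpNorm g p P ≤ ENNReal.ofReal c) : |∫ ω, g ω ∂P| ≤ c :=
  abs_integral_le_of_eLpNorm_one_le hc ((eLpNorm_le_eLpNorm_of_exponent_le hp hg).trans hgc)

theorem eLpNorm_mul_two_le_ofReal {g h : Ω → ℝ} (hg : AEStronglyMeasurable g P)
    (hh : AEStronglyMeasurable h P) {c d : ℝ} (hc : 0 ≤ c)
    (hgc : eLpNorm g 4 P ≤ ENNReal.ofReal c) (hhd : eLpNorm h 4 P ≤ ENNReal.ofReal d) :
    eLpNorm (fun ω => g ω * h ω) 2 P ≤ ENNReal.ofReal (c * d) := by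
  rw [ENNReal.ofReal_mul hc]
  exact (eLpNorm_fun_mul_le hg hh 4 4).trans (mul_le_mul' hgc hhd)

theorem abs_integral_mul_le [IsProbabilityMeasure P] {g h : Ω → ℝ}
    (hg : AEStronglyMeasurable g P) (hh : AEStronglyMeasurable h P) {c : ℝ} (hc : 0 ≤ c)
    (hgc : eLpNorm g 4 P ≤ ENNReal.ofReal c) (hhc : eLpNorm h 4 P ≤ ENNReal.ofReal c) :
    |∫ ω, g ω * h ω ∂P| ≤ c ^ 2 := by
  rw [sq]
  exact abs_integral_le one_le_two (hg.mul hh) (mul_self_nonneg c)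
    (eLpNorm_mul_two_le_ofReal hg hh hc hgc hhc)

open ProbabilityTheory in
theorem abs_covariance_mul_mul_le [IsProbabilityMeasure P] {g h k l : Ω → ℝ} (hg : MemLp g 4 P)
    (hh : MemLp h 4 P) (hk : MemLp k 4 P) (hl : MemLp l 4 P) {c : ℝ} (hc : 0 ≤ c)
    (hgc : eLpNorm g 4 P ≤ ENNReal.ofReal c) (hhc : eLpNorm h 4 P ≤ ENNReal.ofReal c)
    (hkc : eLpNorm k 4 P ≤ ENNReal.ofReal c) (hlc : eLpNorm l 4 P ≤ ENNReal.ofReal c) :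
    |cov[fun ω => g ω * h ω, fun ω => k ω * l ω; P]| ≤ 2 * c ^ 4 := by
  have hgh : MemLp (fun ω => g ω * h ω) 2 P := hh.mul' hg
  have hkl : MemLp (fun ω => k ω * l ω) 2 P := hl.mul' hk
  have hfour : |∫ ω, g ω * h ω * (k ω * l ω) ∂P| ≤ c * c * (c * c) := by
    refine abs_integral_le_of_eLpNorm_one_le (by positivity) ?_
    rw [ENNReal.ofReal_mul (mul_self_nonneg c)]
    exact (eLpNorm_fun_mul_le hgh.1 hkl.1 2 2).trans
      (mul_le_mul' (eLpNorm_mul_two_le_ofReal hg.1 hh.1 hc hgc hhc)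
        (eLpNorm_mul_two_le_ofReal hk.1 hl.1 hc hkc hlc))
  have htwo : |(∫ ω, g ω * h ω ∂P) * ∫ ω, k ω * l ω ∂P| ≤ c ^ 2 * c ^ 2 := by
    rw [abs_mul]
    exact mul_le_mul (abs_integral_mul_le hg.1 hh.1 hc hgc hhc)
      (abs_integral_mul_le hk.1 hl.1 hc hkc hlc) (abs_nonneg _) (sq_nonneg c)
  rw [covariance_eq_sub hgh hkl]
  calc |(∫ ω, g ω * h ω * (k ω * l ω) ∂P) - (∫ ω, g ω * h ω ∂P) * ∫ ω, k ω * l ω ∂P|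
      ≤ c * c * (c * c) + c ^ 2 * c ^ 2 := (abs_sub _ _).trans (add_le_add hfour htwo)
    _ = 2 * c ^ 4 := by ring

theorem eLpNorm_mul_sub_mul_le {x x' y y' : Ω → ℝ} (hx : AEStronglyMeasurable x P)
    (hx' : AEStronglyMeasurable x' P) (hy : AEStronglyMeasurable y P)
    (hy' : AEStronglyMeasurable y' P) {ν δ : ℝ} (hν : 0 ≤ ν) (hδ : 0 ≤ δ)
    (hxν : eLpNorm x 4 P ≤ ENNReal.ofReal ν) (hyν : eLpNorm y' 4 P ≤ ENNReal.ofReal ν)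
    (h : eLpNorm (fun ω => y ω - x ω) 4 P ≤ ENNReal.ofReal δ)
    (h' : eLpNorm (fun ω => y' ω - x' ω) 4 P ≤ ENNReal.ofReal δ) :
    eLpNorm (fun ω => y ω * y' ω - x ω * x' ω) 2 P ≤ ENNReal.ofReal (δ * ν + ν * δ) := by
  have hsplit (ω : Ω) :
      y ω * y' ω - x ω * x' ω = (y ω - x ω) * y' ω + x ω * (y' ω - x' ω) := by ring
  simp only [hsplit]
  exact eLpNorm_add_le_ofReal one_le_two ((hy.sub hx).mul hy') (hx.mul (hy'.sub hx'))
    (by positivity) (by positivity) (eLpNorm_mul_two_le_ofReal (hy.sub hx) hy' hδ h hyν)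
    (eLpNorm_mul_two_le_ofReal hx (hy'.sub hx') hν hxν h')

theorem eLpNorm_mul_sub_const_le {x y : Ω → ℝ} (hx : AEStronglyMeasurable x P)
    (hy : AEStronglyMeasurable y P) {m m' ν c δ : ℝ} (hm : |m| ≤ ν) (hm' : |m'| ≤ ν)
    (hc : 0 ≤ c) (hδ : 0 ≤ δ) (hxc : eLpNorm (fun ω => x ω - m) 4 P ≤ ENNReal.ofReal c)
    (hyc : eLpNorm (fun ω => y ω - m') 4 P ≤ ENNReal.ofReal c)
    (hxδ : eLpNorm (fun ω => x ω - m) 2 P ≤ ENNReal.ofReal δ)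
    (hyδ : eLpNorm (fun ω => y ω - m') 2 P ≤ ENNReal.ofReal δ) :
    eLpNorm (fun ω => x ω * y ω - m * m') 2 P ≤
      ENNReal.ofReal (c * c + δ * ν + δ * ν) := by
  have hν : 0 ≤ ν := (abs_nonneg m).trans hm
  have hxm : AEStronglyMeasurable (fun ω => x ω - m) P := hx.sub aestronglyMeasurable_const
  have hym : AEStronglyMeasurable (fun ω => y ω - m') P := hy.sub aestronglyMeasurable_const
  have hsplit (ω : Ω) : x ω * y ω - m * m' =
      (x ω - m) * (y ω - m') + (x ω - m) * m' + (y ω - m') * m := by ring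
  simp only [hsplit]
  refine eLpNorm_add_le_ofReal one_le_two ((hxm.mul hym).add (hxm.mul_const m')) (hym.mul_const m)
    (by positivity) (by positivity) ?_ (eLpNorm_mul_const_le_ofReal hδ hyδ hm)
  exact eLpNorm_add_le_ofReal one_le_two (hxm.mul hym) (hxm.mul_const m') (by positivity)
    (by positivity) (eLpNorm_mul_two_le_ofReal hxm hym hc hxc hyc)
    (eLpNorm_mul_const_le_ofReal hδ hxδ hm')

open ProbabilityTheory in
theorem eLpNorm_sub_integral_le_sqrt [IsProbabilityMeasure P] {g : Ω → ℝ} (hg : MemLp g 2 P)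
    {v : ℝ} (h : Var[g; P] ≤ v) :
    eLpNorm (fun ω => g ω - ∫ ω, g ω ∂P) 2 P ≤ ENNReal.ofReal √v := by
  refine (eLpNorm_le_ofReal_iff even_two two_ne_zero (hg.sub (memLp_const _)) (by positivity)).2 ?_
  simp only [Pi.sub_apply]
  rwa [Real.sq_sqrt ((variance_nonneg g P).trans h), ← variance_eq_integral hg.1.aemeasurable]

theorem eLpNorm_four_le_sqrt_sqrt {g : Ω → ℝ} (hg : MemLp g 4 P) {v : ℝ}
    (h : ∫ ω, g ω ^ 4 ∂P ≤ v) : eLpNorm g 4 P ≤ ENNReal.ofReal √√v := by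
  have hv : 0 ≤ v := (integral_nonneg fun ω => (by decide : Even 4).pow_nonneg (g ω)).trans h
  refine (eLpNorm_le_ofReal_iff (by decide : Even 4) four_ne_zero hg (by positivity)).2 ?_
  rwa [pow_mul _ 2 2, Real.sq_sqrt (by positivity), Real.sq_sqrt hv]

end Norms

section Setup

open ProbabilityTheory

variable {Ω : Type*} [MeasurableSpace Ω] {P : Measure Ω} {r : ℕ}
  {X : ℝ≥0 → Ω → Fin r → ℝ} {Y : ℝ → ℝ≥0 → Ω → Fin r → ℝ} {ρ f : ℝ → ℝ} {ν : ℝ≥0}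
  {Λ : ℝ≥0 → ℝ≥0}

theorem eLpNorm_apply_le {F : Ω → Fin r → ℝ} (p : ℝ≥0∞) (i : Fin r) :
    eLpNorm (fun ω => F ω i) p P ≤ eLpNorm F p P :=
  eLpNorm_mono fun ω => norm_le_pi_norm (F ω) i

theorem memLp_apply_of_eLpNorm_le {F : Ω → Fin r → ℝ} (hF : Measurable F) {p : ℝ≥0∞} {c : ℝ≥0}
    (h : eLpNorm F p P ≤ c) (i : Fin r) : MemLp (fun ω => F ω i) p P :=
  ⟨((measurable_pi_apply i).comp hF).aestronglyMeasurable,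
    ((eLpNorm_apply_le p i).trans h).trans_lt ENNReal.coe_lt_top⟩

/-- The centered coordinate `X_t(i) - E X_0(i)`. -/
noncomputable def centered (P : Measure Ω) (X : ℝ≥0 → Ω → Fin r → ℝ) (t : ℝ≥0) (i : Fin r)
    (ω : Ω) : ℝ :=
  X t ω i - mean P X i

namespace IsSetup

theorem memLp_X (hS : IsSetup P X Y ρ ν Λ) (t : ℝ≥0) (i : Fin r) :
    MemLp (fun ω => X t ω i) 4 P :=
  memLp_apply_of_eLpNorm_le (hS.measurable_X t) (hS.bound_X t) i

theorem eLpNorm_X (hS : IsSetup P X Y ρ ν Λ) (t : ℝ≥0) (i : Fin r) :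
    eLpNorm (fun ω => X t ω i) 4 P ≤ ENNReal.ofReal ν :=
  (eLpNorm_apply_le 4 i).trans ((hS.bound_X t).trans_eq ENNReal.ofReal_coe_nnreal.symm)

theorem memLp_Y (hS : IsSetup P X Y ρ ν Λ) {ε : ℝ} (hε : 0 < ε) (t : ℝ≥0) (i : Fin r) :
    MemLp (fun ω => Y ε t ω i) 4 P :=
  memLp_apply_of_eLpNorm_le (hS.measurable_Y ε hε t) (hS.bound_Y ε hε t) i

theorem eLpNorm_Y (hS : IsSetup P X Y ρ ν Λ) {ε : ℝ} (hε : 0 < ε) (t : ℝ≥0) (i : Fin r) :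
    eLpNorm (fun ω => Y ε t ω i) 4 P ≤ ENNReal.ofReal ν :=
  (eLpNorm_apply_le 4 i).trans ((hS.bound_Y ε hε t).trans_eq ENNReal.ofReal_coe_nnreal.symm)

theorem eLpNorm_Y_sub_X (hS : IsSetup P X Y ρ ν Λ) {ε : ℝ} (hε : 0 < ε) (t : ℝ≥0) (i : Fin r) :
    eLpNorm (fun ω => Y ε t ω i - X t ω i) 4 P ≤ ENNReal.ofReal (ρ ε) :=
  (eLpNorm_apply_le (F := fun ω => Y ε t ω - X t ω) 4 i).trans (hS.speed ε hε t)

theorem integral_comp_add_right (hS : IsSetup P X Y ρ ν Λ) {n : ℕ} (t : Fin n → ℝ≥0) (h : ℝ≥0)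
    {g : (Fin n → Fin r → ℝ) → ℝ} (hg : Measurable g) :
    ∫ ω, g (fun k => X (t k + h) ω) ∂P = ∫ ω, g (fun k => X (t k) ω) ∂P := by
  have hm (t : Fin n → ℝ≥0) : AEMeasurable (fun ω k => X (t k) ω) P :=
    (measurable_pi_lambda _ fun k => hS.measurable_X (t k)).aemeasurable
  rw [← integral_map (hm t) hg.aestronglyMeasurable, ← hS.stationary n t h,
    integral_map (hm fun k => t k + h) hg.aestronglyMeasurable]

theorem integral_X (hS : IsSetup P X Y ρ ν Λ) (t : ℝ≥0) (i : Fin r) :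
    ∫ ω, X t ω i ∂P = mean P X i := by
  simpa [mean] using
    hS.integral_comp_add_right (n := 1) (fun _ => 0) t (g := fun x => x 0 i) (by fun_prop)

theorem integral_X_mul_X (hS : IsSetup P X Y ρ ν Λ) (t u : ℝ≥0) (i j : Fin r) :
    ∫ ω, X t ω i * X (t + u) ω j ∂P = lagCov P X u i j + mean P X i * mean P X j := by
  have hshift := hS.integral_comp_add_right (n := 2) ![0, u] t (g := fun x => x 0 i * x 1 j)
    (by fun_prop)
  simp only [Matrix.cons_val_zero, Matrix.cons_val_one, zero_add] at hshift
  rw [add_comm t u, hshift]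
  simp [lagCov]

theorem integral_centered_mul_centered (hS : IsSetup P X Y ρ ν Λ) (s t : ℝ≥0) (i : Fin r) :
    ∫ ω, centered P X s i ω * centered P X t i ω ∂P =
      cov[fun ω => X s ω i, fun ω => X t ω i; P] := by
  simp only [covariance, centered, hS.integral_X]

variable [IsProbabilityMeasure P]

theorem abs_mean_le (hS : IsSetup P X Y ρ ν Λ) (i : Fin r) : |mean P X i| ≤ ν :=
  abs_integral_le (by norm_num) (hS.memLp_X 0 i).1 ν.coe_nonneg (hS.eLpNorm_X 0 i)

theorem memLp_centered (hS : IsSetup P X Y ρ ν Λ) (t : ℝ≥0) (i : Fin r) :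
    MemLp (centered P X t i) 4 P :=
  (hS.memLp_X t i).sub (memLp_const _)

theorem eLpNorm_centered (hS : IsSetup P X Y ρ ν Λ) (t : ℝ≥0) (i : Fin r) :
    eLpNorm (centered P X t i) 4 P ≤ ENNReal.ofReal (2 * ν) := by
  rw [two_mul]
  exact eLpNorm_sub_le_ofReal (by norm_num) (hS.memLp_X t i).1 aestronglyMeasurable_const
    ν.coe_nonneg ν.coe_nonneg (hS.eLpNorm_X t i) (eLpNorm_const_le_ofReal 4 (hS.abs_mean_le i))

end IsSetup

theorem HasIntegrableDecorrelationRate.abs_sub_le (hf : HasIntegrableDecorrelationRate P X f)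
    {s s' t t' : ℝ≥0} (hs : s ≤ s') (hst : s' < t) (ht : t ≤ t') {G H : Ω → ℝ}
    (hG : G ∈ lowMoments X (Set.Icc s s')) (hH : H ∈ lowMoments X (Set.Icc t t')) :
    |(∫ ω, G ω * H ω ∂P) - (∫ ω, G ω ∂P) * ∫ ω, H ω ∂P| ≤ f (t - s') := by
  refine hf.decorrelation _ _ Set.ordConnected_Icc Set.ordConnected_Icc _
    (sub_pos.2 (NNReal.coe_lt_coe.2 hst)) (IsLeast.isGLB ⟨?_, ?_⟩) G hG H hH
  · exact ⟨s', ⟨hs, le_rfl⟩, t, ⟨le_rfl, ht⟩, rfl⟩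
  · rintro d ⟨a, ha, b, hb, rfl⟩
    exact sub_le_sub (NNReal.coe_le_coe.2 hb.1) (NNReal.coe_le_coe.2 ha.2)

variable [IsProbabilityMeasure P]

theorem abs_covariance_sub_mul_sub_le {p q H : Ω → ℝ} (hp : MemLp p 4 P) (hq : MemLp q 4 P)
    (hH : MemLp H 2 P) {m c ν : ℝ} (hm : |m| ≤ ν)
    (hpqH : |cov[fun ω => p ω * q ω, H; P]| ≤ c) (hpH : |cov[p, H; P]| ≤ c)
    (hqH : |cov[q, H; P]| ≤ c) :
    |cov[fun ω => (p ω - m) * (q ω - m), H; P]| ≤ (1 + 2 * ν) * c := by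
  have hp2 : MemLp p 2 P := hp.mono_exponent (by norm_num)
  have hq2 : MemLp q 2 P := hq.mono_exponent (by norm_num)
  have hpq : MemLp (fun ω => p ω * q ω) 2 P := hq.mul' hp
  have hexpand : (fun ω => (p ω - m) * (q ω - m)) =
      fun ω => (p ω * q ω - m * p ω - m * q ω) + m ^ 2 := by
    ext ω
    ring
  have hsub : MemLp (fun ω => p ω * q ω - m * p ω) 2 P := hpq.sub (hp2.const_mul m)
  have hsub₂ : MemLp (fun ω => p ω * q ω - m * p ω - m * q ω) 2 P := hsub.sub (hq2.const_mul m)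
  rw [hexpand, covariance_add_const_left (hsub₂.integrable one_le_two), covariance_fun_sub_left hsub
    (hq2.const_mul m) hH, covariance_fun_sub_left hpq (hp2.const_mul m) hH,
    covariance_const_mul_left, covariance_const_mul_left]
  have hmul {x : ℝ} (hx : |x| ≤ c) : |m * x| ≤ ν * c := by
    rw [abs_mul]
    exact mul_le_mul hm hx (abs_nonneg _) ((abs_nonneg _).trans hm)
  calc |cov[fun ω => p ω * q ω, H; P] - m * cov[p, H; P] - m * cov[q, H; P]|
      ≤ c + ν * c + ν * c :=
        (abs_sub _ _).trans (add_le_add ((abs_sub _ _).trans (add_le_add hpqH (hmul hpH)))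
          (hmul hqH))
    _ = (1 + 2 * ν) * c := by ring

namespace IsSetup

theorem abs_covariance_le (hS : IsSetup P X Y ρ ν Λ) (hf : HasIntegrableDecorrelationRate P X f)
    {s s' t t' : ℝ≥0} (hs : s ≤ s') (hst : s' < t) (ht : t ≤ t') {G H : Ω → ℝ}
    (hG : G ∈ lowMoments X (Set.Icc s s')) (hH : H ∈ lowMoments X (Set.Icc t t')) :
    |cov[G, H; P]| ≤ f (t - s') := by
  have hmem {U : Set ℝ≥0} {G : Ω → ℝ} (hG : G ∈ lowMoments X U) : MemLp G 2 P := by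
    rcases hG with ⟨s, -, i, rfl⟩ | ⟨s, -, t, -, i, j, rfl⟩
    · exact (hS.memLp_X s i).mono_exponent (by norm_num)
    · exact (hS.memLp_X t j).mul' (hS.memLp_X s i)
  rw [covariance_eq_sub (hmem hG) (hmem hH)]
  exact hf.abs_sub_le hs hst ht hG hH

theorem abs_covariance_centered_le (hS : IsSetup P X Y ρ ν Λ)
    (hf : HasIntegrableDecorrelationRate P X f)
    {s s' t t' : ℝ≥0} (hs : s ≤ s') (hst : s' < t) (ht : t ≤ t') (i : Fin r) :
    |cov[fun ω => centered P X s i ω * centered P X s' i ω,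
      fun ω => centered P X t i ω * centered P X t' i ω; P]|
      ≤ (1 + 2 * ν) ^ 2 * f (t - s') := by
  have hlow : ∀ G ∈ lowMoments X (Set.Icc s s'), MemLp G 2 P →
      |cov[G, fun ω => centered P X t i ω * centered P X t' i ω; P]|
        ≤ (1 + 2 * ν) * f (t - s') := by
    intro G hG hG2
    have hGH (H : Ω → ℝ) (hH : H ∈ lowMoments X (Set.Icc t t')) : |cov[H, G; P]| ≤ f (t - s') := by
      rw [covariance_comm]
      exact hS.abs_covariance_le hf hs hst ht hG hH
    rw [covariance_comm]
    exact abs_covariance_sub_mul_sub_le (hS.memLp_X t i) (hS.memLp_X t' i) hG2 (hS.abs_mean_le i)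
      (hGH _ (Or.inr ⟨t, ⟨le_rfl, ht⟩, t', ⟨ht, le_rfl⟩, i, i, rfl⟩))
      (hGH _ (Or.inl ⟨t, ⟨le_rfl, ht⟩, i, rfl⟩)) (hGH _ (Or.inl ⟨t', ⟨ht, le_rfl⟩, i, rfl⟩))
  rw [sq, mul_assoc]
  exact abs_covariance_sub_mul_sub_le (hS.memLp_X s i) (hS.memLp_X s' i)
    ((hS.memLp_centered t' i).mul' (hS.memLp_centered t i)) (hS.abs_mean_le i)
    (hlow _ (Or.inr ⟨s, ⟨le_rfl, hs⟩, s', ⟨hs, le_rfl⟩, i, i, rfl⟩)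
      ((hS.memLp_X s' i).mul' (hS.memLp_X s i)))
    (hlow _ (Or.inl ⟨s, ⟨le_rfl, hs⟩, i, rfl⟩) ((hS.memLp_X s i).mono_exponent (by norm_num)))
    (hlow _ (Or.inl ⟨s', ⟨hs, le_rfl⟩, i, rfl⟩) ((hS.memLp_X s' i).mono_exponent (by norm_num)))

end IsSetup

/-- A common bound of the second moments and of the covariances of products of two coordinates,
centered or not, of a process with `L⁴` bound `ν`. -/
def momentBound (ν : ℝ) : ℝ := 4 * ν ^ 2 + 32 * ν ^ 4

theorem momentBound_nonneg (ν : ℝ) : 0 ≤ momentBound ν := by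
  unfold momentBound
  positivity

/-- The bound of the correlations of the sampled process at the distance of `k` steps. -/
noncomputable def sampledRate (f : ℝ → ℝ) (ν Δ : ℝ) : ℕ → ℝ :=
  rateBound (fun T => (1 + 2 * ν) ^ 2 * f T) (momentBound ν) Δ

theorem le_sampledRate {Δ : ℝ≥0} {x : ℝ} {b c : ℕ} (hbc : b ≤ c) (hx : x ≤ momentBound ν)
    (hgap : (b : ℝ≥0) * Δ < c * Δ →
      x ≤ (1 + 2 * ν) ^ 2 * f ((c * Δ : ℝ≥0) - (b * Δ : ℝ≥0))) :
    x ≤ sampledRate f ν Δ (c - b) := by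
  have hdist : ((c * Δ : ℝ≥0) : ℝ) - (b * Δ : ℝ≥0) = (c - b : ℕ) * Δ := by
    push_cast [hbc]
    ring
  unfold sampledRate rateBound
  split_ifs with h
  · exact hx
  · rw [← hdist] at h ⊢
    exact hgap (NNReal.coe_lt_coe.1 (by linarith))

namespace IsSetup

theorem abs_integral_sampled_le (hS : IsSetup P X Y ρ ν Λ)
    (hf : HasIntegrableDecorrelationRate P X f) (Δ : ℝ≥0) (i : Fin r) {a b : ℕ} (hab : a ≤ b) :
    |∫ ω, centered P X (a * Δ) i ω * centered P X (b * Δ) i ω ∂P| ≤ sampledRate f ν Δ (b - a) := by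
  refine le_sampledRate hab ?_ fun hlt => ?_
  · refine (abs_integral_mul_le (hS.memLp_centered _ i).1 (hS.memLp_centered _ i).1 (by positivity)
      (hS.eLpNorm_centered _ i) (hS.eLpNorm_centered _ i)).trans ?_
    unfold momentBound
    nlinarith [pow_nonneg ν.coe_nonneg 4]
  · have hcov := hS.abs_covariance_le hf le_rfl hlt le_rfl
      (Or.inl ⟨_, ⟨le_rfl, le_rfl⟩, i, rfl⟩) (Or.inl ⟨_, ⟨le_rfl, le_rfl⟩, i, rfl⟩)
    rw [hS.integral_centered_mul_centered]
    exact hcov.trans (le_mul_of_one_le_left ((abs_nonneg _).trans hcov)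
      (one_le_pow₀ (by linarith [ν.coe_nonneg])))

theorem abs_covariance_sampled_le (hS : IsSetup P X Y ρ ν Λ)
    (hf : HasIntegrableDecorrelationRate P X f) (Δ : ℝ≥0) (i : Fin r) (a b : ℕ) :
    |cov[fun ω => X (a * Δ) ω i, fun ω => X (b * Δ) ω i; P]| ≤
      sampledRate f ν Δ (Nat.dist a b) := by
  wlog hab : a ≤ b generalizing a b
  · rw [covariance_comm, Nat.dist_comm]
    exact this b a (by omega)
  rw [← hS.integral_centered_mul_centered, Nat.dist_eq_sub_of_le hab]
  exact hS.abs_integral_sampled_le hf Δ i hab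

theorem abs_integral_sampled_four_le (hS : IsSetup P X Y ρ ν Λ)
    (hf : HasIntegrableDecorrelationRate P X f) (Δ : ℝ≥0) (i : Fin r) {a b c d : ℕ} (hab : a ≤ b)
    (hbc : b ≤ c) (hcd : c ≤ d) :
    |(∫ ω, centered P X (a * Δ) i ω * centered P X (b * Δ) i ω *
        (centered P X (c * Δ) i ω * centered P X (d * Δ) i ω) ∂P)
      - (∫ ω, centered P X (a * Δ) i ω * centered P X (b * Δ) i ω ∂P) *
        ∫ ω, centered P X (c * Δ) i ω * centered P X (d * Δ) i ω ∂P|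
      ≤ sampledRate f ν Δ (c - b) := by
  have hmem (a b : ℕ) :
      MemLp (fun ω => centered P X (a * Δ) i ω * centered P X (b * Δ) i ω) 2 P :=
    (hS.memLp_centered _ i).mul' (hS.memLp_centered _ i)
  refine (congrArg abs (covariance_eq_sub (hmem a b) (hmem c d)).symm).trans_le
    (le_sampledRate hbc ?_ fun hlt =>
      hS.abs_covariance_centered_le hf (by gcongr) hlt (by gcongr) i)
  refine (abs_covariance_mul_mul_le (hS.memLp_centered _ i) (hS.memLp_centered _ i)
    (hS.memLp_centered _ i) (hS.memLp_centered _ i) (by positivity) (hS.eLpNorm_centered _ i)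
    (hS.eLpNorm_centered _ i) (hS.eLpNorm_centered _ i) (hS.eLpNorm_centered _ i)).trans ?_
  unfold momentBound
  nlinarith [pow_nonneg ν.coe_nonneg 2]

theorem abs_covariance_sampled_mul_le (hS : IsSetup P X Y ρ ν Λ)
    (hf : HasIntegrableDecorrelationRate P X f) (Δ : ℝ≥0) (κ : ℕ) (i j : Fin r) (n m : ℕ) :
    |cov[fun ω => X (n * Δ) ω i * X ((n + κ : ℕ) * Δ) ω j,
      fun ω => X (m * Δ) ω i * X ((m + κ : ℕ) * Δ) ω j; P]|
      ≤ if Nat.dist n m < κ then momentBound ν else sampledRate f ν Δ (Nat.dist n m - κ) := by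
  wlog hnm : n ≤ m generalizing n m
  · rw [covariance_comm, Nat.dist_comm]
    exact this m n (by omega)
  have hcrude : |cov[fun ω => X (n * Δ) ω i * X ((n + κ : ℕ) * Δ) ω j,
      fun ω => X (m * Δ) ω i * X ((m + κ : ℕ) * Δ) ω j; P]| ≤ momentBound ν := by
    refine (abs_covariance_mul_mul_le (hS.memLp_X _ i) (hS.memLp_X _ j) (hS.memLp_X _ i)
      (hS.memLp_X _ j) ν.coe_nonneg (hS.eLpNorm_X _ i) (hS.eLpNorm_X _ j) (hS.eLpNorm_X _ i)
      (hS.eLpNorm_X _ j)).trans ?_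
    unfold momentBound
    nlinarith [pow_nonneg ν.coe_nonneg 2, pow_nonneg ν.coe_nonneg 4]
  rw [Nat.dist_eq_sub_of_le hnm]
  split_ifs with hκ
  · exact hcrude
  rw [Nat.sub_sub]
  refine le_sampledRate (by omega) hcrude fun hlt => ?_
  have hle (k : ℕ) : (k : ℝ≥0) * Δ ≤ (k + κ : ℕ) * Δ := by
    gcongr
    omega
  have hcov := hS.abs_covariance_le hf (hle n) hlt (hle m)
    (Or.inr ⟨_, ⟨le_rfl, hle n⟩, _, ⟨hle n, le_rfl⟩, i, j, rfl⟩)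
    (Or.inr ⟨_, ⟨le_rfl, hle m⟩, _, ⟨hle m, le_rfl⟩, i, j, rfl⟩)
  exact hcov.trans (le_mul_of_one_le_left ((abs_nonneg _).trans hcov)
    (one_le_pow₀ (by linarith [ν.coe_nonneg])))

end IsSetup

end Setup

section Averages

variable {Ω ι : Type*} [MeasurableSpace Ω] {P : Measure Ω}

theorem memLp_average {p : ℝ≥0∞} {s : Finset ι} {g : ι → Ω → ℝ} (hg : ∀ n, MemLp (g n) p P)
    (c : ℝ) : MemLp (fun ω => c * ∑ n ∈ s, g n ω) p P :=
  (memLp_finsetSum _ fun n _ => hg n).const_mul _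

end Averages

section Estimators

variable {Ω : Type*} {r : ℕ}

/-- The average over `1 ≤ n ≤ N` of the coordinate `i` of `Z` at the times `(n + k) Δ`. -/
noncomputable def delayedMean (Z : ℝ≥0 → Ω → Fin r → ℝ) (N : ℕ) (Δ : ℝ≥0) (k : ℕ) (i : Fin r)
    (ω : Ω) : ℝ :=
  (N : ℝ)⁻¹ * ∑ n ∈ Finset.Icc 1 N, Z ((n + k : ℕ) * Δ) ω i

/-- The average over `1 ≤ n ≤ N` of `Z_{nΔ}(i) Z_{(n+κ)Δ}(j)`. -/
noncomputable def laggedProductMean (Z : ℝ≥0 → Ω → Fin r → ℝ) (N : ℕ) (Δ : ℝ≥0) (κ : ℕ)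
    (i j : Fin r) (ω : Ω) : ℝ :=
  (N : ℝ)⁻¹ * ∑ n ∈ Finset.Icc 1 N, Z (n * Δ) ω i * Z ((n + κ : ℕ) * Δ) ω j

theorem empMean_apply (Z : ℝ≥0 → Ω → Fin r → ℝ) (N : ℕ) (Δ : ℝ≥0) (ω : Ω) (i : Fin r) :
    empMean Z N Δ ω i = delayedMean Z N Δ 0 i ω := by
  simp [empMean, delayedMean]

theorem shiftedEmpMean_apply (Z : ℝ≥0 → Ω → Fin r → ℝ) (N : ℕ) (Δ u : ℝ≥0) (ω : Ω) (i : Fin r) :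
    shiftedEmpMean Z N Δ u ω i = delayedMean Z N Δ (lagIndex Δ u) i ω := by
  simp [shiftedEmpMean, delayedMean]

theorem empCov_apply (Z : ℝ≥0 → Ω → Fin r → ℝ) (N : ℕ) (Δ u : ℝ≥0) (ω : Ω) (i j : Fin r) :
    empCov Z N Δ u ω i j = laggedProductMean Z N Δ (lagIndex Δ u) i j ω
      - delayedMean Z N Δ 0 i ω * delayedMean Z N Δ (lagIndex Δ u) j ω := by
  rw [← empMean_apply, ← shiftedEmpMean_apply]
  simp [empCov, laggedProductMean, Matrix.sum_apply, Matrix.vecMulVec_apply]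

theorem delayedMean_sub_const (Z : ℝ≥0 → Ω → Fin r → ℝ) {N : ℕ} (hN : N ≠ 0) (Δ : ℝ≥0) (k : ℕ)
    (i : Fin r) (c : ℝ) (ω : Ω) :
    delayedMean Z N Δ k i ω - c =
      (N : ℝ)⁻¹ * ∑ n ∈ Finset.Icc 1 N, (Z ((n + k : ℕ) * Δ) ω i - c) := by
  have hN' : (N : ℝ) ≠ 0 := Nat.cast_ne_zero.2 hN
  simp [delayedMean, mul_sub, hN']

theorem abs_lagIndex_mul_sub_le {Δ : ℝ≥0} (hΔ : 0 < Δ) (u : ℝ≥0) :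
    |(lagIndex Δ u : ℝ) * Δ - u| ≤ Δ := by
  have hΔ' : (0 : ℝ) < Δ := hΔ
  have hle : (lagIndex Δ u : ℝ) ≤ u / Δ + 1 / 2 := by
    exact_mod_cast Nat.floor_le (zero_le : 0 ≤ u / Δ + 1 / 2)
  have hlt : (u : ℝ) / Δ + 1 / 2 < lagIndex Δ u + 1 := by
    exact_mod_cast Nat.lt_floor_add_one (u / Δ + 1 / 2)
  have hle_mul := mul_le_mul_of_nonneg_right hle hΔ'.le
  have hlt_mul := mul_le_mul_of_nonneg_right hlt.le hΔ'.le
  rw [add_mul, div_mul_cancel₀ _ hΔ'.ne'] at hle_mul hlt_mul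
  exact abs_le.2 ⟨by linarith, by linarith⟩

end Estimators

section Sampling

open ProbabilityTheory

variable {Ω : Type*} [MeasurableSpace Ω] {P : Measure Ω} {r : ℕ}
  {X : ℝ≥0 → Ω → Fin r → ℝ} {Y : ℝ → ℝ≥0 → Ω → Fin r → ℝ} {ρ f : ℝ → ℝ} {ν : ℝ≥0}
  {Λ : ℝ≥0 → ℝ≥0} {J : ℝ} {Δ : ℝ≥0} {N : ℕ}

/-- `Δ⁻¹` times this constant bounds the sum over one time index of the covariances of the lagged
products at step `Δ`, for lags at most `τ`; the case `τ = 0` serves for the process itself. -/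
def correlationConstant (ν J τ : ℝ) : ℝ := (3 + τ) * momentBound ν + (1 + 2 * ν) ^ 2 * J

/-- Sampling a setup at lags at most `τ` over the time span `S` estimates the covariances with
`L²` error at most `S ^ (-1/2)` times this constant. The three terms come from the lagged products,
from the product of the two centered means, and from each of the means times an expectation. -/
noncomputable def samplingConstant (ν J τ : ℝ) : ℝ :=
  √(2 * correlationConstant ν J τ) +
    (√(24 * (1 + (2 * ν) ^ 2) * correlationConstant ν J 0) +
      √(2 * correlationConstant ν J 0) * ν + √(2 * correlationConstant ν J 0) * ν)

theorem samplingConstant_nonneg {ν : ℝ} (hν : 0 ≤ ν) (J τ : ℝ) : 0 ≤ samplingConstant ν J τ := by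
  unfold samplingConstant
  positivity

theorem sampledRate_nonneg (hf : HasIntegrableDecorrelationRate P X f) (ν Δ : ℝ) (k : ℕ) :
    0 ≤ sampledRate f ν Δ k :=
  rateBound_nonneg (fun T hT => mul_nonneg (by positivity) (hf.pos T hT).le)
    (momentBound_nonneg ν) k

theorem sum_sampledRate_le (hf : HasIntegrableDecorrelationRate P X f)
    (hJ : ∫ T in Set.Ioi (1 : ℝ), f T ≤ J) (hΔ : 0 < Δ) (hΔ1 : Δ ≤ 1) (ν : ℝ) (n : ℕ) :
    ∑ k ∈ Finset.range n, sampledRate f ν Δ k ≤ correlationConstant ν J 0 / Δ := by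
  refine (sum_rateBound_le (fun T hT => mul_nonneg (by positivity) (hf.pos T hT).le)
    (fun a ha b hb hab => mul_le_mul_of_nonneg_left (hf.antitone ha hb hab) (by positivity))
    (hf.integrable.const_mul _) (momentBound_nonneg ν) (NNReal.coe_pos.2 hΔ)
    (by exact_mod_cast hΔ1) n).trans ?_
  rw [integral_const_mul, correlationConstant, add_zero]
  gcongr

namespace IsSetup

theorem memLp_delayedMean_X (hS : IsSetup P X Y ρ ν Λ) (k : ℕ) (i : Fin r) :
    MemLp (delayedMean X N Δ k i) 4 P :=
  memLp_average (fun _ => hS.memLp_X _ i) _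

theorem memLp_delayedMean_Y (hS : IsSetup P X Y ρ ν Λ) {ε : ℝ} (hε : 0 < ε) (k : ℕ)
    (i : Fin r) : MemLp (delayedMean (Y ε) N Δ k i) 4 P :=
  memLp_average (fun _ => hS.memLp_Y hε _ i) _

theorem memLp_laggedProductMean_X (hS : IsSetup P X Y ρ ν Λ) (κ : ℕ) (i j : Fin r) :
    MemLp (laggedProductMean X N Δ κ i j) 2 P :=
  memLp_average (fun _ => (hS.memLp_X _ j).mul' (hS.memLp_X _ i)) _

theorem memLp_laggedProductMean_Y (hS : IsSetup P X Y ρ ν Λ) {ε : ℝ} (hε : 0 < ε) (κ : ℕ)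
    (i j : Fin r) : MemLp (laggedProductMean (Y ε) N Δ κ i j) 2 P :=
  memLp_average (fun _ => (hS.memLp_Y hε _ j).mul' (hS.memLp_Y hε _ i)) _

variable [IsProbabilityMeasure P]

theorem integral_delayedMean (hS : IsSetup P X Y ρ ν Λ) (hN : N ≠ 0) (k : ℕ) (i : Fin r) :
    ∫ ω, delayedMean X N Δ k i ω ∂P = mean P X i := by
  have hN' : (N : ℝ) ≠ 0 := Nat.cast_ne_zero.2 hN
  unfold delayedMean
  rw [integral_const_mul,
    integral_finsetSum _ fun n _ => (hS.memLp_X _ i).integrable (by norm_num)]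
  simp [hS.integral_X, hN']

theorem integral_laggedProductMean (hS : IsSetup P X Y ρ ν Λ) (hN : N ≠ 0) (κ : ℕ)
    (i j : Fin r) :
    ∫ ω, laggedProductMean X N Δ κ i j ω ∂P =
      lagCov P X (κ * Δ) i j + mean P X i * mean P X j := by
  have hN' : (N : ℝ) ≠ 0 := Nat.cast_ne_zero.2 hN
  have hterm (n : ℕ) : ∫ ω, X (n * Δ) ω i * X ((n + κ : ℕ) * Δ) ω j ∂P =
      lagCov P X (κ * Δ) i j + mean P X i * mean P X j := by
    rw [Nat.cast_add, add_mul, hS.integral_X_mul_X]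
  unfold laggedProductMean
  rw [integral_const_mul, integral_finsetSum _ fun n _ =>
    memLp_one_iff_integrable.1 (((hS.memLp_X _ j).mul' (hS.memLp_X _ i)).mono_exponent one_le_two)]
  simp only [hterm, Finset.sum_const, Nat.card_Icc, Nat.add_sub_cancel, nsmul_eq_mul,
    inv_mul_cancel_left₀ hN']

theorem variance_delayedMean_le (hS : IsSetup P X Y ρ ν Λ)
    (hf : HasIntegrableDecorrelationRate P X f) (hJ : ∫ T in Set.Ioi (1 : ℝ), f T ≤ J)
    (hΔ : 0 < Δ) (hΔ1 : Δ ≤ 1) (k : ℕ) (i : Fin r) :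
    Var[delayedMean X N Δ k i; P] ≤ 2 * correlationConstant ν J 0 / (N * Δ) := by
  have h := variance_average_le (P := P) (sampledRate_nonneg hf ν Δ)
    (sum_sampledRate_le hf hJ hΔ hΔ1 ν) (Finset.Icc 1 N) (fun n ω => X ((n + k : ℕ) * Δ) ω i)
    (fun n => (hS.memLp_X _ i).mono_exponent (by norm_num))
    (fun n m => by
      simpa only [Nat.dist_add_add_right] using hS.abs_covariance_sampled_le hf Δ i (n + k) (m + k))
  simp only [Nat.card_Icc, Nat.add_sub_cancel] at h
  refine h.trans_eq ?_
  rw [mul_div_assoc', div_div, mul_comm (Δ : ℝ)]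

theorem integral_delayedMean_sub_pow_four_le (hS : IsSetup P X Y ρ ν Λ)
    (hf : HasIntegrableDecorrelationRate P X f) (hJ : ∫ T in Set.Ioi (1 : ℝ), f T ≤ J)
    (hΔ : 0 < Δ) (hΔ1 : Δ ≤ 1) (hN : N ≠ 0) (k : ℕ) (i : Fin r) :
    ∫ ω, (delayedMean X N Δ k i ω - mean P X i) ^ 4 ∂P ≤
      24 * (1 + (2 * ν) ^ 2) * correlationConstant ν J 0 / (N * Δ) := by
  have h := integral_average_pow_four_le (P := P) (sampledRate_nonneg hf ν Δ)
    (sum_sampledRate_le hf hJ hΔ hΔ1 ν) (Finset.Icc 1 N)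
    (fun n => centered P X ((n + k : ℕ) * Δ) i) (fun n => hS.memLp_centered _ i)
    (fun a b => abs_integral_mul_le (hS.memLp_centered _ i).1 (hS.memLp_centered _ i).1
      (by positivity) (hS.eLpNorm_centered _ i) (hS.eLpNorm_centered _ i))
    (fun a b hab => by
      simpa only [Nat.add_sub_add_right] using
        hS.abs_integral_sampled_le hf Δ i (Nat.add_le_add_right hab k))
    (fun a b c d hab hbc hcd => by
      simpa only [Nat.add_sub_add_right] using
        hS.abs_integral_sampled_four_le hf Δ i (Nat.add_le_add_right hab k)
          (Nat.add_le_add_right hbc k) (Nat.add_le_add_right hcd k))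
  simp only [Nat.card_Icc, Nat.add_sub_cancel] at h
  simp only [delayedMean_sub_const X hN]
  refine h.trans_eq ?_
  rw [mul_div_assoc', div_div, mul_comm (Δ : ℝ)]

theorem variance_laggedProductMean_le (hS : IsSetup P X Y ρ ν Λ)
    (hf : HasIntegrableDecorrelationRate P X f) (hJ : ∫ T in Set.Ioi (1 : ℝ), f T ≤ J)
    (hΔ : 0 < Δ) (hΔ1 : Δ ≤ 1) {τ : ℝ} {κ : ℕ} (hκ : κ * Δ ≤ τ) (i j : Fin r) :
    Var[laggedProductMean X N Δ κ i j; P] ≤ 2 * correlationConstant ν J τ / (N * Δ) := by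
  have hΔ' : (0 : ℝ) < Δ := hΔ
  have hM := momentBound_nonneg ν
  have hnonneg (k : ℕ) : 0 ≤ if k < κ then momentBound ν else sampledRate f ν Δ (k - κ) := by
    split_ifs
    exacts [hM, sampledRate_nonneg hf _ _ _]
  have hsum (n : ℕ) : ∑ k ∈ Finset.range n,
      (if k < κ then momentBound ν else sampledRate f ν Δ (k - κ)) ≤
        correlationConstant ν J τ / Δ := by
    refine (sum_ite_lt_le (sampledRate_nonneg hf ν Δ) hM
      (sum_sampledRate_le hf hJ hΔ hΔ1 ν) κ n).trans ?_
    rw [le_div_iff₀ hΔ', add_mul, div_mul_cancel₀ _ hΔ'.ne', correlationConstant,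
      correlationConstant]
    nlinarith
  have h := variance_average_le (P := P) hnonneg hsum (Finset.Icc 1 N)
    (fun n ω => X (n * Δ) ω i * X ((n + κ : ℕ) * Δ) ω j)
    (fun n => (hS.memLp_X _ j).mul' (hS.memLp_X _ i))
    (fun n m => hS.abs_covariance_sampled_mul_le hf Δ κ i j n m)
  simp only [Nat.card_Icc, Nat.add_sub_cancel] at h
  refine h.trans_eq ?_
  rw [mul_div_assoc', div_div, mul_comm (Δ : ℝ)]

theorem eLpNorm_delayedMean_sub_mean_le (hS : IsSetup P X Y ρ ν Λ)
    (hf : HasIntegrableDecorrelationRate P X f) (hJ : ∫ T in Set.Ioi (1 : ℝ), f T ≤ J)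
    (hΔ : 0 < Δ) (hΔ1 : Δ ≤ 1) (hN : N ≠ 0) (k : ℕ) (i : Fin r) :
    eLpNorm (fun ω => delayedMean X N Δ k i ω - mean P X i) 2 P
      ≤ ENNReal.ofReal √(2 * correlationConstant ν J 0 / (N * Δ)) := by
  have h := eLpNorm_sub_integral_le_sqrt
    ((hS.memLp_delayedMean_X (N := N) (Δ := Δ) k i).mono_exponent (by norm_num))
    (hS.variance_delayedMean_le hf hJ hΔ hΔ1 k i)
  rwa [hS.integral_delayedMean hN] at h

theorem eLpNorm_delayedMean_mul_sub_le (hS : IsSetup P X Y ρ ν Λ)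
    (hf : HasIntegrableDecorrelationRate P X f) (hJ : ∫ T in Set.Ioi (1 : ℝ), f T ≤ J)
    (hΔ : 0 < Δ) (hΔ1 : Δ ≤ 1) (hN : N ≠ 0) (k l : ℕ) (i j : Fin r) :
    eLpNorm (fun ω => delayedMean X N Δ k i ω * delayedMean X N Δ l j ω
        - mean P X i * mean P X j) 2 P
      ≤ ENNReal.ofReal (√(24 * (1 + (2 * ν) ^ 2) * correlationConstant ν J 0 / (N * Δ))
        + √(2 * correlationConstant ν J 0 / (N * Δ)) * ν
        + √(2 * correlationConstant ν J 0 / (N * Δ)) * ν) := by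
  have hfour (k : ℕ) (i : Fin r) := eLpNorm_four_le_sqrt_sqrt
    ((hS.memLp_delayedMean_X k i).sub (memLp_const _))
    (hS.integral_delayedMean_sub_pow_four_le hf hJ hΔ hΔ1 hN k i)
  refine (eLpNorm_mul_sub_const_le (hS.memLp_delayedMean_X k i).1 (hS.memLp_delayedMean_X l j).1
    (hS.abs_mean_le i) (hS.abs_mean_le j) (Real.sqrt_nonneg _) (Real.sqrt_nonneg _)
    (hfour k i) (hfour l j) (hS.eLpNorm_delayedMean_sub_mean_le hf hJ hΔ hΔ1 hN k i)
    (hS.eLpNorm_delayedMean_sub_mean_le hf hJ hΔ hΔ1 hN l j)).trans_eq ?_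
  rw [Real.mul_self_sqrt (Real.sqrt_nonneg _)]

theorem eLpNorm_empCov_X_sub_le (hS : IsSetup P X Y ρ ν Λ)
    (hf : HasIntegrableDecorrelationRate P X f) (hJ : ∫ T in Set.Ioi (1 : ℝ), f T ≤ J)
    (hΔ : 0 < Δ) (hΔ1 : Δ ≤ 1) (hN : N ≠ 0) {u : ℝ≥0} {τ : ℝ} (hτ : lagIndex Δ u * Δ ≤ τ)
    (i j : Fin r) :
    eLpNorm (fun ω => empCov X N Δ u ω i j - lagCov P X (lagIndex Δ u * Δ) i j) 2 P
      ≤ ENNReal.ofReal (samplingConstant ν J τ / √(N * Δ)) := by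
  set κ := lagIndex Δ u
  have hsplit (ω : Ω) : empCov X N Δ u ω i j - lagCov P X (κ * Δ) i j =
      (laggedProductMean X N Δ κ i j ω - (lagCov P X (κ * Δ) i j + mean P X i * mean P X j))
        - (delayedMean X N Δ 0 i ω * delayedMean X N Δ κ j ω - mean P X i * mean P X j) := by
    rw [empCov_apply]
    ring
  have hproduct := eLpNorm_sub_integral_le_sqrt (hS.memLp_laggedProductMean_X κ i j)
    (hS.variance_laggedProductMean_le (N := N) hf hJ hΔ hΔ1 hτ i j)
  rw [hS.integral_laggedProductMean hN] at hproduct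
  simp only [hsplit]
  refine (eLpNorm_sub_le_ofReal one_le_two
    ((hS.memLp_laggedProductMean_X κ i j).1.sub aestronglyMeasurable_const)
    (((hS.memLp_delayedMean_X 0 i).1.mul (hS.memLp_delayedMean_X κ j).1).sub
      aestronglyMeasurable_const) (by positivity) (by positivity) hproduct
    (hS.eLpNorm_delayedMean_mul_sub_le hf hJ hΔ hΔ1 hN 0 κ i j)).trans_eq ?_
  simp only [Real.sqrt_div' _ (show (0 : ℝ) ≤ N * Δ by positivity), samplingConstant]
  congr 1
  ring

end IsSetup

end Sampling

section Schemes

variable {ρ : ℝ → ℝ} {a b : ℝ} {N : ℝ → ℕ} {Δ : ℝ → ℝ≥0}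

namespace IsSpeed

theorem eventually_pos (hρ : IsSpeed ρ) : ∀ᶠ ε in 𝓝[>] (0 : ℝ), 0 < ρ ε :=
  eventually_nhdsWithin_of_forall fun ε hε => hρ.1 ε hε

theorem tendsto_inv_pow_atTop (hρ : IsSpeed ρ) {k : ℕ} (hk : k ≠ 0) :
    Tendsto (fun ε => (ρ ε ^ k)⁻¹) (𝓝[>] 0) atTop := by
  have hzero : Tendsto (fun ε => ρ ε ^ k) (𝓝[>] 0) (𝓝 0) := by
    simpa [hk] using hρ.2.pow k
  exact (tendsto_nhdsWithin_iff.2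
    ⟨hzero, hρ.eventually_pos.mono fun ε hε => pow_pos hε k⟩).inv_tendsto_nhdsGT_zero

end IsSpeed

namespace IsOptimizedScheme

theorem tendsto_step (h : IsOptimizedScheme ρ a b N Δ) (hρ : IsSpeed ρ) :
    Tendsto Δ (𝓝[>] 0) (𝓝 0) := by
  have hlim := h.step_similar.2.mul hρ.2
  rw [mul_zero] at hlim
  refine NNReal.tendsto_coe.1 (hlim.congr' ?_)
  filter_upwards [hρ.eventually_pos] with ε hε using div_mul_cancel₀ _ hε.ne'

theorem tendsto_span_mul_sq (h : IsOptimizedScheme ρ a b N Δ) (hρ : IsSpeed ρ) :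
    Tendsto (fun ε => span N Δ ε * ρ ε ^ 2) (𝓝[>] 0) (𝓝 (a * b)) := by
  refine (h.number_similar.2.mul h.step_similar.2).congr' ?_
  filter_upwards [hρ.eventually_pos] with ε hε
  rw [span]
  field_simp

theorem isBigO_span (h : IsOptimizedScheme ρ a b N Δ) (hρ : IsSpeed ρ) :
    span N Δ =O[𝓝[>] 0] fun ε => (ρ ε ^ 2)⁻¹ := by
  have hbound := ((h.tendsto_span_mul_sq hρ).isBigO_one ℝ).mul
    (Asymptotics.isBigO_refl (fun ε => (ρ ε ^ 2)⁻¹) (𝓝[>] 0))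
  refine hbound.congr' ?_ (Eventually.of_forall fun _ => one_mul _)
  filter_upwards [hρ.eventually_pos] with ε hε using
    mul_inv_cancel_right₀ (pow_ne_zero 2 hε.ne') _

theorem isAdaptiveScheme (h : IsOptimizedScheme ρ a b N Δ) (hρ : IsSpeed ρ) :
    IsAdaptiveScheme N Δ where
  step_pos := h.step_pos
  step_tendsto := h.tendsto_step hρ
  span_tendsto := by
    refine ((h.tendsto_span_mul_sq hρ).pos_mul_atTop
      (mul_pos h.number_similar.1 h.step_similar.1)
      (hρ.tendsto_inv_pow_atTop two_ne_zero)).congr' ?_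
    filter_upwards [hρ.eventually_pos] with ε hε using
      mul_inv_cancel_right₀ (pow_ne_zero 2 hε.ne') _

theorem eventually_inv_sqrt_span_le (h : IsOptimizedScheme ρ a b N Δ) (hρ : IsSpeed ρ) :
    ∀ᶠ ε in 𝓝[>] (0 : ℝ), (√(N ε * Δ ε))⁻¹ ≤ √(2 / (a * b)) * ρ ε := by
  have hab : 0 < a * b := mul_pos h.number_similar.1 h.step_similar.1
  filter_upwards [hρ.eventually_pos,
    (h.tendsto_span_mul_sq hρ).eventually_const_lt (half_lt_self hab)] with ε hε hlt
  rw [span] at hlt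
  have hspan : 0 < (N ε : ℝ) * Δ ε :=
    pos_of_mul_pos_left ((half_pos hab).trans hlt) (sq_nonneg (ρ ε))
  rw [← Real.sqrt_inv, Real.sqrt_le_left (by positivity), mul_pow, Real.sq_sqrt (by positivity),
    inv_le_iff_one_le_mul₀ hspan]
  calc (1 : ℝ) = 2 / (a * b) * (a * b / 2) := by
        rw [div_mul_div_cancel₀ hab.ne', div_self two_ne_zero]
    _ ≤ 2 / (a * b) * (N ε * Δ ε * ρ ε ^ 2) := by gcongr
    _ = 2 / (a * b) * ρ ε ^ 2 * (N ε * Δ ε) := by ring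

theorem eventually_step_le (h : IsOptimizedScheme ρ a b N Δ) (hρ : IsSpeed ρ) :
    ∀ᶠ ε in 𝓝[>] (0 : ℝ), Δ ε ≤ 2 * b * ρ ε := by
  filter_upwards [hρ.eventually_pos,
    h.step_similar.2.eventually_lt_const (lt_mul_of_one_lt_left h.step_similar.1 one_lt_two)]
    with ε hε hlt using ((div_lt_iff₀ hε).1 hlt).le

end IsOptimizedScheme

theorem IsAdaptiveScheme.eventually_ne_zero (h : IsAdaptiveScheme N Δ) :
    ∀ᶠ ε in 𝓝[>] (0 : ℝ), N ε ≠ 0 := by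
  filter_upwards [h.span_tendsto.eventually_gt_atTop 0] with ε hε hN
  simp [hN] at hε

theorem exists_isOptimizedScheme (hρ : IsSpeed ρ) (ha : 0 < a) (hb : 0 < b) :
    ∃ (N : ℝ → ℕ) (Δ : ℝ → ℝ≥0), IsOptimizedScheme ρ a b N Δ := by
  refine ⟨fun ε => ⌊a * (ρ ε ^ 3)⁻¹⌋₊, fun ε => Real.toNNReal (b * ρ ε),
    fun ε hε => Real.toNNReal_pos.2 (mul_pos hb (hρ.1 ε hε)), ⟨ha, ?_⟩, hb, ?_⟩
  · simp only [one_div]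
    exact (tendsto_nat_floor_mul_div_atTop ha.le).comp (hρ.tendsto_inv_pow_atTop three_ne_zero)
  · refine tendsto_const_nhds.congr' ?_
    filter_upwards [hρ.eventually_pos] with ε hε
    rw [Real.coe_toNNReal _ (by positivity), mul_div_cancel_right₀ _ hε.ne']

end Schemes

section UpperBound

open ProbabilityTheory
open scoped Matrix.Norms.Elementwise

variable {Ω : Type*} [MeasurableSpace Ω] {P : Measure Ω} {r : ℕ}
  {X : ℝ≥0 → Ω → Fin r → ℝ} {Y : ℝ → ℝ≥0 → Ω → Fin r → ℝ} {ρ f : ℝ → ℝ} {ν : ℝ≥0}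
  {Λ : ℝ≥0 → ℝ≥0} {J : ℝ} {Δ : ℝ≥0} {N : ℕ}

theorem lagIndex_mul_le {u A : ℝ≥0} (hΔ : 0 < Δ) (hΔ1 : Δ ≤ 1) (hu : u ≤ A) :
    lagIndex Δ u * Δ ≤ A + 1 := by
  rw [← NNReal.coe_le_coe] at hΔ1 hu ⊢
  push_cast at hΔ1 ⊢
  linarith [(abs_le.1 (abs_lagIndex_mul_sub_le hΔ u)).2]

namespace IsSetup

theorem abs_lagCov_lagIndex_sub_le (hS : IsSetup P X Y ρ ν Λ) (hΔ : 0 < Δ) (hΔ1 : Δ ≤ 1)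
    {u A : ℝ≥0} (hu : u ≤ A) (i j : Fin r) :
    |lagCov P X (lagIndex Δ u * Δ) i j - lagCov P X u i j| ≤ Λ (A + 1) * Δ :=
  calc |lagCov P X (lagIndex Δ u * Δ) i j - lagCov P X u i j|
      ≤ dist (lagCov P X (lagIndex Δ u * Δ)) (lagCov P X u) := by
        rw [dist_eq_norm]
        exact Matrix.norm_entry_le_entrywise_sup_norm
          (lagCov P X (lagIndex Δ u * Δ) - lagCov P X u)
    _ ≤ Λ (A + 1) * dist (lagIndex Δ u * Δ) u :=
        (hS.lipschitz (A + 1)).dist_le_mul _ (lagIndex_mul_le hΔ hΔ1 hu) _ (hu.trans le_self_add)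
    _ ≤ Λ (A + 1) * Δ := by
        gcongr
        rw [NNReal.dist_eq]
        exact_mod_cast abs_lagIndex_mul_sub_le hΔ u

theorem memLp_empCov_X (hS : IsSetup P X Y ρ ν Λ) (u : ℝ≥0) (i j : Fin r) :
    MemLp (fun ω => empCov X N Δ u ω i j) 2 P := by
  simp only [empCov_apply]
  exact (hS.memLp_laggedProductMean_X _ i j).sub
    ((hS.memLp_delayedMean_X _ j).mul' (hS.memLp_delayedMean_X _ i))

section Distortion

variable {ε : ℝ} (hS : IsSetup P X Y ρ ν Λ) (hε : 0 < ε)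

include hS hε

theorem memLp_empCov_Y (u : ℝ≥0) (i j : Fin r) :
    MemLp (fun ω => empCov (Y ε) N Δ u ω i j) 2 P := by
  simp only [empCov_apply]
  exact (hS.memLp_laggedProductMean_Y hε _ i j).sub
    ((hS.memLp_delayedMean_Y hε _ j).mul' (hS.memLp_delayedMean_Y hε _ i))

theorem eLpNorm_delayedMean_Y_sub_X_le (hN : N ≠ 0) (k : ℕ) (i : Fin r) :
    eLpNorm (fun ω => delayedMean (Y ε) N Δ k i ω - delayedMean X N Δ k i ω) 4 P
      ≤ ENNReal.ofReal (ρ ε) := by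
  have h := eLpNorm_average_Icc_le (p := 4) (by norm_num) hN
    (fun n => ((hS.memLp_Y hε ((n + k : ℕ) * Δ) i).sub (hS.memLp_X _ i)).1)
    (fun n => hS.eLpNorm_Y_sub_X hε _ i)
  simpa only [delayedMean, Pi.sub_apply, Finset.sum_sub_distrib, mul_sub] using h

theorem eLpNorm_laggedProductMean_Y_sub_X_le (hN : N ≠ 0) (κ : ℕ) (i j : Fin r) :
    eLpNorm (fun ω => laggedProductMean (Y ε) N Δ κ i j ω - laggedProductMean X N Δ κ i j ω) 2 P
      ≤ ENNReal.ofReal (ρ ε * ν + ν * ρ ε) := by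
  have h := eLpNorm_average_Icc_le one_le_two hN
    (fun n => (((hS.memLp_Y hε (n * Δ) i).1.mul (hS.memLp_Y hε ((n + κ : ℕ) * Δ) j).1).sub
      ((hS.memLp_X (n * Δ) i).1.mul (hS.memLp_X ((n + κ : ℕ) * Δ) j).1)))
    (fun n => eLpNorm_mul_sub_mul_le (hS.memLp_X _ i).1 (hS.memLp_X _ j).1
      (hS.memLp_Y hε _ i).1 (hS.memLp_Y hε _ j).1 ν.coe_nonneg (hS.isSpeed.1 ε hε).le
      (hS.eLpNorm_X _ i) (hS.eLpNorm_Y hε _ j) (hS.eLpNorm_Y_sub_X hε _ i)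
      (hS.eLpNorm_Y_sub_X hε _ j))
  simpa only [laggedProductMean, Pi.sub_apply, Pi.mul_apply, Finset.sum_sub_distrib, mul_sub]
    using h

theorem eLpNorm_delayedMean_mul_Y_sub_X_le (hN : N ≠ 0) (k l : ℕ) (i j : Fin r) :
    eLpNorm (fun ω => delayedMean (Y ε) N Δ k i ω * delayedMean (Y ε) N Δ l j ω
        - delayedMean X N Δ k i ω * delayedMean X N Δ l j ω) 2 P
      ≤ ENNReal.ofReal (ρ ε * ν + ν * ρ ε) :=
  eLpNorm_mul_sub_mul_le (hS.memLp_delayedMean_X k i).1 (hS.memLp_delayedMean_X l j).1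
    (hS.memLp_delayedMean_Y hε k i).1 (hS.memLp_delayedMean_Y hε l j).1 ν.coe_nonneg
    (hS.isSpeed.1 ε hε).le
    (eLpNorm_average_Icc_le (by norm_num) hN (fun _ => (hS.memLp_X _ i).1)
      fun _ => hS.eLpNorm_X _ i)
    (eLpNorm_average_Icc_le (by norm_num) hN (fun _ => (hS.memLp_Y hε _ j).1)
      fun _ => hS.eLpNorm_Y hε _ j)
    (hS.eLpNorm_delayedMean_Y_sub_X_le hε hN k i) (hS.eLpNorm_delayedMean_Y_sub_X_le hε hN l j)

theorem eLpNorm_empCov_Y_sub_X_le (hN : N ≠ 0) (u : ℝ≥0) (i j : Fin r) :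
    eLpNorm (fun ω => empCov (Y ε) N Δ u ω i j - empCov X N Δ u ω i j) 2 P
      ≤ ENNReal.ofReal (4 * ν * ρ ε) := by
  set κ := lagIndex Δ u
  have hsplit (ω : Ω) : empCov (Y ε) N Δ u ω i j - empCov X N Δ u ω i j =
      (laggedProductMean (Y ε) N Δ κ i j ω - laggedProductMean X N Δ κ i j ω)
        - (delayedMean (Y ε) N Δ 0 i ω * delayedMean (Y ε) N Δ κ j ω
          - delayedMean X N Δ 0 i ω * delayedMean X N Δ κ j ω) := by
    rw [empCov_apply, empCov_apply]
    ring
  have hρ := (hS.isSpeed.1 ε hε).le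
  simp only [hsplit]
  refine (eLpNorm_sub_le_ofReal one_le_two
    ((hS.memLp_laggedProductMean_Y hε κ i j).1.sub (hS.memLp_laggedProductMean_X κ i j).1)
    (((hS.memLp_delayedMean_Y hε 0 i).1.mul (hS.memLp_delayedMean_Y hε κ j).1).sub
      ((hS.memLp_delayedMean_X 0 i).1.mul (hS.memLp_delayedMean_X κ j).1))
    (by positivity) (by positivity) (hS.eLpNorm_laggedProductMean_Y_sub_X_le hε hN κ i j)
    (hS.eLpNorm_delayedMean_mul_Y_sub_X_le hε hN 0 κ i j)).trans_eq ?_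
  ring_nf

end Distortion

variable [IsProbabilityMeasure P]

theorem eLpNorm_empCov_apply_sub_lagCov_apply_le (hS : IsSetup P X Y ρ ν Λ)
    (hf : HasIntegrableDecorrelationRate P X f) (hJ : ∫ T in Set.Ioi (1 : ℝ), f T ≤ J)
    (hΔ : 0 < Δ) (hΔ1 : Δ ≤ 1) (hN : N ≠ 0) {u A : ℝ≥0} (hu : u ≤ A) {ε : ℝ} (hε : 0 < ε)
    (i j : Fin r) :
    eLpNorm (fun ω => empCov (Y ε) N Δ u ω i j - lagCov P X u i j) 2 P ≤ ENNReal.ofReal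
      (4 * ν * ρ ε + samplingConstant ν J (A + 1) / √(N * Δ) + Λ (A + 1) * Δ) := by
  have hsplit (ω : Ω) : empCov (Y ε) N Δ u ω i j - lagCov P X u i j =
      (empCov (Y ε) N Δ u ω i j - empCov X N Δ u ω i j)
        + (empCov X N Δ u ω i j - lagCov P X (lagIndex Δ u * Δ) i j)
        + (lagCov P X (lagIndex Δ u * Δ) i j - lagCov P X u i j) := by
    ring
  have hY := (hS.memLp_empCov_Y (N := N) (Δ := Δ) hε u i j).1
  have hX := (hS.memLp_empCov_X (N := N) (Δ := Δ) u i j).1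
  have hdist := (hY.sub hX)
  have hsamp : AEStronglyMeasurable
      (fun ω => empCov X N Δ u ω i j - lagCov P X (lagIndex Δ u * Δ) i j) P :=
    hX.sub aestronglyMeasurable_const
  have hρ := (hS.isSpeed.1 ε hε).le
  have hnonneg : 0 ≤ samplingConstant ν J (A + 1) / √(N * Δ) :=
    div_nonneg (samplingConstant_nonneg ν.coe_nonneg _ _) (Real.sqrt_nonneg _)
  simp only [hsplit]
  refine eLpNorm_add_le_ofReal one_le_two (hdist.add hsamp) aestronglyMeasurable_const
    (by positivity) (by positivity) ?_
    (eLpNorm_const_le_ofReal 2 (hS.abs_lagCov_lagIndex_sub_le hΔ hΔ1 hu i j))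
  exact eLpNorm_add_le_ofReal one_le_two hdist hsamp (by positivity) hnonneg
    (hS.eLpNorm_empCov_Y_sub_X_le hε hN u i j)
    (hS.eLpNorm_empCov_X_sub_le hf hJ hΔ hΔ1 hN (by exact_mod_cast lagIndex_mul_le hΔ hΔ1 hu) i j)

theorem eLpNorm_empCov_sub_lagCov_le (hS : IsSetup P X Y ρ ν Λ)
    (hf : HasIntegrableDecorrelationRate P X f) (hJ : ∫ T in Set.Ioi (1 : ℝ), f T ≤ J)
    (hΔ : 0 < Δ) (hΔ1 : Δ ≤ 1) (hN : N ≠ 0) {u A : ℝ≥0} (hu : u ≤ A) {ε : ℝ} (hε : 0 < ε) :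
    eLpNorm (fun ω => empCov (Y ε) N Δ u ω - lagCov P X u) 2 P ≤ ENNReal.ofReal
      (r * (r * (4 * ν * ρ ε + samplingConstant ν J (A + 1) / √(N * Δ) + Λ (A + 1) * Δ))) :=
  eLpNorm_matrix_le_ofReal one_le_two
    (fun i j => (hS.memLp_empCov_Y hε u i j).1.sub aestronglyMeasurable_const)
    (hS.eLpNorm_empCov_apply_sub_lagCov_apply_le hf hJ hΔ hΔ1 hN hu hε)

theorem eLpNorm_empMean_sub_mean_le (hS : IsSetup P X Y ρ ν Λ)
    (hf : HasIntegrableDecorrelationRate P X f) (hJ : ∫ T in Set.Ioi (1 : ℝ), f T ≤ J)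
    (hΔ : 0 < Δ) (hΔ1 : Δ ≤ 1) (hN : N ≠ 0) {ε : ℝ} (hε : 0 < ε) :
    eLpNorm (fun ω => empMean (Y ε) N Δ ω - mean P X) 2 P ≤
      ENNReal.ofReal (r * (ρ ε + √(2 * correlationConstant ν J 0 / (N * Δ)))) := by
  refine eLpNorm_pi_le_ofReal one_le_two (fun i => ?_) fun i => ?_
  · simp only [Pi.sub_apply, empMean_apply]
    exact (hS.memLp_delayedMean_Y hε 0 i).1.sub aestronglyMeasurable_const
  have hsplit (ω : Ω) : (empMean (Y ε) N Δ ω - mean P X) i =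
      (delayedMean (Y ε) N Δ 0 i ω - delayedMean X N Δ 0 i ω)
        + (delayedMean X N Δ 0 i ω - mean P X i) := by
    rw [Pi.sub_apply, empMean_apply]
    ring
  have hdist := (hS.memLp_delayedMean_Y (N := N) (Δ := Δ) hε 0 i).1.sub
    (hS.memLp_delayedMean_X (N := N) (Δ := Δ) 0 i).1
  simp only [hsplit]
  exact eLpNorm_add_le_ofReal one_le_two hdist
    ((hS.memLp_delayedMean_X 0 i).1.sub aestronglyMeasurable_const) (hS.isSpeed.1 ε hε).le
    (Real.sqrt_nonneg _)
    ((eLpNorm_le_eLpNorm_of_exponent_le (by norm_num) hdist).trans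
      (hS.eLpNorm_delayedMean_Y_sub_X_le hε hN 0 i))
    (hS.eLpNorm_delayedMean_sub_mean_le hf hJ hΔ hΔ1 hN 0 i)

end IsSetup

theorem exists_upperBound (r : ℕ) (A ν : ℝ≥0) (J : ℝ) (Λ : ℝ≥0 → ℝ≥0) (a b : ℝ) : ∃ C : ℝ,
    ∀ {Ω : Type*} [MeasurableSpace Ω] (P : Measure Ω) [IsProbabilityMeasure P]
      (X : ℝ≥0 → Ω → Fin r → ℝ) (Y : ℝ → ℝ≥0 → Ω → Fin r → ℝ) (ρ f : ℝ → ℝ)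
      (N : ℝ → ℕ) (Δ : ℝ → ℝ≥0), IsSetup P X Y ρ ν Λ → HasIntegrableDecorrelationRate P X f →
      (∫ T in Set.Ioi (1 : ℝ), f T) ≤ J → IsOptimizedScheme ρ a b N Δ →
      ∀ᶠ ε in 𝓝[>] (0 : ℝ),
        (∀ u : ℝ≥0, u ≤ A → covError P X Y N Δ u ε ≤ ENNReal.ofReal (C * ρ ε)) ∧
        meanError P X Y N Δ ε ≤ ENNReal.ofReal (C * ρ ε) := by
  set q := √(2 / (a * b))
  set C₁ : ℝ := r * (r * (4 * ν + samplingConstant ν J (A + 1) * q + Λ (A + 1) * (2 * b))) with hC₁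
  set C₂ : ℝ := r * (1 + √(2 * correlationConstant ν J 0) * q) with hC₂
  refine ⟨max C₁ C₂, fun {Ω} _ P _ X Y ρ f N Δ hS hf hJ hopt => ?_⟩
  have hsampling : 0 ≤ samplingConstant ν J (A + 1) := samplingConstant_nonneg ν.coe_nonneg _ _
  have hadaptive := hopt.isAdaptiveScheme hS.isSpeed
  filter_upwards [self_mem_nhdsWithin, hadaptive.eventually_ne_zero,
    hadaptive.step_tendsto.eventually_le_const one_pos, hopt.eventually_step_le hS.isSpeed,
    hopt.eventually_inv_sqrt_span_le hS.isSpeed] with ε hε hN hΔ1 hΔρ hspan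
  have hρ := hS.isSpeed.1 ε hε
  have hΔ := hopt.step_pos ε hε
  constructor
  · intro u hu
    refine (hS.eLpNorm_empCov_sub_lagCov_le hf hJ hΔ hΔ1 hN hu hε).trans
      (ENNReal.ofReal_le_ofReal (le_trans ?_
        (mul_le_mul_of_nonneg_right (le_max_left C₁ C₂) hρ.le)))
    calc _ ≤ (r : ℝ) * (r * (4 * ν * ρ ε + samplingConstant ν J (A + 1) * (q * ρ ε)
          + Λ (A + 1) * (2 * b * ρ ε))) := by
          rw [div_eq_mul_inv]
          gcongr
      _ = C₁ * ρ ε := by rw [hC₁]; ring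
  · refine (hS.eLpNorm_empMean_sub_mean_le hf hJ hΔ hΔ1 hN hε).trans
      (ENNReal.ofReal_le_ofReal (le_trans ?_
        (mul_le_mul_of_nonneg_right (le_max_right C₁ C₂) hρ.le)))
    calc _ ≤ (r : ℝ) * (ρ ε + √(2 * correlationConstant ν J 0) * (q * ρ ε)) := by
          rw [Real.sqrt_div' _ (by positivity), div_eq_mul_inv]
          gcongr
      _ = C₂ * ρ ε := by rw [hC₂]; ring

end UpperBound

section ExponentialSums

theorem sum_exp_neg_mul_le {Δ : ℝ} (hΔ : 0 < Δ) (hΔ1 : Δ ≤ 1) (n : ℕ) :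
    ∑ k ∈ Finset.range n, Real.exp (-(k * Δ)) ≤ 2 / Δ := by
  have hpow (k : ℕ) : Real.exp (-(k * Δ)) = Real.exp (-Δ) ^ k := by
    rw [← Real.exp_nat_mul, mul_neg]
  have hle : Real.exp (-Δ) * (1 + Δ) ≤ 1 := by
    rw [Real.exp_neg, inv_mul_le_iff₀ (Real.exp_pos _), mul_one, add_comm]
    exact Real.add_one_le_exp Δ
  have hratio : Δ / 2 ≤ 1 - Real.exp (-Δ) := by nlinarith [Real.exp_pos (-Δ)]
  have hsum : 0 ≤ ∑ k ∈ Finset.range n, Real.exp (-Δ) ^ k := by positivity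
  have hgeom := mul_neg_geom_sum (Real.exp (-Δ)) n
  have hlast : 0 ≤ Real.exp (-Δ) ^ n := by positivity
  simp only [hpow]
  rw [le_div_iff₀ hΔ]
  linarith [mul_le_mul_of_nonneg_right hratio hsum]

theorem sum_exp_neg_dist_le {Δ : ℝ} (hΔ : 0 < Δ) (hΔ1 : Δ ≤ 1) {s : Finset ℕ} {g : ℕ → ℕ}
    (hg : Set.InjOn g s) (n : ℕ) :
    ∑ m ∈ s, Real.exp (-(Nat.dist n (g m) * Δ)) ≤ 4 / Δ := by
  rw [← Finset.sum_image (f := fun m => Real.exp (-(Nat.dist n m * Δ))) hg]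
  refine (sum_dist_le (φ := fun k => Real.exp (-(k * Δ))) (fun k => by positivity)
    (sum_exp_neg_mul_le hΔ hΔ1) _ n).trans_eq ?_
  ring

-- From any point of `[1, N]` one can walk `N / 2` steps to the left or to the right.
theorem sum_range_le_sum_dist {φ : ℕ → ℝ} (hφ : ∀ j, 0 ≤ φ j) {L N n : ℕ} (hLN : 2 * L ≤ N)
    (hn : n ∈ Finset.Icc 1 N) :
    ∑ j ∈ Finset.range L, φ j ≤ ∑ m ∈ Finset.Icc 1 N, φ (Nat.dist n m) := by
  suffices ∃ g : ℕ → ℕ, Set.InjOn g (Finset.range L) ∧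
      ∀ j ∈ Finset.range L, g j ∈ Finset.Icc 1 N ∧ Nat.dist n (g j) = j by
    obtain ⟨g, hg, hgd⟩ := this
    calc ∑ j ∈ Finset.range L, φ j = ∑ j ∈ Finset.range L, φ (Nat.dist n (g j)) :=
          Finset.sum_congr rfl fun j hj => by rw [(hgd j hj).2]
      _ = ∑ m ∈ (Finset.range L).image g, φ (Nat.dist n m) :=
          (Finset.sum_image (f := fun m => φ (Nat.dist n m)) hg).symm
      _ ≤ ∑ m ∈ Finset.Icc 1 N, φ (Nat.dist n m) :=
          Finset.sum_le_sum_of_subset_of_nonneg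
            (Finset.image_subset_iff.2 fun j hj => (hgd j hj).1) fun _ _ _ => hφ _
  simp only [Finset.mem_range, Finset.mem_Icc, Nat.dist, Set.InjOn, Finset.coe_range,
    Set.mem_Iio] at hn ⊢
  by_cases h : n + L ≤ N
  · exact ⟨fun j => n + j, by grind, by grind⟩
  · exact ⟨fun j => n - j, by grind, by grind⟩

theorem mul_exp_div_le_sum_sum {Δ : ℝ} (hΔ : 0 < Δ) (hΔ1 : Δ ≤ 1) {N : ℕ} (hN : 2 ≤ N * Δ) :
    N * (Real.exp (-2) / (2 * Δ)) ≤ ∑ n ∈ Finset.Icc 1 N, ∑ m ∈ Finset.Icc 1 N,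
      Real.exp (-(Nat.dist n m * Δ)) ^ 2 := by
  set L := ⌊1 / Δ⌋₊
  have hLΔ : L * Δ ≤ 1 := (le_div_iff₀ hΔ).1 (Nat.floor_le (by positivity))
  have hLN : 2 * L ≤ N := by
    have : (2 * L : ℝ) ≤ N := le_of_mul_le_mul_right (by linarith) hΔ
    exact_mod_cast this
  have hL_ge : 1 / (2 * Δ) ≤ L := by
    have hone : (1 : ℝ) ≤ L := by
      exact_mod_cast Nat.le_floor (by rwa [Nat.cast_one, le_div_iff₀ hΔ, one_mul])
    have hlt : 1 / Δ < L + 1 := Nat.lt_floor_add_one _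
    have hhalf : 1 / (2 * Δ) = (1 / Δ) / 2 := by ring
    linarith
  have hterm (j : ℕ) (hj : j ∈ Finset.range L) :
      Real.exp (-2) ≤ Real.exp (-(j * Δ)) ^ 2 := by
    have hjL : (j : ℝ) * Δ ≤ L * Δ := by
      gcongr
      exact (Finset.mem_range.1 hj).le
    rw [← Real.exp_nat_mul, Nat.cast_ofNat]
    exact Real.exp_le_exp.2 (by linarith)
  have hrow (n : ℕ) (hn : n ∈ Finset.Icc 1 N) :
      Real.exp (-2) / (2 * Δ) ≤ ∑ m ∈ Finset.Icc 1 N, Real.exp (-(Nat.dist n m * Δ)) ^ 2 :=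
    calc Real.exp (-2) / (2 * Δ) = (1 / (2 * Δ)) * Real.exp (-2) := by ring
      _ ≤ L * Real.exp (-2) := by gcongr
      _ = ∑ j ∈ Finset.range L, Real.exp (-2) := by simp
      _ ≤ ∑ j ∈ Finset.range L, Real.exp (-(j * Δ)) ^ 2 := Finset.sum_le_sum hterm
      _ ≤ _ := sum_range_le_sum_dist (φ := fun j => Real.exp (-(j * Δ)) ^ 2)
          (fun j => by positivity) hLN hn
  calc N * (Real.exp (-2) / (2 * Δ)) = ∑ n ∈ Finset.Icc 1 N, Real.exp (-2) / (2 * Δ) := by simp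
    _ ≤ _ := Finset.sum_le_sum hrow

end ExponentialSums

section OrnsteinUhlenbeckCovariance

open ProbabilityTheory

variable {Ω : Type*}

/-- The empirical second moment, at the lag of `κ` steps, of a scalar process sampled with
step `Δ`. -/
noncomputable def scalarProductMean (x : ℝ≥0 → Ω → ℝ) (N κ : ℕ) (Δ : ℝ≥0) (ω : Ω) : ℝ :=
  (N : ℝ)⁻¹ * ∑ n ∈ Finset.Icc 1 N, x (n * Δ) ω * x ((n + κ : ℕ) * Δ) ω

/-- The product of the empirical mean of a scalar process and of its translate by `κ` steps. -/
noncomputable def scalarMeanProduct (x : ℝ≥0 → Ω → ℝ) (N κ : ℕ) (Δ : ℝ≥0) (ω : Ω) : ℝ :=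
  ((N : ℝ)⁻¹ * ∑ n ∈ Finset.Icc 1 N, x (n * Δ) ω) *
    ((N : ℝ)⁻¹ * ∑ n ∈ Finset.Icc 1 N, x ((n + κ : ℕ) * Δ) ω)

/-- The empirical covariance of a scalar process at the lag of `κ` steps. -/
noncomputable def scalarCov (x : ℝ≥0 → Ω → ℝ) (N κ : ℕ) (Δ : ℝ≥0) : Ω → ℝ :=
  scalarProductMean x N κ Δ - scalarMeanProduct x N κ Δ

theorem scalarMeanProduct_eq_sum (x : ℝ≥0 → Ω → ℝ) (N κ : ℕ) (Δ : ℝ≥0) :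
    scalarMeanProduct x N κ Δ = fun ω => (N : ℝ)⁻¹ ^ 2 *
      ∑ p ∈ Finset.Icc 1 N ×ˢ Finset.Icc 1 N, x (p.1 * Δ) ω * x ((p.2 + κ : ℕ) * Δ) ω := by
  ext ω
  simp only [scalarMeanProduct, Finset.sum_product]
  rw [← Finset.sum_mul_sum]
  ring

theorem abs_natCast_mul_sub_natCast_mul (Δ : ℝ≥0) (n m : ℕ) :
    |(((m : ℝ≥0) * Δ : ℝ≥0) : ℝ) - (((n : ℝ≥0) * Δ : ℝ≥0) : ℝ)| = Nat.dist n m * Δ := by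
  push_cast
  rw [← sub_mul, abs_mul, abs_of_nonneg Δ.coe_nonneg]
  congr 1
  rcases le_total n m with h | h
  · rw [Nat.dist_eq_sub_of_le h, Nat.cast_sub h, abs_of_nonneg (by simpa using h)]
  · rw [Nat.dist_eq_sub_of_le_right h, Nat.cast_sub h, abs_of_nonpos (by simpa using h), neg_sub]

variable [MeasurableSpace Ω] {P : Measure Ω} {x : ℝ≥0 → Ω → ℝ}

namespace IsOrnsteinUhlenbeck

theorem integral_sampled (hx : IsOrnsteinUhlenbeck P x) (Δ : ℝ≥0) (n m : ℕ) :
    ∫ ω, x (n * Δ) ω * x (m * Δ) ω ∂P = Real.exp (-(Nat.dist n m * Δ)) := by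
  rw [hx.integral_mul, abs_natCast_mul_sub_natCast_mul]

theorem memLp_mul (hx : IsOrnsteinUhlenbeck P x) (s t : ℝ≥0) :
    MemLp (fun ω => x s ω * x t ω) 2 P :=
  (hx.memLp t).mul' (hx.memLp s)

theorem memLp_scalarProductMean (hx : IsOrnsteinUhlenbeck P x) (N κ : ℕ) (Δ : ℝ≥0) :
    MemLp (scalarProductMean x N κ Δ) 2 P :=
  memLp_average (fun _ => hx.memLp_mul _ _) _

theorem memLp_scalarMeanProduct (hx : IsOrnsteinUhlenbeck P x) (N κ : ℕ) (Δ : ℝ≥0) :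
    MemLp (scalarMeanProduct x N κ Δ) 2 P := by
  rw [scalarMeanProduct_eq_sum]
  exact memLp_average (fun _ => hx.memLp_mul _ _) _

theorem memLp_scalarCov (hx : IsOrnsteinUhlenbeck P x) (N κ : ℕ) (Δ : ℝ≥0) :
    MemLp (scalarCov x N κ Δ) 2 P :=
  (hx.memLp_scalarProductMean N κ Δ).sub (hx.memLp_scalarMeanProduct N κ Δ)

theorem covariance_sampled (hx : IsOrnsteinUhlenbeck P x) (Δ : ℝ≥0) (a b c d : ℕ) :
    cov[fun ω => x (a * Δ) ω * x (b * Δ) ω, fun ω => x (c * Δ) ω * x (d * Δ) ω; P] =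
      Real.exp (-(Nat.dist a c * Δ)) * Real.exp (-(Nat.dist b d * Δ))
      + Real.exp (-(Nat.dist a d * Δ)) * Real.exp (-(Nat.dist b c * Δ)) := by
  have := hx.isGaussianProcess.isProbabilityMeasure
  rw [covariance_eq_sub (hx.memLp_mul _ _) (hx.memLp_mul _ _)]
  simp only [Pi.mul_apply]
  rw [hx.integral_mul_mul_mul, hx.integral_mul, hx.integral_mul]
  simp only [abs_natCast_mul_sub_natCast_mul]
  ring

theorem integral_scalarProductMean (hx : IsOrnsteinUhlenbeck P x) {N : ℕ} (hN : N ≠ 0) (κ : ℕ)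
    (Δ : ℝ≥0) : ∫ ω, scalarProductMean x N κ Δ ω ∂P = Real.exp (-(κ * Δ)) := by
  have := hx.isGaussianProcess.isProbabilityMeasure
  have hterm (n : ℕ) :
      ∫ ω, x (n * Δ) ω * x ((n + κ : ℕ) * Δ) ω ∂P = Real.exp (-(κ * Δ)) := by
    rw [hx.integral_sampled, Nat.dist_eq_sub_of_le (Nat.le_add_right n κ), Nat.add_sub_cancel_left]
  simp only [scalarProductMean]
  rw [integral_const_mul,
    integral_finsetSum _ fun n _ => (hx.memLp_mul _ _).integrable one_le_two]
  simp only [hterm]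
  simp [hN]

theorem abs_integral_scalarMeanProduct_le (hx : IsOrnsteinUhlenbeck P x) {N : ℕ} (hN : N ≠ 0)
    (κ : ℕ) {Δ : ℝ≥0} (hΔ : 0 < Δ) (hΔ1 : Δ ≤ 1) :
    |∫ ω, scalarMeanProduct x N κ Δ ω ∂P| ≤ 4 / ((N : ℝ) * Δ) := by
  have := hx.isGaussianProcess.isProbabilityMeasure
  have hΔ' : (0 : ℝ) < Δ := hΔ
  rw [scalarMeanProduct_eq_sum, integral_const_mul,
    integral_finsetSum _ fun p _ => (hx.memLp_mul _ _).integrable one_le_two]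
  simp only [hx.integral_sampled]
  rw [abs_of_nonneg (by positivity), Finset.sum_product]
  calc (N : ℝ)⁻¹ ^ 2 * ∑ n ∈ Finset.Icc 1 N, ∑ m ∈ Finset.Icc 1 N,
        Real.exp (-(Nat.dist n (m + κ) * Δ))
      ≤ (N : ℝ)⁻¹ ^ 2 * ∑ n ∈ Finset.Icc 1 N, 4 / (Δ : ℝ) := by
        gcongr with n _
        exact sum_exp_neg_dist_le hΔ' hΔ1 (add_left_injective κ).injOn n
    _ = 4 / ((N : ℝ) * Δ) := by
        simp only [Finset.sum_const, Nat.card_Icc, Nat.add_sub_cancel, nsmul_eq_mul]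
        field_simp

theorem abs_integral_scalarCov_sub_le (hx : IsOrnsteinUhlenbeck P x) {N : ℕ} (hN : N ≠ 0) (κ : ℕ)
    {Δ : ℝ≥0} (hΔ : 0 < Δ) (hΔ1 : Δ ≤ 1) :
    |∫ ω, scalarCov x N κ Δ ω ∂P - Real.exp (-(κ * Δ))| ≤ 4 / ((N : ℝ) * Δ) := by
  have := hx.isGaussianProcess.isProbabilityMeasure
  rw [scalarCov, integral_sub' ((hx.memLp_scalarProductMean N κ Δ).integrable one_le_two)
    ((hx.memLp_scalarMeanProduct N κ Δ).integrable one_le_two), hx.integral_scalarProductMean hN,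
    sub_sub_cancel_left, abs_neg]
  exact hx.abs_integral_scalarMeanProduct_le hN κ hΔ hΔ1

theorem le_variance_scalarProductMean (hx : IsOrnsteinUhlenbeck P x) {N : ℕ} (κ : ℕ) {Δ : ℝ≥0}
    (hΔ : 0 < Δ) (hΔ1 : Δ ≤ 1) (hNΔ : 2 ≤ (N : ℝ) * Δ) :
    Real.exp (-2) / (2 * ((N : ℝ) * Δ)) ≤ Var[scalarProductMean x N κ Δ; P] := by
  have := hx.isGaussianProcess.isProbabilityMeasure
  unfold scalarProductMean
  rw [variance_const_mul, variance_fun_sum' fun n _ => hx.memLp_mul _ _]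
  calc Real.exp (-2) / (2 * ((N : ℝ) * Δ)) = (N : ℝ)⁻¹ ^ 2 * (N * (Real.exp (-2) / (2 * Δ))) := by
        field_simp
    _ ≤ (N : ℝ)⁻¹ ^ 2 * ∑ n ∈ Finset.Icc 1 N, ∑ m ∈ Finset.Icc 1 N,
          Real.exp (-(Nat.dist n m * Δ)) ^ 2 := by
        gcongr
        exact mul_exp_div_le_sum_sum hΔ hΔ1 hNΔ
    _ ≤ _ := by
        gcongr with n _ m _
        rw [hx.covariance_sampled, Nat.dist_add_add_right, ← pow_two]
        exact le_add_of_nonneg_right (by positivity)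

theorem sum_covariance_sampled_le (hx : IsOrnsteinUhlenbeck P x) (N κ n : ℕ) {Δ : ℝ≥0}
    (hΔ : 0 < Δ) (hΔ1 : Δ ≤ 1) :
    ∑ p ∈ Finset.Icc 1 N ×ˢ Finset.Icc 1 N, cov[fun ω => x (n * Δ) ω * x ((n + κ : ℕ) * Δ) ω,
      fun ω => x (p.1 * Δ) ω * x ((p.2 + κ : ℕ) * Δ) ω; P] ≤ 2 * (4 / (Δ : ℝ)) ^ 2 := by
  have hΔ' : (0 : ℝ) < Δ := hΔ
  have hsum (k : ℕ) (g : ℕ → ℕ) (hg : Function.Injective g) :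
      ∑ m ∈ Finset.Icc 1 N, Real.exp (-(Nat.dist k (g m) * Δ)) ≤ 4 / Δ :=
    sum_exp_neg_dist_le hΔ' hΔ1 hg.injOn k
  have hshift := add_left_injective κ
  simp only [hx.covariance_sampled, Finset.sum_product, Finset.sum_add_distrib]
  rw [two_mul]
  refine add_le_add ?_ ?_
  · rw [← Finset.sum_mul_sum, sq]
    exact mul_le_mul (hsum n id Function.injective_id) (hsum (n + κ) _ hshift) (by positivity)
      (by positivity)
  · rw [Finset.sum_comm, ← Finset.sum_mul_sum, sq]
    exact mul_le_mul (hsum n _ hshift) (hsum (n + κ) id Function.injective_id) (by positivity)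
      (by positivity)

theorem covariance_scalarProductMean_scalarMeanProduct_le (hx : IsOrnsteinUhlenbeck P x) (N κ : ℕ)
    {Δ : ℝ≥0} (hΔ : 0 < Δ) (hΔ1 : Δ ≤ 1) :
    cov[scalarProductMean x N κ Δ, scalarMeanProduct x N κ Δ; P] ≤ 32 / ((N : ℝ) * Δ) ^ 2 := by
  have := hx.isGaussianProcess.isProbabilityMeasure
  rw [scalarMeanProduct_eq_sum]
  unfold scalarProductMean
  rw [covariance_const_mul_left, covariance_const_mul_right,
    covariance_fun_sum_fun_sum' (fun n _ => hx.memLp_mul _ _) (fun p _ => hx.memLp_mul _ _)]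
  calc _ ≤ (N : ℝ)⁻¹ * ((N : ℝ)⁻¹ ^ 2 * ∑ n ∈ Finset.Icc 1 N, 2 * (4 / (Δ : ℝ)) ^ 2) := by
        gcongr with n _
        exact hx.sum_covariance_sampled_le N κ n hΔ hΔ1
    _ = 32 / ((N : ℝ) * Δ) ^ 2 := by
        simp only [Finset.sum_const, Nat.card_Icc, Nat.add_sub_cancel, nsmul_eq_mul]
        field_simp
        norm_num

theorem le_variance_scalarCov (hx : IsOrnsteinUhlenbeck P x) {N : ℕ} (κ : ℕ) {Δ : ℝ≥0}
    (hΔ : 0 < Δ) (hΔ1 : Δ ≤ 1) (hNΔ : 2 ≤ (N : ℝ) * Δ) :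
    Real.exp (-2) / (2 * ((N : ℝ) * Δ)) - 64 / ((N : ℝ) * Δ) ^ 2 ≤ Var[scalarCov x N κ Δ; P] := by
  have := hx.isGaussianProcess.isProbabilityMeasure
  have hvar := hx.le_variance_scalarProductMean κ hΔ hΔ1 hNΔ
  have hcov := hx.covariance_scalarProductMean_scalarMeanProduct_le N κ hΔ hΔ1
  have hnonneg := variance_nonneg (scalarMeanProduct x N κ Δ) P
  rw [scalarCov, variance_sub (hx.memLp_scalarProductMean N κ Δ) (hx.memLp_scalarMeanProduct N κ Δ)]
  have htwo : 64 / ((N : ℝ) * Δ) ^ 2 = 2 * (32 / ((N : ℝ) * Δ) ^ 2) := by ring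
  linarith

end IsOrnsteinUhlenbeck

end OrnsteinUhlenbeckCovariance

section RandomSign

open ProbabilityTheory

/-- The law of a fair coin, whose outcome decides the sign of the distortion. -/
noncomputable abbrev coin : Measure Bool := (PMF.uniformOfFintype Bool).toMeasure

/-- The sign `±1` attached to the outcome of a coin. -/
def coinSign (b : Bool) : ℝ := if b then 1 else -1

theorem abs_coinSign (b : Bool) : |coinSign b| = 1 := by
  cases b <;> simp [coinSign]

theorem abs_one_add_mul_coinSign_le (δ : ℝ) (b : Bool) : |1 + δ * coinSign b| ≤ 1 + |δ| := by
  simpa only [abs_one, abs_mul, abs_coinSign, mul_one] using abs_add_le 1 (δ * coinSign b)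

variable {Ω : Type*}

/-- The error on a target `k` of an estimator `Q` that is quadratic in the observations, when
these are distorted by the random factor `1 ± δ`. -/
def distortedError (Q : Ω → ℝ) (δ k : ℝ) (p : Ω × Bool) : ℝ :=
  (1 + δ * coinSign p.2) ^ 2 * Q p.1 - k

variable [MeasurableSpace Ω] {P : Measure Ω}

theorem measurable_one_add_mul_coinSign (δ : ℝ) :
    Measurable fun p : Ω × Bool => 1 + δ * coinSign p.2 :=
  (((measurable_of_finite coinSign).comp measurable_snd).const_mul δ).const_add 1

theorem integral_prod_coin [SFinite P] {F : Ω × Bool → ℝ} (hF : Integrable F (P.prod coin)) :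
    ∫ p, F p ∂(P.prod coin) = 2⁻¹ * (∫ ω, F (ω, true) ∂P + ∫ ω, F (ω, false) ∂P) := by
  rw [integral_prod_symm _ hF, PMF.integral_eq_sum]
  simp [mul_add]

variable [IsProbabilityMeasure P] {Q : Ω → ℝ} {δ k : ℝ}

theorem memLp_distortedError (hQ : MemLp Q 2 P) :
    MemLp (distortedError Q δ k) 2 (P.prod coin) := by
  have hmeas : AEStronglyMeasurable (fun p : Ω × Bool => (1 + δ * coinSign p.2) ^ 2 * Q p.1)
      (P.prod coin) :=
    ((measurable_one_add_mul_coinSign δ).pow_const 2).aestronglyMeasurable.mul (hQ.comp_fst coin).1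
  refine (MemLp.of_le_mul (c := (1 + |δ|) ^ 2) (hQ.comp_fst coin) hmeas
    (ae_of_all _ fun p => ?_)).sub (memLp_const k)
  rw [norm_mul, norm_pow]
  gcongr
  exact abs_one_add_mul_coinSign_le δ p.2

theorem integral_distortedError_sq (hQ : MemLp Q 2 P) :
    ∫ p, distortedError Q δ k p ^ 2 ∂(P.prod coin) =
      2⁻¹ * (∫ ω, ((1 + δ) ^ 2 * Q ω - k) ^ 2 ∂P + ∫ ω, ((1 - δ) ^ 2 * Q ω - k) ^ 2 ∂P) := by
  rw [integral_prod_coin (memLp_distortedError hQ).integrable_sq]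
  simp [distortedError, coinSign, ← sub_eq_add_neg]

-- The two errors `(1 ± δ)² Q - k` differ by `4 δ Q`, so one of them is at least `2 δ |Q|`.
theorem sq_integral_le_integral_distortedError_sq (hQ : MemLp Q 2 P) :
    (2 * δ * ∫ ω, Q ω ∂P) ^ 2 ≤ ∫ p, distortedError Q δ k p ^ 2 ∂(P.prod coin) := by
  have hint (a : ℝ) : Integrable (fun ω => (a * Q ω - k) ^ 2) P :=
    ((hQ.const_mul a).sub (memLp_const k)).integrable_sq
  have hjensen : (∫ ω, 2 * δ * Q ω ∂P) ^ 2 ≤ ∫ ω, (2 * δ * Q ω) ^ 2 ∂P := by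
    have hvar := variance_nonneg (fun ω => 2 * δ * Q ω) P
    rw [variance_eq_sub (hQ.const_mul _)] at hvar
    simpa only [sub_nonneg, Pi.pow_apply] using hvar
  rw [integral_const_mul] at hjensen
  refine hjensen.trans ?_
  rw [integral_distortedError_sq hQ, ← integral_add (hint _) (hint _), ← integral_const_mul]
  refine integral_mono (hQ.const_mul _).integrable_sq (((hint _).add (hint _)).const_mul _)
    fun ω => ?_
  dsimp only
  linarith [sq_nonneg (((1 + δ) ^ 2 * Q ω - k) + ((1 - δ) ^ 2 * Q ω - k))]

theorem variance_le_integral_distortedError_sq (hQ : MemLp Q 2 P) (hδ : 0 ≤ δ) :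
    Var[Q; P] / 2 ≤ ∫ p, distortedError Q δ k p ^ 2 ∂(P.prod coin) := by
  have hmemLp : MemLp (fun ω => (1 + δ) ^ 2 * Q ω - k) 2 P :=
    (hQ.const_mul _).sub (memLp_const k)
  have hgrow : Var[Q; P] ≤ ∫ ω, ((1 + δ) ^ 2 * Q ω - k) ^ 2 ∂P := by
    have hfactor : (1 : ℝ) ≤ ((1 + δ) ^ 2) ^ 2 := one_le_pow₀ (one_le_pow₀ (by linarith))
    calc Var[Q; P] ≤ ((1 + δ) ^ 2) ^ 2 * Var[Q; P] :=
          le_mul_of_one_le_left (variance_nonneg _ _) hfactor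
      _ = Var[fun ω => (1 + δ) ^ 2 * Q ω - k; P] := by
          rw [variance_sub_const (hQ.const_mul _).1, variance_const_mul]
      _ ≤ ∫ ω, ((1 + δ) ^ 2 * Q ω - k) ^ 2 ∂P := variance_le_expectation_sq hmemLp.1
  have hother : 0 ≤ ∫ ω, ((1 - δ) ^ 2 * Q ω - k) ^ 2 ∂P := integral_nonneg fun _ => sq_nonneg _
  rw [integral_distortedError_sq hQ]
  linarith

end RandomSign

section DiagonalLift

open scoped Matrix.Norms.Elementwise

variable {Ω : Type*}

/-- The vector-valued process whose coordinates are all equal to `c x`. -/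
def diagonalLift (r : ℕ) (c : ℝ) (x : ℝ≥0 → Ω → ℝ) : ℝ≥0 → Ω → Fin r → ℝ :=
  fun t ω _ => c * x t ω

theorem abs_exp_neg_sub_exp_neg_le {s t : ℝ} (hs : 0 ≤ s) (ht : 0 ≤ t) :
    |Real.exp (-s) - Real.exp (-t)| ≤ |s - t| := by
  have hderiv (y : ℝ) : HasDerivAt (fun y => Real.exp (-y)) (-Real.exp (-y)) y := by
    simpa using (hasDerivAt_neg y).exp
  have hbound (y : ℝ) (hy : y ∈ Set.Ici 0) : ‖-Real.exp (-y)‖ ≤ 1 := by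
    simpa using hy
  simpa using (convex_Ici 0).norm_image_sub_le_of_norm_hasDerivWithin_le
    (fun y _ => (hderiv y).hasDerivWithinAt) hbound ht hs

variable [MeasurableSpace Ω] {P : Measure Ω} {x : ℝ≥0 → Ω → ℝ} {r : ℕ} {c : ℝ}

namespace IsOrnsteinUhlenbeck

theorem measurable_diagonalLift (hx : IsOrnsteinUhlenbeck P x) (t : ℝ≥0) :
    Measurable (diagonalLift r c x t) :=
  measurable_pi_lambda _ fun _ => (hx.measurable t).const_mul c

theorem mean_diagonalLift (hx : IsOrnsteinUhlenbeck P x) :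
    mean P (diagonalLift r c x) = 0 := by
  ext i
  simp [mean, diagonalLift, integral_const_mul, hx.integral]

theorem lagCov_diagonalLift (hx : IsOrnsteinUhlenbeck P x) (u : ℝ≥0) (i j : Fin r) :
    lagCov P (diagonalLift r c x) u i j = c ^ 2 * Real.exp (-u) := by
  simp [lagCov, hx.mean_diagonalLift, diagonalLift, mul_mul_mul_comm c, ← sq, integral_const_mul,
    hx.integral_mul]

theorem lipschitzWith_lagCov_diagonalLift (hx : IsOrnsteinUhlenbeck P x) {lam : ℝ≥0}
    (hc : c ^ 2 ≤ lam) : LipschitzWith lam (lagCov P (diagonalLift r c x)) := by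
  refine LipschitzWith.of_dist_le_mul fun u v => ?_
  rw [dist_eq_norm, Matrix.norm_le_iff (by positivity)]
  intro i j
  rw [Matrix.sub_apply, hx.lagCov_diagonalLift, hx.lagCov_diagonalLift, ← mul_sub, norm_mul,
    Real.norm_of_nonneg (sq_nonneg c), NNReal.dist_eq]
  gcongr
  exact abs_exp_neg_sub_exp_neg_le u.coe_nonneg v.coe_nonneg

theorem isStrictlyStationary_diagonalLift (hx : IsOrnsteinUhlenbeck P x) :
    IsStrictlyStationary P (diagonalLift r c x) := by
  intro n t h
  have hmeas : Measurable fun (y : Fin n → ℝ) k (_ : Fin r) => c * y k := by fun_prop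
  have hmap (s : Fin n → ℝ≥0) : P.map (fun ω k => diagonalLift r c x (s k) ω) =
      (P.map fun ω k => x (s k) ω).map fun (y : Fin n → ℝ) k (_ : Fin r) => c * y k := by
    rw [Measure.map_map hmeas (measurable_pi_lambda _ fun k => hx.measurable _)]
    rfl
  rw [hmap t, hmap fun k => t k + h, hx.map_add_right]

theorem eLpNorm_diagonalLift_le (hx : IsOrnsteinUhlenbeck P x) {m : ℝ} (hm : 0 ≤ m)
    (hc : 2 * c ^ 2 ≤ m ^ 2) (t : ℝ≥0) :
    eLpNorm (diagonalLift r c x t) 4 P ≤ ENNReal.ofReal m := by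
  have hcoord : eLpNorm (diagonalLift r c x t) 4 P ≤ eLpNorm (fun ω => c * x t ω) 4 P :=
    eLpNorm_mono fun ω => (pi_norm_le_iff_of_nonneg (norm_nonneg _)).2 fun _ => le_rfl
  refine hcoord.trans ((eLpNorm_le_ofReal_iff (by decide : Even 4) four_ne_zero
    ((hx.memLp t).const_mul c) hm).2 ?_)
  have hpow (ω) : (c * x t ω) ^ 4 = c ^ 4 * (x t ω * x t ω * (x t ω * x t ω)) := by ring
  calc ∫ ω, (c * x t ω) ^ 4 ∂P = 3 * (c ^ 2) ^ 2 := by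
        simp only [hpow]
        rw [integral_const_mul, hx.integral_mul_mul_mul]
        simp only [sub_self, abs_zero, neg_zero, Real.exp_zero]
        ring
    _ ≤ (2 * c ^ 2) ^ 2 := by linarith [sq_nonneg (c ^ 2)]
    _ ≤ (m ^ 2) ^ 2 := by gcongr
    _ = m ^ 4 := by ring

theorem abs_integral_mul_le (hx : IsOrnsteinUhlenbeck P x) {s u : ℝ≥0} {T : ℝ}
    (hsu : T ≤ |(u : ℝ) - s|) : |∫ ω, x s ω * x u ω ∂P| ≤ Real.exp (-T) := by
  rw [hx.integral_mul, Real.abs_exp]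
  exact Real.exp_le_exp.2 (neg_le_neg hsu)

theorem abs_integral_mul_mul_mul_sub_le (hx : IsOrnsteinUhlenbeck P x) {s t u v : ℝ≥0} {T : ℝ}
    (hsu : T ≤ |(u : ℝ) - s|) (hsv : T ≤ |(v : ℝ) - s|) :
    |(∫ ω, x s ω * x t ω * (x u ω * x v ω) ∂P) -
      (∫ ω, x s ω * x t ω ∂P) * ∫ ω, x u ω * x v ω ∂P| ≤ 2 * Real.exp (-T) := by
  have hprod (a b : ℝ) (ha : T ≤ |a|) :
      Real.exp (-|a|) * Real.exp (-|b|) ≤ Real.exp (-T) := by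
    rw [← Real.exp_add]
    exact Real.exp_le_exp.2 (by linarith [abs_nonneg b])
  rw [hx.integral_mul_mul_mul, hx.integral_mul, hx.integral_mul, add_assoc, add_sub_cancel_left,
    abs_of_nonneg (by positivity), two_mul]
  exact add_le_add (hprod _ _ hsu) (hprod _ _ hsv)

theorem abs_covariance_lowMoments_diagonalLift_le (hx : IsOrnsteinUhlenbeck P x) {U V : Set ℝ≥0}
    {T : ℝ} (hgap : ∀ s ∈ U, ∀ t ∈ V, T ≤ |(t : ℝ) - s|) {G H : Ω → ℝ}
    (hG : G ∈ lowMoments (diagonalLift r c x) U) (hH : H ∈ lowMoments (diagonalLift r c x) V) :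
    |(∫ ω, G ω * H ω ∂P) - (∫ ω, G ω ∂P) * ∫ ω, H ω ∂P| ≤
      (c ^ 2 + 2 * c ^ 4) * Real.exp (-T) := by
  have hscale (s t ω) : c * x s ω * (c * x t ω) = c ^ 2 * (x s ω * x t ω) := by ring
  have hlinear (s) : ∫ ω, c * x s ω ∂P = 0 := by rw [integral_const_mul, hx.integral, mul_zero]
  rcases hG with ⟨s, hs, i, rfl⟩ | ⟨s, hs, t, -, i, j, rfl⟩ <;>
  rcases hH with ⟨u, hu, k, rfl⟩ | ⟨u, hu, v, hv, k, l, rfl⟩ <;>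
  simp only [diagonalLift, hlinear, mul_zero, zero_mul, sub_zero]
  · simp only [hscale]
    rw [integral_const_mul, abs_mul, abs_of_nonneg (by positivity)]
    gcongr
    · exact le_add_of_nonneg_right (by positivity)
    · exact hx.abs_integral_mul_le (hgap s hs u hu)
  · have hcube (ω) : c * x s ω * (c * x u ω * (c * x v ω)) =
        c ^ 3 * (x s ω * x u ω * x v ω) := by ring
    simp only [hcube]
    rw [integral_const_mul, hx.integral_mul_mul, mul_zero, abs_zero]
    positivity
  · have hcube (ω) : c * x s ω * (c * x t ω) * (c * x u ω) =
        c ^ 3 * (x s ω * x t ω * x u ω) := by ring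
    simp only [hcube]
    rw [integral_const_mul, hx.integral_mul_mul, mul_zero, abs_zero]
    positivity
  · have hfactor (y z : ℝ) : c ^ 2 * y * (c ^ 2 * z) = c ^ 4 * (y * z) := by ring
    simp only [hscale, hfactor, integral_const_mul]
    rw [← mul_sub, abs_mul, abs_of_nonneg (by positivity)]
    calc c ^ 4 * _ ≤ c ^ 4 * (2 * Real.exp (-T)) := by
          gcongr
          exact hx.abs_integral_mul_mul_mul_sub_le (hgap s hs u hu) (hgap s hs v hv)
      _ ≤ (c ^ 2 + 2 * c ^ 4) * Real.exp (-T) := by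
          linarith [mul_nonneg (sq_nonneg c) (Real.exp_pos (-T)).le]

theorem hasIntegrableDecorrelationRate_diagonalLift (hx : IsOrnsteinUhlenbeck P x) (hc : 0 < c) :
    HasIntegrableDecorrelationRate P (diagonalLift r c x)
      fun T => (c ^ 2 + 2 * c ^ 4) * Real.exp (-T) where
  pos T _ := by positivity
  antitone S _ T _ h := by
    dsimp only
    gcongr
  continuous := by fun_prop
  integrable := (integrableOn_exp_neg_Ioi 1).const_mul _
  decorrelation U V _ _ T _ hGLB G hG H hH :=
    hx.abs_covariance_lowMoments_diagonalLift_le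
      (fun s hs t ht => (hGLB.1 ⟨s, hs, t, ht, rfl⟩).trans (le_abs_self _)) hG hH

end IsOrnsteinUhlenbeck

end DiagonalLift

section SignDistortion

variable {Ω : Type*} {r : ℕ}

/-- The observations of `X` multiplied by a random factor `1 ± δ ε`, which is common to all times
and coordinates, so that averaging over time does not remove it. -/
def signDistortion (δ : ℝ → ℝ) (X : ℝ≥0 → Ω → Fin r → ℝ) : ℝ → ℝ≥0 → Ω × Bool → Fin r → ℝ :=
  fun ε t p => (1 + δ ε * coinSign p.2) • X t p.1

theorem empCov_signDistortion (δ : ℝ → ℝ) (X : ℝ≥0 → Ω → Fin r → ℝ) (ε : ℝ) (N : ℕ) (Δ u : ℝ≥0)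
    (p : Ω × Bool) :
    empCov (signDistortion δ X ε) N Δ u p =
      (1 + δ ε * coinSign p.2) ^ 2 • empCov X N Δ u p.1 := by
  simp only [empCov, empMean, shiftedEmpMean, signDistortion, ← Finset.smul_sum,
    Matrix.smul_vecMulVec, Matrix.vecMulVec_smul, smul_comm (N : ℝ)⁻¹, smul_smul, ← sq, smul_sub,
    mul_pow]

theorem empCov_diagonalLift (c : ℝ) (x : ℝ≥0 → Ω → ℝ) (N : ℕ) (Δ u : ℝ≥0) (ω : Ω) (i j : Fin r) :
    empCov (diagonalLift r c x) N Δ u ω i j = c ^ 2 * scalarCov x N (lagIndex Δ u) Δ ω := by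
  have hproduct (s t) : c * x s ω * (c * x t ω) = c ^ 2 * (x s ω * x t ω) := by ring
  simp only [empCov_apply, laggedProductMean, delayedMean, diagonalLift, scalarCov, Pi.sub_apply,
    scalarProductMean, scalarMeanProduct, hproduct, add_zero, ← Finset.mul_sum]
  ring

variable [MeasurableSpace Ω] {P : Measure Ω} {X : ℝ≥0 → Ω → Fin r → ℝ} {t : ℝ≥0}

theorem measurable_signDistortion (δ : ℝ → ℝ) (hX : Measurable (X t)) (ε : ℝ) :
    Measurable (signDistortion δ X ε t) :=
  (measurable_one_add_mul_coinSign (δ ε)).smul (hX.comp measurable_fst)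

theorem eLpNorm_signDistortion_le (δ : ℝ → ℝ) (hX : AEStronglyMeasurable (X t) P) (ε : ℝ)
    (q : ℝ≥0∞) :
    eLpNorm (signDistortion δ X ε t) q (P.prod coin) ≤
      ENNReal.ofReal (1 + |δ ε|) * eLpNorm (X t) q P := by
  rw [← eLpNorm_comp_measurePreserving (ν := P) hX (measurePreserving_fst (ν := coin))]
  refine eLpNorm_le_mul_eLpNorm_of_ae_le_mul (ae_of_all _ fun p => ?_) _
  rw [signDistortion, norm_smul]
  gcongr
  exacts [abs_one_add_mul_coinSign_le _ _, le_rfl]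

theorem eLpNorm_signDistortion_sub_le (δ : ℝ → ℝ) (hX : AEStronglyMeasurable (X t) P) (ε : ℝ)
    (q : ℝ≥0∞) :
    eLpNorm (fun p => signDistortion δ X ε t p - X t p.1) q (P.prod coin) ≤
      ENNReal.ofReal |δ ε| * eLpNorm (X t) q P := by
  rw [← eLpNorm_comp_measurePreserving (ν := P) hX (measurePreserving_fst (ν := coin))]
  refine eLpNorm_le_mul_eLpNorm_of_ae_le_mul (ae_of_all _ fun p => ?_) _
  rw [signDistortion, add_smul, one_smul, add_sub_cancel_left, norm_smul, norm_mul,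
    Real.norm_eq_abs (coinSign _), abs_coinSign, mul_one, Real.norm_eq_abs, Function.comp_apply]

end SignDistortion

section LowerBound

open ProbabilityTheory
open scoped Matrix.Norms.Elementwise

variable {Ω : Type*} [MeasurableSpace Ω] {P : Measure Ω} {x : ℝ≥0 → Ω → ℝ} {r : ℕ} {c : ℝ}
  {δ ρ : ℝ → ℝ} {N : ℝ → ℕ} {Δ : ℝ → ℝ≥0} {u : ℝ≥0}

namespace IsOrnsteinUhlenbeck

theorem prod_coin (hx : IsOrnsteinUhlenbeck P x) :
    IsOrnsteinUhlenbeck (P.prod coin) fun t => x t ∘ Prod.fst :=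
  hx.comp_measurePreserving measurePreserving_fst

theorem isSetup_signDistortion (hx : IsOrnsteinUhlenbeck P x) {ν lam : ℝ≥0} {m : ℝ} (hm : 0 ≤ m)
    (hm1 : m ≤ 1) (hmν : 2 * m ≤ ν) (hc : 2 * c ^ 2 ≤ m ^ 2) (hlam : c ^ 2 ≤ lam)
    (hρ : IsSpeed ρ) (hδ1 : ∀ ε, 0 < ε → |δ ε| ≤ 1) (hδρ : ∀ ε, 0 < ε → |δ ε| ≤ ρ ε) :
    IsSetup (P.prod coin) (diagonalLift r c fun t => x t ∘ Prod.fst)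
      (signDistortion δ (diagonalLift r c x)) ρ ν fun _ => lam := by
  have := hx.isGaussianProcess.isProbabilityMeasure
  have hbound (t) := hx.eLpNorm_diagonalLift_le (r := r) hm hc t
  have hmeas (t) := (hx.measurable_diagonalLift (r := r) (c := c) t).aestronglyMeasurable (μ := P)
  rw [← ENNReal.ofReal_le_ofReal_iff ν.coe_nonneg, ENNReal.ofReal_coe_nnreal] at hmν
  refine ⟨hx.prod_coin.measurable_diagonalLift,
    fun ε _ t => measurable_signDistortion δ (hx.measurable_diagonalLift t) ε,
    hx.prod_coin.isStrictlyStationary_diagonalLift, fun t => ?_, fun ε hε t => ?_, hρ,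
    fun ε hε t => ?_,
    fun B => (hx.prod_coin.lipschitzWith_lagCov_diagonalLift hlam).lipschitzOnWith⟩
  · exact (hx.prod_coin.eLpNorm_diagonalLift_le hm hc t).trans
      ((ENNReal.ofReal_le_ofReal (by linarith)).trans hmν)
  · calc eLpNorm (signDistortion δ (diagonalLift r c x) ε t) 4 (P.prod coin)
        ≤ ENNReal.ofReal (1 + |δ ε|) * eLpNorm (diagonalLift r c x t) 4 P :=
          eLpNorm_signDistortion_le δ (hmeas t) ε 4
      _ ≤ ENNReal.ofReal 2 * ENNReal.ofReal m := by
          gcongr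
          exacts [by linarith [hδ1 ε hε], hbound t]
      _ ≤ ν := by rwa [← ENNReal.ofReal_mul zero_le_two]
  · calc eLpNorm (fun p => signDistortion δ (diagonalLift r c x) ε t p -
            diagonalLift r c x t p.1) 4 (P.prod coin)
        ≤ ENNReal.ofReal |δ ε| * eLpNorm (diagonalLift r c x t) 4 P :=
          eLpNorm_signDistortion_sub_le δ (hmeas t) ε 4
      _ ≤ ENNReal.ofReal (ρ ε) * ENNReal.ofReal 1 := by
          gcongr
          exacts [hδρ ε hε, (hbound t).trans (ENNReal.ofReal_le_ofReal hm1)]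
      _ = ENNReal.ofReal (ρ ε) := by rw [ENNReal.ofReal_one, mul_one]

theorem eLpNorm_distortedError_le_covError (hx : IsOrnsteinUhlenbeck P x) (hr : 0 < r)
    (N : ℝ → ℕ) (Δ : ℝ → ℝ≥0) (u : ℝ≥0) (ε : ℝ) :
    eLpNorm (distortedError (fun ω => c ^ 2 * scalarCov x (N ε) (lagIndex (Δ ε) u) (Δ ε) ω) (δ ε)
        (c ^ 2 * Real.exp (-u))) 2 (P.prod coin) ≤
      covError (P.prod coin) (diagonalLift r c fun t => x t ∘ Prod.fst)
        (signDistortion δ (diagonalLift r c x)) N Δ u ε := by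
  refine eLpNorm_mono fun p => ?_
  refine le_trans (le_of_eq ?_) (Matrix.norm_entry_le_entrywise_sup_norm _ (i := ⟨0, hr⟩)
    (j := ⟨0, hr⟩))
  rw [Matrix.sub_apply, empCov_signDistortion, Matrix.smul_apply, empCov_diagonalLift,
    hx.prod_coin.lagCov_diagonalLift, distortedError, smul_eq_mul]

theorem integral_distortedError_sq_le (hx : IsOrnsteinUhlenbeck P x) (hr : 0 < r) {ε B : ℝ}
    (hB : 0 ≤ B) (h : covError (P.prod coin) (diagonalLift r c fun t => x t ∘ Prod.fst)
      (signDistortion δ (diagonalLift r c x)) N Δ u ε ≤ ENNReal.ofReal B) :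
    ∫ p, distortedError (fun ω => c ^ 2 * scalarCov x (N ε) (lagIndex (Δ ε) u) (Δ ε) ω) (δ ε)
      (c ^ 2 * Real.exp (-u)) p ^ 2 ∂(P.prod coin) ≤ B ^ 2 := by
  have := hx.isGaussianProcess.isProbabilityMeasure
  exact (eLpNorm_le_ofReal_iff even_two two_ne_zero
    (memLp_distortedError ((hx.memLp_scalarCov _ _ _).const_mul _)) hB).1
    ((hx.eLpNorm_distortedError_le_covError hr N Δ u ε).trans h)

theorem tendsto_integral_scalarCov (hx : IsOrnsteinUhlenbeck P x) (h : IsAdaptiveScheme N Δ)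
    (u : ℝ≥0) :
    Tendsto (fun ε => ∫ ω, scalarCov x (N ε) (lagIndex (Δ ε) u) (Δ ε) ω ∂P) (𝓝[>] 0)
      (𝓝 (Real.exp (-u))) := by
  have hlim : Tendsto (fun ε => 4 / ((N ε : ℝ) * Δ ε) + (Δ ε : ℝ)) (𝓝[>] 0) (𝓝 0) := by
    simpa using (h.span_tendsto.const_div_atTop 4).add (NNReal.tendsto_coe.2 h.step_tendsto)
  rw [tendsto_iff_dist_tendsto_zero]
  refine squeeze_zero' (Eventually.of_forall fun _ => dist_nonneg) ?_ hlim
  filter_upwards [self_mem_nhdsWithin, h.step_tendsto.eventually_le_const zero_lt_one,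
    h.eventually_ne_zero] with ε hε hΔ1 hN
  refine (dist_triangle _ (Real.exp (-(lagIndex (Δ ε) u * Δ ε))) _).trans (add_le_add ?_ ?_)
  · exact hx.abs_integral_scalarCov_sub_le hN _ (h.step_pos ε hε) hΔ1
  · exact (abs_exp_neg_sub_exp_neg_le (by positivity) u.coe_nonneg).trans
      (abs_lagIndex_mul_sub_le (h.step_pos ε hε) u)

theorem eventually_le_covError (hx : IsOrnsteinUhlenbeck P x) (hr : 0 < r) (hc : 0 < c)
    (hρ : IsSpeed ρ) (h : IsAdaptiveScheme N Δ) (hδρ : δ =ᶠ[𝓝[>] 0] ρ) (u : ℝ≥0) :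
    ∀ᶠ ε in 𝓝[>] (0 : ℝ), ENNReal.ofReal (c ^ 2 * Real.exp (-u) * ρ ε) ≤
      covError (P.prod coin) (diagonalLift r c fun t => x t ∘ Prod.fst)
        (signDistortion δ (diagonalLift r c x)) N Δ u ε := by
  have := hx.isGaussianProcess.isProbabilityMeasure
  filter_upwards [hρ.eventually_pos, hδρ, (hx.tendsto_integral_scalarCov h u).eventually_const_lt
    (half_lt_self (Real.exp_pos _))] with ε hρε hδε hmean
  by_contra! hlt
  have hbias := abs_le_of_sq_le_sq ((sq_integral_le_integral_distortedError_sq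
    ((hx.memLp_scalarCov _ _ _).const_mul (c ^ 2))).trans
      (hx.integral_distortedError_sq_le hr (by positivity) hlt.le)) (by positivity)
  rw [integral_const_mul, hδε] at hbias
  refine hbias.not_gt ((lt_of_eq_of_lt ?_ (mul_lt_mul_of_pos_left hmean
    (by positivity : 0 < 2 * ρ ε * c ^ 2))).trans_le ((le_of_eq ?_).trans (le_abs_self _)))
  · ring
  · ring

theorem eventually_le_variance_scalarCov (hx : IsOrnsteinUhlenbeck P x)
    (h : IsAdaptiveScheme N Δ) (u : ℝ≥0) :
    ∀ᶠ ε in 𝓝[>] (0 : ℝ), Real.exp (-2) / (4 * span N Δ ε) ≤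
      Var[scalarCov x (N ε) (lagIndex (Δ ε) u) (Δ ε); P] := by
  filter_upwards [self_mem_nhdsWithin, h.step_tendsto.eventually_le_const zero_lt_one,
    h.span_tendsto.eventually_ge_atTop 2,
    h.span_tendsto.eventually_ge_atTop (256 / Real.exp (-2))] with ε hε hΔ1 htwo hlarge
  refine le_trans ?_ (hx.le_variance_scalarCov _ (h.step_pos ε hε) hΔ1 htwo)
  rw [← span] at htwo hlarge ⊢
  have hspan : 0 < span N Δ ε := two_pos.trans_le htwo
  rw [div_le_iff₀' (Real.exp_pos _)] at hlarge
  have hremainder : 64 / span N Δ ε ^ 2 ≤ Real.exp (-2) / (4 * span N Δ ε) := by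
    rw [div_le_div_iff₀ (by positivity) (by positivity), sq]
    calc 64 * (4 * span N Δ ε) = 256 * span N Δ ε := by ring
      _ ≤ Real.exp (-2) * span N Δ ε * span N Δ ε := by gcongr
      _ = Real.exp (-2) * (span N Δ ε * span N Δ ε) := mul_assoc _ _ _
  have hhalf : Real.exp (-2) / (2 * span N Δ ε) = 2 * (Real.exp (-2) / (4 * span N Δ ε)) := by
    field_simp
    norm_num
  linarith

theorem isBigO_inv_sq_span (hx : IsOrnsteinUhlenbeck P x) (hr : 0 < r) (hc : 0 < c)
    (hρ : IsSpeed ρ) (hδ0 : ∀ ε, 0 < ε → 0 ≤ δ ε) (h : IsAdaptiveScheme N Δ) {C : ℝ}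
    (hC : ∀ᶠ ε in 𝓝[>] (0 : ℝ),
      covError (P.prod coin) (diagonalLift r c fun t => x t ∘ Prod.fst)
        (signDistortion δ (diagonalLift r c x)) N Δ u ε ≤ ENNReal.ofReal (C * ρ ε)) :
    (fun ε => (ρ ε ^ 2)⁻¹) =O[𝓝[>] (0 : ℝ)] span N Δ := by
  have := hx.isGaussianProcess.isProbabilityMeasure
  set κ := c ^ 4 * Real.exp (-2) / 8 with hκ
  have hκ0 : 0 < κ := by positivity
  refine Asymptotics.IsBigO.of_bound (C ^ 2 / κ) ?_
  filter_upwards [self_mem_nhdsWithin, hC, h.span_tendsto.eventually_gt_atTop 0,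
    hx.eventually_le_variance_scalarCov h u] with ε hε hCε hspan hvar
  rw [← span] at hspan
  have hρε := hρ.1 ε hε
  have herror : c ^ 4 * Var[scalarCov x (N ε) (lagIndex (Δ ε) u) (Δ ε); P] / 2 ≤
      C ^ 2 * ρ ε ^ 2 := by
    have hle := (variance_le_integral_distortedError_sq
      ((hx.memLp_scalarCov _ _ _).const_mul (c ^ 2)) (hδ0 ε hε)).trans
      (hx.integral_distortedError_sq_le hr (by positivity) (hCε.trans
        (ENNReal.ofReal_le_ofReal (mul_le_mul_of_nonneg_right (le_abs_self C) hρε.le))))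
    rwa [variance_const_mul, ← pow_mul, mul_pow, sq_abs] at hle
  have hκspan : κ / span N Δ ε ≤ C ^ 2 * ρ ε ^ 2 :=
    calc κ / span N Δ ε = c ^ 4 * (Real.exp (-2) / (4 * span N Δ ε)) / 2 := by
          rw [hκ]
          field_simp
          norm_num
      _ ≤ c ^ 4 * Var[scalarCov x (N ε) (lagIndex (Δ ε) u) (Δ ε); P] / 2 := by gcongr
      _ ≤ C ^ 2 * ρ ε ^ 2 := herror
  rw [Real.norm_of_nonneg (by positivity), Real.norm_of_nonneg hspan.le, div_mul_eq_mul_div,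
    inv_le_iff_one_le_mul₀ (by positivity), div_mul_eq_mul_div, one_le_div hκ0]
  rw [div_le_iff₀ hspan] at hκspan
  linarith

end IsOrnsteinUhlenbeck

theorem exists_amplitude {lam J m : ℝ} (hlam : 0 < lam) (hJ : 0 < J) (hm : 0 < m) :
    ∃ c : ℝ, 0 < c ∧ c ^ 2 ≤ 1 ∧ c ^ 2 ≤ lam ∧ 3 * c ^ 2 ≤ J ∧ 2 * c ^ 2 ≤ m ^ 2 := by
  set q : ℝ := min (min 1 lam) (min (J / 3) (m ^ 2 / 2))
  have hq0 : 0 < q := by positivity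
  obtain ⟨⟨hone, hlam'⟩, hJ', hm'⟩ : (q ≤ 1 ∧ q ≤ lam) ∧ q ≤ J / 3 ∧ q ≤ m ^ 2 / 2 := by
    rw [← le_min_iff, ← le_min_iff, ← le_min_iff]
  refine ⟨√q, Real.sqrt_pos.2 hq0, ?_⟩
  rw [Real.sq_sqrt hq0.le]
  exact ⟨hone, hlam', by linarith, by linarith⟩

theorem integral_decorrelationRate_le {c J : ℝ} (hone : c ^ 2 ≤ 1) (hJ : 3 * c ^ 2 ≤ J) :
    ∫ T in Set.Ioi (1 : ℝ), (c ^ 2 + 2 * c ^ 4) * Real.exp (-T) ≤ J := by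
  have hexp : Real.exp (-1) ≤ 1 := Real.exp_le_one_iff.2 (by norm_num)
  have hpow : c ^ 4 ≤ c ^ 2 := by nlinarith [sq_nonneg c]
  rw [integral_const_mul, integral_exp_neg_Ioi]
  calc (c ^ 2 + 2 * c ^ 4) * Real.exp (-1) ≤ (c ^ 2 + 2 * c ^ 4) * 1 := by gcongr
    _ ≤ J := by linarith

theorem exists_lowerBound {ν lam : ℝ≥0} {J : ℝ} (hr : 0 < r) (hν : 0 < ν) (hlam : 0 < lam)
    (hJ : 0 < J) :
    ∃ c : ℝ≥0 → ℝ, (∀ u, 0 < c u) ∧ ∀ ρ : ℝ → ℝ, IsSpeed ρ →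
      ∃ (Ω : Type) (_ : MeasurableSpace Ω) (P : Measure Ω) (_ : IsProbabilityMeasure P)
        (X : ℝ≥0 → Ω → Fin r → ℝ) (Y : ℝ → ℝ≥0 → Ω → Fin r → ℝ) (f : ℝ → ℝ),
        IsSetup P X Y ρ ν (fun _ => lam) ∧ HasIntegrableDecorrelationRate P X f ∧
        (∫ T in Set.Ioi (1 : ℝ), f T) ≤ J ∧
        ∀ u : ℝ≥0, ∀ (N : ℝ → ℕ) (Δ : ℝ → ℝ≥0), IsAdaptiveScheme N Δ →
          (∀ᶠ ε in 𝓝[>] (0 : ℝ), ENNReal.ofReal (c u * ρ ε) ≤ covError P X Y N Δ u ε) ∧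
          ((∃ C : ℝ, ∀ᶠ ε in 𝓝[>] (0 : ℝ),
              covError P X Y N Δ u ε ≤ ENNReal.ofReal (C * ρ ε)) →
            ∀ (a b : ℝ) (N' : ℝ → ℕ) (Δ' : ℝ → ℝ≥0), IsOptimizedScheme ρ a b N' Δ' →
              span N' Δ' =O[𝓝[>] (0 : ℝ)] span N Δ) := by
  set m : ℝ := min (ν / 2) 1
  have hm : 0 < m := lt_min (half_pos (NNReal.coe_pos.2 hν)) one_pos
  have hmν : 2 * m ≤ ν := by linarith [min_le_left ((ν : ℝ) / 2) 1]
  obtain ⟨c, hc, hone, hclam, hcJ, hcm⟩ := exists_amplitude (NNReal.coe_pos.2 hlam) hJ hm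
  refine ⟨fun u => c ^ 2 * Real.exp (-u), fun u => by positivity, fun ρ hρ => ?_⟩
  obtain ⟨Ω, _, P, _, x, hx⟩ := exists_isOrnsteinUhlenbeck
  -- Truncated at `1` because `ρ` is small only near `0`, while the bounds are for all `ε`.
  set δ : ℝ → ℝ := fun ε => min (ρ ε) 1
  have hδ0 (ε : ℝ) (hε : 0 < ε) : 0 ≤ δ ε := le_min (hρ.1 ε hε).le zero_le_one
  have hδρ : δ =ᶠ[𝓝[>] 0] ρ := by
    filter_upwards [hρ.2.eventually_le_const zero_lt_one] with ε hε using min_eq_left hε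
  have hsetup := hx.isSetup_signDistortion (r := r) (δ := δ) hm.le (min_le_right _ _) hmν hcm hclam
    hρ (fun ε hε => (abs_of_nonneg (hδ0 ε hε)).trans_le (min_le_right _ _))
    (fun ε hε => (abs_of_nonneg (hδ0 ε hε)).trans_le (min_le_left _ _))
  refine ⟨Ω × Bool, inferInstance, P.prod coin, inferInstance, _, _, _, hsetup,
    hx.prod_coin.hasIntegrableDecorrelationRate_diagonalLift hc,
    integral_decorrelationRate_le hone hcJ,
    fun u N Δ h => ⟨hx.eventually_le_covError hr hc hρ h hδρ u, ?_⟩⟩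
  rintro ⟨C, hC⟩ a b N' Δ' h'
  exact (h'.isBigO_span hρ).trans (hx.isBigO_inv_sq_span hr hc hρ hδ0 h hC)

end LowerBound

end IndirectObs

theorem mainTheorem1 :
    -- optimized schemes exist for every speed, and they are adaptive sub-sampling schemes
    (∀ ρ : ℝ → ℝ, IndirectObs.IsSpeed ρ → ∀ a b : ℝ, 0 < a → 0 < b →
      (∃ (N : ℝ → ℕ) (Δ : ℝ → ℝ≥0), IndirectObs.IsOptimizedScheme ρ a b N Δ) ∧
      ∀ (N : ℝ → ℕ) (Δ : ℝ → ℝ≥0), IndirectObs.IsOptimizedScheme ρ a b N Δ →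
        IndirectObs.IsAdaptiveScheme N Δ) ∧
    -- every optimized scheme achieves the speed `ρ`, with a constant that depends only on the
    -- listed parameters
    (∀ (r : ℕ) (A ν : ℝ≥0) (J : ℝ) (Λ : ℝ≥0 → ℝ≥0) (a b : ℝ), ∃ C : ℝ,
      ∀ {Ω : Type*} [MeasurableSpace Ω] (P : Measure Ω) [IsProbabilityMeasure P]
        (X : ℝ≥0 → Ω → Fin r → ℝ) (Y : ℝ → ℝ≥0 → Ω → Fin r → ℝ) (ρ f : ℝ → ℝ)
        (N : ℝ → ℕ) (Δ : ℝ → ℝ≥0),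
        IndirectObs.IsSetup P X Y ρ ν Λ →
        IndirectObs.HasIntegrableDecorrelationRate P X f →
        (∫ T in Set.Ioi (1 : ℝ), f T) ≤ J →
        IndirectObs.IsOptimizedScheme ρ a b N Δ →
        ∀ᶠ ε in 𝓝[>] (0 : ℝ),
          (∀ u : ℝ≥0, u ≤ A →
            IndirectObs.covError P X Y N Δ u ε ≤ ENNReal.ofReal (C * ρ ε)) ∧
          IndirectObs.meanError P X Y N Δ ε ≤ ENNReal.ofReal (C * ρ ε)) ∧
    -- in every class of setups no adaptive scheme can do better than `ρ`, and no adaptive scheme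
    -- that achieves `ρ` can have a time span of smaller order than an optimized scheme
    (∀ (r : ℕ) (ν lam : ℝ≥0) (J : ℝ), 0 < r → 0 < ν → 0 < lam → 0 < J →
      ∃ c : ℝ≥0 → ℝ, (∀ u, 0 < c u) ∧
      ∀ ρ : ℝ → ℝ, IndirectObs.IsSpeed ρ →
        ∃ (Ω : Type) (_ : MeasurableSpace Ω) (P : Measure Ω) (_ : IsProbabilityMeasure P)
          (X : ℝ≥0 → Ω → Fin r → ℝ) (Y : ℝ → ℝ≥0 → Ω → Fin r → ℝ) (f : ℝ → ℝ),
          IndirectObs.IsSetup P X Y ρ ν (fun _ => lam) ∧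
          IndirectObs.HasIntegrableDecorrelationRate P X f ∧
          (∫ T in Set.Ioi (1 : ℝ), f T) ≤ J ∧
          ∀ u : ℝ≥0, ∀ (N : ℝ → ℕ) (Δ : ℝ → ℝ≥0), IndirectObs.IsAdaptiveScheme N Δ →
            (∀ᶠ ε in 𝓝[>] (0 : ℝ),
              ENNReal.ofReal (c u * ρ ε) ≤ IndirectObs.covError P X Y N Δ u ε) ∧
            ((∃ C : ℝ, ∀ᶠ ε in 𝓝[>] (0 : ℝ),
                IndirectObs.covError P X Y N Δ u ε ≤ ENNReal.ofReal (C * ρ ε)) →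
              ∀ (a b : ℝ) (N' : ℝ → ℕ) (Δ' : ℝ → ℝ≥0),
                IndirectObs.IsOptimizedScheme ρ a b N' Δ' →
                IndirectObs.span N' Δ' =O[𝓝[>] (0 : ℝ)] IndirectObs.span N Δ)) :=
  ⟨fun _ hρ _ _ ha hb => ⟨IndirectObs.exists_isOptimizedScheme hρ ha hb,
      fun _ _ h => h.isAdaptiveScheme hρ⟩,
    IndirectObs.exists_upperBound,
    fun _ _ _ _ hr hν hlam hJ => IndirectObs.exists_lowerBound hr hν hlam hJ⟩
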